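/- Let $G$ be a real Lie group with semisimple Lie algebra $\mathfrak g$ and Killing form $\langle\,,\rangle$, and let $\mathfrak g=\mathfrak g_0\oplus\mathfrak g_1$ be a symmetric decomposition, i.e. $[\mathfrak g_0,\mathfrak g_0]\subset\mathfrak g_0$, $[\mathfrak g_0,\mathfrak g_1]\subset\mathfrak g_1$, $[\mathfrak g_1,\mathfrak g_1]\subset\mathfrak g_0$. Its rank is the least dimension of the centralizer in $\mathfrak g_1$ of an element of $\mathfrak g_1$, and $A\in\mathfrak g_1$ is regular if its orbit under the isotropy representation has maximal dimension, i.e. $\dim[A,\mathfrak g_0]=\max_{X\in\mathfrak g_1}\dim[X,\mathfrak g_0]$. Let $k$ be the rank and $\mathfrak a\subset\mathfrak g_1$ a maximal Abelian subspace of dimension $k$ on which the Killing form is nondegenerate (automatic if $G/G_0$ is Riemannian), having a basis $(A_1,\dots,A_k)$ of regular elements. Put $\mathfrak m=\mathfrak a^\perp\cap\mathfrak g_1$ and $\mathfrak b=\mathfrak g_0\cap\{X\in\mathfrak g_0:[X,\mathfrak a]=0\}^\perp$, let $\mathfrak n$ satisfy $\mathfrak g_0=\mathfrak b\oplus\mathfrak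 n$, and decompose the Maurer–Cartan form of $G$ as $\theta=\theta_{\mathfrak a}+\theta_{\mathfrak m}+\theta_{\mathfrak b}+\theta_{\mathfrak n}$ along $\mathfrak g=\mathfrak a\oplus\mathfrak m\oplus\mathfrak b\oplus\mathfrak n$, with $\theta_{\mathfrak a}=\sum_i\theta_{\mathfrak a}^iA_i$. The $G/G_0$-exterior differential system is the Pfaffian system with independence condition on $G\times\mathfrak m$ associated with the Cartan tableau $\mathfrak m\to\mathrm{Hom}(\mathfrak a,\mathfrak b)$, $V\mapsto-\mathrm{ad}_V$: it is generated, as a differential ideal, by the components of $$\theta_{\mathfrak b}-[\theta_{\mathfrak a},V],\qquad \theta_{\mathfrak m},\qquad \theta_{\mathfrak n},$$ with independence condition $\theta_{\mathfrak a}^1\wedge\cdots\wedge\theta_{\mathfrak a}^k\neq0$. Its integral manifolds are the smooth immersions $(g,V):M\to G\times\mathfrak m$ of $k$-dimensional manifolds on which the ideal vanishes and the independence condition holds at every point. A generalized solution of Terng's $G/G_0$-system on a $k$-dimensional manifold $M$ is a pair of smooth maps $f:M\to\mathfrak a$, $V:M\to\mathfrak m$ such that $f$ is a local diffeomorphism and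 $\vartheta=df+[df,V]$ satisfies the Maurer–Cartan equation $d\vartheta(v,w)+[\vartheta(v),\vartheta(w)]=0$. A framed solution is a pair of smooth maps $g:M\to G$, $V:M\to\mathfrak m$ for which there is a generalized solution $(f,V)$ with $g^{-1}dg=df+[df,V]$. Then: 1. Let $M$ be a $k$-dimensional manifold. Every framed solution $(g,V)$ on $M$ is an integral manifold of the $G/G_0$-exterior differential system. A pair of maps $(g,V):M\to G\times\mathfrak m$ is an integral manifold if and only if every point of $M$ has an open neighbourhood on which $(g,V)$ restricts to a framed solution; if $M$ is simply connected, $(g,V)$ is an integral manifold if and only if it is a framed solution on $M$. 2. For $U\subset\mathfrak a$ open and $V$ defined on $U$ with values in $\mathfrak m$, $V$ is a smooth solution of the $G/G_0$-system $$[A_i,V_{x_j}]-[A_j,V_{x_i}]=[[A_i,V],[A_j,V]]\qquad(i\neq j),$$ where the $x_i$ are the coordinates with respect to $(A_1,\dots,A_k)$, if and only if the inclusion $U\hookrightarrow\mathfrak a$ together with $V$ is a generalized solution. 3. The $G/G_0$-exterior differential system is in involution: at every point of $G\times\mathfrak m$ there is an ordinary $k$-dimensional integral element satisfying the independence condition.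 Every ordinary integral flag ending in such an element has Cartan characters $s_1=\dim\mathfrak m$ and $s_j=0$ for $j\geq2$; that is, in the sense of Cartan–Kähler theory, the general solution depends on $\dim\mathfrak m$ functions of one variable. -/

import Mathlib

open scoped Manifold ContDiff Topology
open Module

noncomputable section

namespace TerngSystem

/-! ### Pfaffian systems on manifolds without boundary -/

section Pfaffian

variable {W : Type*} [NormedAddCommGroup W] [NormedSpace ℝ W] {H : Type*} [TopologicalSpace H]
  {I : ModelWithCorners ℝ W H} {N : Type*} [TopologicalSpace N] [ChartedSpace H N]
  {F : Type*} [NormedAddCommGroup F] [NormedSpace ℝ F]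

/-- The expression of a vector-valued 1-form in the preferred chart at `y₀`, that is, its
pull-back under the inverse of that chart. -/
def localForm (η : ∀ y : N, TangentSpace I y →L[ℝ] F) (y₀ : N) (z : W) : W →L[ℝ] F :=
  ((η ((extChartAt I y₀).symm z)).comp (mfderiv 𝓘(ℝ, W) I (extChartAt I y₀).symm z)).comp
    (NormedSpace.fromTangentSpace (𝕜 := ℝ) z).symm.toContinuousLinearMap

/-- The exterior derivative, in the chart at `y₀`:
`dη(v, w) = D_v (η(w)) - D_w (η(v))` for constant `v`, `w`. -/
def localExtDeriv (η : ∀ y : N, TangentSpace I y →L[ℝ] F) (y₀ : N) (z v w : W) : F :=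
  fderiv ℝ (localForm η y₀) z v w - fderiv ℝ (localForm η y₀) z w v

/-- The exterior derivative `dη` of a vector-valued 1-form on a manifold. -/
def extDerivOneForm (η : ∀ y : N, TangentSpace I y →L[ℝ] F) (y : N) (v w : TangentSpace I y) : F :=
  localExtDeriv η y (extChartAt I y y)
    (mvfderiv I (extChartAt I y) y v) (mvfderiv I (extChartAt I y) y w)

variable (I N F) in
/-- A Pfaffian system with independence condition `(𝓘, ω)` on `N`: the components of the
`F`-valued 1-form `form` generate `𝓘` as a differential ideal (so `𝓘` is generated algebraically by
the components of `form` and of its exterior derivative), and `indep` is the `k`-form `ω`. -/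
structure PfaffianSystem (k : ℕ) where
  form : ∀ y : N, TangentSpace I y →L[ℝ] F
  indep : ∀ y : N, TangentSpace I y [⋀^Fin k]→ₗ[ℝ] ℝ

namespace PfaffianSystem

variable {k : ℕ} (S : PfaffianSystem I N F k)

/-- `E ∈ V_k(𝓘, ω)(y)`: a `k`-dimensional subspace of `T_y N` on which all the elements of `𝓘`
vanish and on which `ω` does not vanish. -/
structure IsIntegralElement (y : N) (E : Submodule ℝ (TangentSpace I y)) : Prop where
  finrank_eq : finrank ℝ E = k
  form_eq_zero : ∀ v ∈ E, S.form y v = 0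
  extDeriv_eq_zero : ∀ v ∈ E, ∀ w ∈ E, extDerivOneForm S.form y v w = 0
  indep_ne_zero : ∃ e : Fin k → TangentSpace I y, (∀ i, e i ∈ E) ∧ S.indep y e ≠ 0

/-- An integral manifold of `(𝓘, ω)`: a smooth immersion all of whose tangent spaces are integral
elements in `V_k(𝓘, ω)`. -/
structure IsIntegralManifold {EM : Type*} [NormedAddCommGroup EM] [NormedSpace ℝ EM]
    {M : Type*} [TopologicalSpace M] [ChartedSpace EM M] (Ψ : M → N) : Prop where
  smooth : ContMDiff 𝓘(ℝ, EM) I ∞ Ψ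
  immersion : ∀ x, Function.Injective (mfderiv 𝓘(ℝ, EM) I Ψ x)
  integral : ∀ x, S.IsIntegralElement (Ψ x)
    (LinearMap.range (mfderiv 𝓘(ℝ, EM) I Ψ x).toLinearMap)

/-- The functions whose common zeros, among the `p`-frames `(z, e₁, …, e_p)` in the chart at `y₀`,
are the frames of the `p`-dimensional integral elements. -/
def frameEquations (y₀ : N) (p : ℕ) (q : W × (Fin p → W)) :
    (Fin p → F) × (Fin p → Fin p → F) :=
  (fun a => localForm S.form y₀ q.1 (q.2 a),
    fun a b => localExtDeriv S.form y₀ q.1 (q.2 a) (q.2 b))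

/-- The polar space `H(E) = {v | η(v) = 0, dη(v, e_a) = 0 for all a}` of the integral element
spanned by the frame `(z, e₁, …, e_p)` in the chart at `y₀`. -/
def polarSpace (y₀ : N) {p : ℕ} (q : W × (Fin p → W)) : Submodule ℝ W :=
  LinearMap.ker (localForm S.form y₀ q.1).toLinearMap ⊓
    ⨅ a : Fin p, LinearMap.ker ((fderiv ℝ (localForm S.form y₀) q.1).flip (q.2 a) -
      fderiv ℝ (localForm S.form y₀) q.1 (q.2 a)).toLinearMap

/-- A frame at `y`, read in the preferred chart at `y`. -/
def localFrame (y : N) {p : ℕ} (e : Fin p → TangentSpace I y) : W × (Fin p → W) :=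
  (extChartAt I y y, fun a => mvfderiv I (extChartAt I y) y (e a))

/-- The span of the frame `e` is a Kähler-ordinary integral element: near it, the integral elements
are cut out by finitely many of the equations (or linear combinations of them) whose differentials
are linearly independent there. -/
structure IsKahlerOrdinary (y : N) {p : ℕ} (e : Fin p → TangentSpace I y) : Prop where
  linearIndependent : LinearIndependent ℝ e
  integral : S.frameEquations y p (localFrame y e) = 0
  ordinary : ∃ (c : ℕ) (l : ((Fin p → F) × (Fin p → Fin p → F)) →L[ℝ] (Fin c → ℝ)),
    Function.Surjective (fderiv ℝ (fun q => l (S.frameEquations y p q)) (localFrame y e)) ∧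
    ∀ᶠ q in 𝓝 (localFrame y e), l (S.frameEquations y p q) = 0 → S.frameEquations y p q = 0

/-- The span of the frame `e` is a Kähler-regular integral element: it is Kähler-ordinary, and the
dimension of the polar space is constant on the nearby integral elements. -/
structure IsKahlerRegular (y : N) {p : ℕ} (e : Fin p → TangentSpace I y) : Prop extends
    S.IsKahlerOrdinary y e where
  regular : ∀ᶠ q in 𝓝 (localFrame y e), S.frameEquations y p q = 0 →
    finrank ℝ (S.polarSpace y q) = finrank ℝ (S.polarSpace y (localFrame y e))

/-- `E_p = span (e₁, …, e_p)`, `0 ≤ p ≤ k`, is an ordinary integral flag ending in `V_k(𝓘, ω)(y)`. -/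
structure IsOrdinaryFlag (y : N) (e : Fin k → TangentSpace I y) : Prop where
  integral : S.IsIntegralElement y (Submodule.span ℝ (Set.range e))
  regular : ∀ (p : ℕ) (hp : p < k), S.IsKahlerRegular y (fun a => e (Fin.castLE hp.le a))
  ordinary : S.IsKahlerOrdinary y e

/-- The system is in involution: through every point there is an ordinary integral element in
`V_k(𝓘, ω)`, i.e. one that is the last element of an ordinary flag. -/
def InInvolution : Prop :=
  ∀ y : N, ∃ E : Submodule ℝ (TangentSpace I y), S.IsIntegralElement y E ∧
    ∃ e : Fin k → TangentSpace I y, Submodule.span ℝ (Set.range e) = E ∧ S.IsOrdinaryFlag y e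

/-- The numbers `c_p` of the flag spanned by `e`: the codimension in `T_y N` of the polar space of
`E_p` for `p < k`, and `c_k = dim N - k`. -/
def polarCodim (y : N) (e : Fin k → TangentSpace I y) (p : ℕ) : ℤ :=
  if hp : p < k then
    (finrank ℝ W : ℤ) - finrank ℝ (S.polarSpace y (localFrame y fun a => e (Fin.castLE hp.le a)))
  else (finrank ℝ W : ℤ) - k

/-- The Cartan characters of the flag spanned by `e`: `s_0 = c_0`, `s_p = c_p - c_{p-1}` for
`1 ≤ p ≤ k`; by convention `s_p = 0` for `p > k`. -/
def cartanCharacter (y : N) (e : Fin k → TangentSpace I y) : ℕ → ℤ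
  | 0 => S.polarCodim y e 0
  | p + 1 => if p + 1 ≤ k then S.polarCodim y e (p + 1) - S.polarCodim y e p else 0

/-- In the sense of Cartan–Kähler theory, the general integral manifold depends on `s` functions of
`q` variables: the system is in involution, and for every ordinary flag the character `s_q` is `s`
and the characters of higher index vanish. -/
def GeneralSolutionDependsOn (s q : ℕ) : Prop :=
  S.InInvolution ∧ ∀ (y : N) (e : Fin k → TangentSpace I y), S.IsOrdinaryFlag y e →
    S.cartanCharacter y e q = s ∧ ∀ j, q < j → S.cartanCharacter y e j = 0

end PfaffianSystem

end Pfaffian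

/-! ### Symmetric decompositions and the Cartan tableau -/

section Algebra

variable (L : Type*) [LieRing L] [LieAlgebra ℝ L]

/-- A symmetric decomposition `𝔤 = 𝔤₀ ⊕ 𝔤₁`. -/
structure SymmetricDecomposition where
  g₀ : Submodule ℝ L
  g₁ : Submodule ℝ L
  isCompl : IsCompl g₀ g₁
  lie₀₀ : ∀ X ∈ g₀, ∀ Y ∈ g₀, ⁅X, Y⁆ ∈ g₀
  lie₀₁ : ∀ X ∈ g₀, ∀ Y ∈ g₁, ⁅X, Y⁆ ∈ g₁
  lie₁₁ : ∀ X ∈ g₁, ∀ Y ∈ g₁, ⁅X, Y⁆ ∈ g₀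

variable {L}

/-- The orthogonal complement with respect to the Killing form. -/
def killingPerp (s : Submodule ℝ L) : Submodule ℝ L := (killingForm ℝ L).orthogonal s

namespace SymmetricDecomposition

variable (D : SymmetricDecomposition L)

/-- `[A, 𝔤₀]`, the tangent space at `A` of the orbit of `A` under the isotropy group `Ad(G₀)`. -/
def orbitTangent (A : L) : Submodule ℝ L := D.g₀.map (LieAlgebra.ad ℝ L A)

/-- `A ∈ 𝔤₁` is regular if its orbit under `Ad(G₀)` has the largest dimension among the orbits
in `𝔤₁`. -/
def IsRegular (A : L) : Prop :=
  A ∈ D.g₁ ∧ ∀ X ∈ D.g₁, finrank ℝ (D.orbitTangent X) ≤ finrank ℝ (D.orbitTangent A)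

/-- The rank: the least dimension of the centralizer in `𝔤₁` of an element of `𝔤₁`. -/
def rank : ℕ :=
  sInf {d | ∃ X ∈ D.g₁,
    d = finrank ℝ (D.g₁ ⊓ LinearMap.ker (LieAlgebra.ad ℝ L X) : Submodule ℝ L)}

/-- `𝔞` is a maximal Abelian subspace of `𝔤₁`, of dimension the rank, on which the Killing form is
nondegenerate. -/
structure IsCartanSubspace (a : Submodule ℝ L) : Prop where
  le : a ≤ D.g₁
  abelian : ∀ X ∈ a, ∀ Y ∈ a, ⁅X, Y⁆ = 0
  maximal : ∀ a' : Submodule ℝ L, a ≤ a' → a' ≤ D.g₁ →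
    (∀ X ∈ a', ∀ Y ∈ a', ⁅X, Y⁆ = 0) → a' = a
  finrank_eq : finrank ℝ a = D.rank
  nondegenerate : Disjoint a (killingPerp a)

/-- `𝔪 = 𝔞^⊥ ∩ 𝔤₁`. -/
def m (a : Submodule ℝ L) : Submodule ℝ L := killingPerp a ⊓ D.g₁

/-- `(𝔤₀)_𝔞 = {X ∈ 𝔤₀ | [X, 𝔞] = 0}`. -/
def centralizer₀ (a : Submodule ℝ L) : Submodule ℝ L where
  carrier := {X | X ∈ D.g₀ ∧ ∀ A ∈ a, ⁅X, A⁆ = 0}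
  add_mem' := fun hX hY =>
    ⟨D.g₀.add_mem hX.1 hY.1, fun A hA => by rw [add_lie, hX.2 A hA, hY.2 A hA, add_zero]⟩
  zero_mem' := ⟨D.g₀.zero_mem, fun A _ => zero_lie A⟩
  smul_mem' := fun c X hX =>
    ⟨D.g₀.smul_mem c hX.1, fun A hA => by rw [smul_lie, hX.2 A hA, smul_zero]⟩

/-- `𝔟 = 𝔤₀ ∩ (𝔤₀)_𝔞^⊥`. -/
def b (a : Submodule ℝ L) : Submodule ℝ L := D.g₀ ⊓ killingPerp (D.centralizer₀ a)

variable {D} {a : Submodule ℝ L}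

theorem lie_mem_b (ha : D.IsCartanSubspace a) {X A : L} (hX : X ∈ D.m a) (hA : A ∈ a) :
    ⁅X, A⁆ ∈ D.b a := by
  refine ⟨D.lie₁₁ X hX.2 A (ha.le hA), ?_⟩
  intro Y hY
  have h1 : ⁅A, Y⁆ = 0 := by rw [← lie_skew, hY.2 A hA, neg_zero]
  have h2 := LieModule.traceForm_apply_lie_apply ℝ L L Y A X
  have h3 : killingForm ℝ L Y ⁅A, X⁆ = 0 := by
    change LieModule.traceForm ℝ L L Y ⁅A, X⁆ = 0
    rw [← h2, hY.2 A hA]; simp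
  change killingForm ℝ L Y ⁅X, A⁆ = 0
  rw [← lie_skew, map_neg, h3, neg_zero]

/-- The Cartan tableau: `𝔪 → Hom(𝔞, 𝔟)`, `X ↦ -ad_X`. -/
def cartanTableau (ha : D.IsCartanSubspace a) : D.m a →ₗ[ℝ] (a →ₗ[ℝ] D.b a) where
  toFun X :=
    { toFun := fun A => ⟨-⁅(X : L), (A : L)⁆, (D.b a).neg_mem (lie_mem_b ha X.2 A.2)⟩
      map_add' := fun A B => by ext; simp [lie_add]; abel
      map_smul' := fun c A => by ext; simp [lie_smul, -lie_skew] }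
  map_add' := fun X Y => by ext A; simp [add_lie]; abel
  map_smul' := fun c X => by ext A; simp [smul_lie, -lie_skew]

end SymmetricDecomposition

/-- `𝔤 = 𝔞 ⊕ 𝔟 ⊕ 𝔠`. -/
structure IsSplitting (a b c : Submodule ℝ L) : Prop where
  left : IsCompl a (b ⊔ c)
  middle : IsCompl b (a ⊔ c)
  right : IsCompl c (a ⊔ b)

theorem isSplitting_of_four {g₀ g₁ a m b n : Submodule ℝ L} (h : IsCompl g₀ g₁)
    (h1 : a ⊔ m = g₁) (h1' : Disjoint a m) (h0 : b ⊔ n = g₀) (h0' : Disjoint b n) :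
    IsSplitting a b (m ⊔ n) := by
  have key : ∀ A ∈ a, ∀ M ∈ m, ∀ B ∈ b, ∀ C ∈ n, A + M + (B + C) = 0 →
      A = 0 ∧ M = 0 ∧ B = 0 ∧ C = 0 := by
    intro A hA M hM B hB C hC e
    have e1 : A + M ∈ g₁ := h1 ▸ Submodule.add_mem_sup hA hM
    have e0 : B + C ∈ g₀ := h0 ▸ Submodule.add_mem_sup hB hC
    have e2 : A + M ∈ g₀ := by
      rw [eq_neg_of_add_eq_zero_left e]; exact g₀.neg_mem e0
    have z1 : A + M = 0 := Submodule.disjoint_def.1 h.disjoint _ e2 e1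
    have z0 : B + C = 0 := by rw [z1, zero_add] at e; exact e
    have zA : A = 0 := Submodule.disjoint_def.1 h1' A hA (by
      rw [eq_neg_of_add_eq_zero_left z1]; exact m.neg_mem hM)
    have zB : B = 0 := Submodule.disjoint_def.1 h0' B hB (by
      rw [eq_neg_of_add_eq_zero_left z0]; exact n.neg_mem hC)
    subst zA; subst zB
    exact ⟨rfl, by simpa using z1, rfl, by simpa using z0⟩
  have top : a ⊔ m ⊔ (b ⊔ n) = ⊤ := by rw [h1, h0, sup_comm]; exact h.sup_eq_top
  refine ⟨⟨?_, ?_⟩, ⟨?_, ?_⟩, ⟨?_, ?_⟩⟩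
  · rw [Submodule.disjoint_def]
    intro X hX hX'
    obtain ⟨B, hB, Z, hZ, rfl⟩ := Submodule.mem_sup.1 hX'
    obtain ⟨M, hM, C, hC, rfl⟩ := Submodule.mem_sup.1 hZ
    exact (key _ (a.neg_mem hX) M hM B hB C hC (by abel)) |>.1 |> neg_eq_zero.1
  · rw [codisjoint_iff, ← top]; simp only [sup_left_comm, sup_comm]
  · rw [Submodule.disjoint_def]
    intro X hX hX'
    obtain ⟨A, hA, Z, hZ, rfl⟩ := Submodule.mem_sup.1 hX'
    obtain ⟨M, hM, C, hC, rfl⟩ := Submodule.mem_sup.1 hZ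
    exact (key A hA M hM _ (b.neg_mem hX) C hC (by abel)) |>.2.2.1 |> neg_eq_zero.1
  · rw [codisjoint_iff, ← top]; simp only [sup_left_comm, sup_comm]
  · rw [Submodule.disjoint_def]
    intro X hX hX'
    obtain ⟨A, hA, B, hB, rfl⟩ := Submodule.mem_sup.1 hX'
    obtain ⟨M, hM, C, hC, e⟩ := Submodule.mem_sup.1 hX
    have := key A hA _ (m.neg_mem hM) B hB _ (n.neg_mem hC) (by
      have : A + -M + (B + -C) = (A + B) - (M + C) := by abel
      rw [this, e, sub_self])
    rw [this.1, this.2.2.1, add_zero]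
  · rw [codisjoint_iff, ← top]; simp only [sup_left_comm, sup_comm]

theorem SymmetricDecomposition.isSplitting [FiniteDimensional ℝ L]
    {D : SymmetricDecomposition L} {a n : Submodule ℝ L} (ha : D.IsCartanSubspace a)
    (hn : D.b a ⊔ n = D.g₀) (hn' : Disjoint (D.b a) n) :
    IsSplitting a (D.b a) (D.m a ⊔ n) := by
  have hc : IsCompl a (killingPerp a) :=
    (LinearMap.BilinForm.isCompl_orthogonal_iff_disjoint
      (LieModule.traceForm_isSymm ℝ L L).isRefl).2 ha.nondegenerate
  refine isSplitting_of_four D.isCompl ?_ (ha.nondegenerate.mono_right inf_le_left) hn hn'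
  apply le_antisymm (sup_le ha.le inf_le_right)
  intro X hX
  obtain ⟨A, hA, Y, hY, rfl⟩ := Submodule.mem_sup.1
    (show X ∈ a ⊔ killingPerp a by rw [hc.sup_eq_top]; trivial)
  refine Submodule.add_mem_sup hA ⟨hY, ?_⟩
  simpa using D.g₁.sub_mem hX (ha.le hA)

end Algebra

/-! ### The Lie algebra and the Maurer–Cartan form of a Lie group -/

section Group

variable (E : Type*) [NormedAddCommGroup E] [NormedSpace ℝ E]
  (G : Type*) [TopologicalSpace G] [ChartedSpace E G] [Group G]

/-- The Lie algebra `T_1 G` of `G`, with the bracket of left-invariant vector fields. (It is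
`GroupLieAlgebra`, together with the norm of the model space.) -/
def LieAlg : Type _ := GroupLieAlgebra 𝓘(ℝ, E) G

instance : NormedAddCommGroup (LieAlg E G) := inferInstanceAs (NormedAddCommGroup E)

instance : NormedSpace ℝ (LieAlg E G) := inferInstanceAs (NormedSpace ℝ E)

instance [FiniteDimensional ℝ E] : FiniteDimensional ℝ (LieAlg E G) :=
  inferInstanceAs (FiniteDimensional ℝ E)

instance instLieGroupMinSmoothness [LieGroup 𝓘(ℝ, E) ∞ G] :
    LieGroup 𝓘(ℝ, E) (minSmoothness ℝ 3) G :=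
  LieGroup.of_le (n := ∞) (by
    rw [minSmoothness_of_isRCLikeNormedField]; exact ENat.LEInfty.out)

/-- The bracket of `GroupLieAlgebra`, that is, of left-invariant vector fields. -/
def lieAlgBracket (X Y : GroupLieAlgebra 𝓘(ℝ, E) G) : GroupLieAlgebra 𝓘(ℝ, E) G := ⁅X, Y⁆

instance [FiniteDimensional ℝ E] [LieGroup 𝓘(ℝ, E) ∞ G] : LieRing (LieAlg E G) where
  bracket X Y := lieAlgBracket E G X Y
  add_lie X Y Z := by
    have := FiniteDimensional.complete ℝ E
    exact add_lie (L := GroupLieAlgebra 𝓘(ℝ, E) G) (M := GroupLieAlgebra 𝓘(ℝ, E) G) X Y Z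
  lie_add X Y Z := by
    have := FiniteDimensional.complete ℝ E
    exact lie_add (L := GroupLieAlgebra 𝓘(ℝ, E) G) (M := GroupLieAlgebra 𝓘(ℝ, E) G) X Y Z
  lie_self X := by
    have := FiniteDimensional.complete ℝ E
    exact lie_self (L := GroupLieAlgebra 𝓘(ℝ, E) G) X
  leibniz_lie X Y Z := by
    have := FiniteDimensional.complete ℝ E
    exact leibniz_lie (L₁ := GroupLieAlgebra 𝓘(ℝ, E) G) (L₂ := GroupLieAlgebra 𝓘(ℝ, E) G)
      (M := GroupLieAlgebra 𝓘(ℝ, E) G) X Y Z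

instance [FiniteDimensional ℝ E] [LieGroup 𝓘(ℝ, E) ∞ G] : LieAlgebra ℝ (LieAlg E G) where
  lie_smul c X Y := by
    have := FiniteDimensional.complete ℝ E
    exact lie_smul (R := ℝ) (L := GroupLieAlgebra 𝓘(ℝ, E) G)
      (M := GroupLieAlgebra 𝓘(ℝ, E) G) c X Y

variable {E G}

/-- The Maurer–Cartan form `g⁻¹ dg`: the derivative at `g` of `x ↦ g⁻¹ x`. -/
def maurerCartan (g : G) : TangentSpace 𝓘(ℝ, E) g →L[ℝ] LieAlg E G :=
  (mfderiv 𝓘(ℝ, E) 𝓘(ℝ, E) (fun x : G => g⁻¹ * x) g :)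

end Group

/-! ### The Pfaffian system of a tableau -/

section Tableau

variable {E : Type*} [NormedAddCommGroup E] [NormedSpace ℝ E] [FiniteDimensional ℝ E]
  {G : Type*} [TopologicalSpace G] [ChartedSpace E G] [Group G] [LieGroup 𝓘(ℝ, E) ∞ G]
  {P : Type*} [NormedAddCommGroup P] [NormedSpace ℝ P]

variable (E G P) in
/-- The pull-back to `G × P` of the Maurer–Cartan form of `G`. -/
def maurerCartanProd (y : G × P) :
    TangentSpace (𝓘(ℝ, E).prod 𝓘(ℝ, P)) y →L[ℝ] LieAlg E G :=
  (maurerCartan y.1).comp (mfderiv (𝓘(ℝ, E).prod 𝓘(ℝ, P)) 𝓘(ℝ, E) Prod.fst y)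

/-- The Pfaffian system on `G × P` of the tableau in `Hom(𝔞, 𝔟)` parametrized by `Q`, for a
splitting `𝔤 = 𝔞 ⊕ 𝔟 ⊕ 𝔠` and a basis `A` of `𝔞`: if `θ = θ_𝔞 + θ_𝔟 + θ_𝔠` is the Maurer–Cartan
form, the generators are the components of `θ_𝔟 - Q_p(θ_𝔞)` and of `θ_𝔠`, and the independence
form is `α¹ ∧ ⋯ ∧ αᵏ`, where `θ_𝔞 = ∑ αⁱ A_i`. -/
def tableauSystem {a b c : Submodule ℝ (LieAlg E G)} (h : IsSplitting a b c)
    (Q : P →ₗ[ℝ] (a →ₗ[ℝ] b)) {k : ℕ} (A : Basis (Fin k) ℝ a) :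
    PfaffianSystem (𝓘(ℝ, E).prod 𝓘(ℝ, P)) (G × P) (b × c) k where
  form y :=
    (LinearMap.toContinuousLinearMap
      ((b.projectionOnto (a ⊔ c) h.middle - (Q y.2).comp (a.projectionOnto (b ⊔ c) h.left)).prod
        (c.projectionOnto (a ⊔ b) h.right))).comp (maurerCartanProd E G P y)
  indep y := A.det.compLinearMap
    ((a.projectionOnto (b ⊔ c) h.left).comp (maurerCartanProd E G P y).toLinearMap)

/-- The `G/G₀`-exterior differential system: the Pfaffian system on `G × 𝔪` associated with the
Cartan tableau, for the splitting `𝔤 = 𝔞 ⊕ 𝔟 ⊕ (𝔪 ⊕ 𝔫)`, where `𝔤₀ = 𝔟 ⊕ 𝔫`. Its equations are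
`θ_𝔟 = [θ_𝔞, V]`, `θ_𝔪 = θ_𝔫 = 0`. -/
def terngEDS {D : SymmetricDecomposition (LieAlg E G)} {a n : Submodule ℝ (LieAlg E G)}
    (ha : D.IsCartanSubspace a) (hn : D.b a ⊔ n = D.g₀) (hn' : Disjoint (D.b a) n)
    {k : ℕ} (A : Basis (Fin k) ℝ a) :
    PfaffianSystem (𝓘(ℝ, E).prod 𝓘(ℝ, D.m a)) (G × D.m a)
      (D.b a × (D.m a ⊔ n : Submodule ℝ (LieAlg E G))) k :=
  tableauSystem (SymmetricDecomposition.isSplitting ha hn hn')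
    (SymmetricDecomposition.cartanTableau ha) A

end Tableau

/-! ### The `G/G₀`-system, generalized solutions and framed solutions -/

section Solutions

variable {E : Type*} [NormedAddCommGroup E] [NormedSpace ℝ E] [FiniteDimensional ℝ E]
  {G : Type*} [TopologicalSpace G] [ChartedSpace E G] [Group G] [LieGroup 𝓘(ℝ, E) ∞ G]
  (D : SymmetricDecomposition (LieAlg E G)) {a : Submodule ℝ (LieAlg E G)}

/-- `V : U ⊆ 𝔞 → 𝔪` is a solution of the `G/G₀`-system:
`[A_i, V_{x_j}] - [A_j, V_{x_i}] = [[A_i, V], [A_j, V]]` for `i ≠ j`, where the `x_i` are the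
coordinates with respect to the basis `A` of `𝔞`. -/
structure IsSolution {k : ℕ} (A : Basis (Fin k) ℝ a) (U : Set a) (V : a → D.m a) : Prop where
  smooth : ContDiffOn ℝ ∞ V U
  equation : ∀ x ∈ U, ∀ i j : Fin k, i ≠ j →
    ⁅(A i : LieAlg E G), (fderiv ℝ V x (A j) : LieAlg E G)⁆ -
        ⁅(A j : LieAlg E G), (fderiv ℝ V x (A i) : LieAlg E G)⁆ =
      ⁅⁅(A i : LieAlg E G), (V x : LieAlg E G)⁆, ⁅(A j : LieAlg E G), (V x : LieAlg E G)⁆⁆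

/-- The linear map `𝔞 → 𝔤`, `A ↦ A + [A, X]`. -/
def addLie (a : Submodule ℝ (LieAlg E G)) (X : LieAlg E G) : a →L[ℝ] LieAlg E G :=
  LinearMap.toContinuousLinearMap
    { toFun := fun A => (A : LieAlg E G) + ⁅(A : LieAlg E G), X⁆
      map_add' := fun A B => by simp only [Submodule.coe_add, add_lie]; abel
      map_smul' := fun c A => by simp [smul_lie] }

variable {EM : Type*} [NormedAddCommGroup EM] [NormedSpace ℝ EM]
  {M : Type*} [TopologicalSpace M] [ChartedSpace EM M]

/-- The `𝔤`-valued 1-form `df + [df, V]` on `M`. -/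
def solutionForm (f : M → a) (V : M → D.m a) (x : M) :
    TangentSpace 𝓘(ℝ, EM) x →L[ℝ] LieAlg E G :=
  (addLie a (V x : LieAlg E G)).comp (mvfderiv 𝓘(ℝ, EM) f x)

/-- A `𝔤`-valued 1-form satisfies the Maurer–Cartan equation `dθ(v, w) + [θ(v), θ(w)] = 0`. -/
def IsFlat (θ : ∀ x : M, TangentSpace 𝓘(ℝ, EM) x →L[ℝ] LieAlg E G) : Prop :=
  ∀ (x : M) (v w : TangentSpace 𝓘(ℝ, EM) x), extDerivOneForm θ x v w + ⁅θ x v, θ x w⁆ = 0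

/-- `(f, V)` is a generalized solution of the `G/G₀`-system: `f` is a local diffeomorphism and
`df + [df, V]` satisfies the Maurer–Cartan equation. -/
structure IsGeneralizedSolution (f : M → a) (V : M → D.m a) : Prop where
  localDiffeo : IsLocalDiffeomorph 𝓘(ℝ, EM) 𝓘(ℝ, a) ∞ f
  smooth : ContMDiff 𝓘(ℝ, EM) 𝓘(ℝ, D.m a) ∞ V
  flat : IsFlat (solutionForm (EM := EM) D f V)

/-- `(g, V)` is a framed solution of the `G/G₀`-system: `g⁻¹ dg = df + [df, V]` for some
generalized solution `(f, V)`. -/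
def IsFramedSolution (g : M → G) (V : M → D.m a) : Prop :=
  ContMDiff 𝓘(ℝ, EM) 𝓘(ℝ, E) ∞ g ∧ ∃ f : M → a, IsGeneralizedSolution (EM := EM) D f V ∧
    ∀ x : M, (maurerCartan (g x)).comp (mfderiv 𝓘(ℝ, EM) 𝓘(ℝ, E) g x) =
      solutionForm (EM := EM) D f V x

end Solutions

end TerngSystem

end

noncomputable section

set_option linter.unusedSectionVars false

namespace TerngSystem

/-! ### The algebra of a Cartan subspace -/

section KillingAlgebra

variable {L : Type*} [LieRing L] [LieAlgebra ℝ L]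

/-! Let θ be the Maurer–Cartan form pulled back along g and α its 𝔞-component. The linear equations
of the system say precisely that θ = α + [α, V] (`tableau_eq_zero_iff`). Since 𝔞 is Abelian, the
bracket of two values of α + [α, V] reduces by the Jacobi identity to a term [[α, V], [α, V]]
(`lie_add_lie_add`), and this term lies in 𝔟 (`lie_lie_mem_b`). The structure equation dθ + [θ, θ] =
0 then gives dα = 0 (`localExtDeriv_alphaForm`). So α = df locally, and globally when M is simply
connected; the independence condition makes f a local diffeomorphism, and the flatness of df + [df,
V] is the structure equation again. Integral manifolds and framed solutions therefore differ only by
the existence of a primitive of α (`isIntegralManifold_iff`, `isFramedSolution_iff`). For f an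
inclusion U ⊆ 𝔞, flatness evaluated on pairs of basis vectors is the G/G₀-system (`flat_iff`).

Involution rests on two algebraic facts. For regular A in 𝔞, ad A maps 𝔪 bijectively onto 𝔟
(`eq_zero_of_isRegular`, `exists_lie_eq_of_isRegular`). Moreover ad A and (ad A)² have the same
kernel on 𝔤₁ (`lie_eq_zero_of_lie_lie_eq_zero`), so ad A is also injective on 𝔟. This second fact
holds for every A in 𝔞: the 𝔤₁-part of a nilpotent part of A would lie in 𝔞 and be orthogonal to 𝔞.

Consequently, if dη vanishes between a vector whose 𝔞-component C has ad C : 𝔪 → 𝔟 onto and each of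
two others, all annihilated by η, it vanishes between these two: apply ad C to the missing equation
(`adMB_eq_of_adMB_eq`). So only the polar equations of the first vector of a flag count. The polar
space has dimension k + dim 𝔪 for E_0 and k for every later E_p, which yields s_1 = dim 𝔪 and s_j =
0 for j ≥ 2. An arbitrary ordinary flag may start with a vector whose 𝔞-component does not have this
property; Kähler regularity allows it to be perturbed without changing the dimension of the polar
space (`finrank_polarSpace_one`). -/

theorem killingForm_lie_left (X Y Z : L) :
    killingForm ℝ L ⁅X, Y⁆ Z = killingForm ℝ L X ⁅Y, Z⁆ :=
  LieModule.traceForm_apply_lie_apply ℝ L L X Y Z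

theorem killingForm_lie_swap (X Y Z : L) :
    killingForm ℝ L ⁅X, Y⁆ Z = -killingForm ℝ L Y ⁅X, Z⁆ := by
  rw [← lie_skew, map_neg, LinearMap.neg_apply, killingForm_lie_left]

theorem killingForm_comm (X Y : L) : killingForm ℝ L X Y = killingForm ℝ L Y X :=
  LieModule.traceForm_comm ℝ L L X Y

attribute [local instance] LieRing.ofAssociativeRing

open LieAlgebra in
/-- A form of the Jordan decomposition in a Lie algebra with nondegenerate Killing form: the
nilpotent part of `ad A` is `ad x` for some `x` commuting with all elements that commute with `A`,
and `ad x` agrees with `ad A` on the kernel of `(ad A)²`. -/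
theorem exists_nilpotent_part [FiniteDimensional ℝ L] [IsKilling ℝ L] (A : L) :
    ∃ x : L, IsNilpotent (ad ℝ L x) ∧ (∀ B : L, ⁅A, B⁆ = 0 → ⁅x, B⁆ = 0) ∧
      ∀ y : L, ⁅A, ⁅A, y⁆⁆ = 0 → ⁅x, y⁆ = ⁅A, y⁆ := by
  have ad_inj : ∀ x y : L, ad ℝ L x = ad ℝ L y → x = y := by
    intro x y h
    have : x - y ∈ center ℝ L := by
      rw [LieModule.mem_maxTrivSubmodule]
      intro z
      have h1 := LinearMap.congr_fun h z
      simp only [ad_apply] at h1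
      rw [← lie_skew, sub_lie, h1, sub_self, neg_zero]
    rw [LieAlgebra.center_eq_bot, LieSubmodule.mem_bot] at this
    exact sub_eq_zero.1 this
  obtain ⟨N, hN₀, S, hS₀, hN, hS, hT⟩ := (ad ℝ L A).exists_isNilpotent_isSemisimple
  have hNT : Commute (ad ℝ L A) N := Algebra.commute_of_mem_adjoin_self hN₀
  have hNS : Commute N S := Algebra.commute_of_mem_adjoin_singleton_of_commute hS₀ hNT.symm
  -- `ad N` is a polynomial p in `ad (ad A)`, and `ad (ad A)` preserves the image of `ad`. So [N, ad
  -- y] = ad (δ y) with δ = p(ad A).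
  have hadN := ad_mem_adjoin_of_isNilpotent hNS hN hS
  rw [← hT, Algebra.adjoin_singleton_eq_range_aeval] at hadN
  obtain ⟨p, hp⟩ := hadN
  have ad_end : ∀ f g : Module.End ℝ L, ad ℝ (Module.End ℝ L) f g = f * g - g * f :=
    fun f g => rfl
  have ad_lie : ∀ X Y : L, ad ℝ L ⁅X, Y⁆ = ad ℝ L X * ad ℝ L Y - ad ℝ L Y * ad ℝ L X :=
    fun X Y => (ad ℝ L).map_lie X Y
  have hpow : ∀ (i : ℕ) (y : L), ((ad ℝ (Module.End ℝ L) (ad ℝ L A)) ^ i) (ad ℝ L y) =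
      ad ℝ L (((ad ℝ L A) ^ i) y) := by
    intro i
    induction i with
    | zero => intro y; simp
    | succ i ih =>
      intro y
      rw [pow_succ, pow_succ, Module.End.mul_apply, Module.End.mul_apply, ad_end, ← ad_lie, ih]
      rfl
  set δ : Module.End ℝ L := Polynomial.aeval (ad ℝ L A) p with hδ
  have hδN : ∀ y, N * ad ℝ L y - ad ℝ L y * N = ad ℝ L (δ y) := by
    intro y
    rw [← ad_end, ← hp, hδ]
    change Polynomial.aeval (ad ℝ (Module.End ℝ L) (ad ℝ L A)) p (ad ℝ L y) = _
    rw [Polynomial.aeval_eq_sum_range, Polynomial.aeval_eq_sum_range, LinearMap.sum_apply,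
      LinearMap.sum_apply, map_sum]
    refine Finset.sum_congr rfl fun i _ => ?_
    rw [LinearMap.smul_apply, LinearMap.smul_apply, map_smul, hpow]
  -- Taking the commutator with N is a derivation and `ad` is injective, so δ is a derivation of the
  -- Lie algebra. Derivations being inner here, δ = ad x.
  have hder : ∀ y z : L, δ ⁅y, z⁆ = ⁅y, δ z⁆ - ⁅z, δ y⁆ := by
    intro y z
    apply ad_inj
    rw [← hδN, map_sub, ad_lie, ad_lie, ad_lie, ← hδN, ← hδN]
    noncomm_ring
  obtain ⟨x, hx⟩ := LieDerivation.IsKilling.exists_eq_ad (⟨δ, hder⟩ : LieDerivation ℝ L L)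
  have hxδ : ∀ y, ⁅x, y⁆ = δ y := fun y => by
    have := LieDerivation.congr_fun hx y
    simpa using this
  have hxδ' : ad ℝ L x = δ := LinearMap.ext hxδ
  refine ⟨x, ?_, ?_, ?_⟩
  · obtain ⟨r, hr⟩ := LieAlgebra.ad_nilpotent_of_nilpotent (R := ℝ) hN
    refine ⟨r, LinearMap.ext fun y => ad_inj _ _ ?_⟩
    have : ∀ (i : ℕ) (y : L), ((ad ℝ (Module.End ℝ L) N) ^ i) (ad ℝ L y) =
        ad ℝ L (((ad ℝ L x) ^ i) y) := by
      intro i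
      induction i with
      | zero => intro y; simp
      | succ i ih =>
        intro y
        rw [pow_succ, pow_succ, Module.End.mul_apply, Module.End.mul_apply, ad_end, hδN, ih, hxδ']
    rw [← this, hr]; simp
  · intro B hB
    rw [hxδ]
    apply ad_inj
    have hc : Commute (ad ℝ L B) (ad ℝ L A) := by
      have := ad_lie A B
      rw [hB, map_zero] at this
      exact (sub_eq_zero.1 this.symm).symm
    have := Algebra.commute_of_mem_adjoin_singleton_of_commute hN₀ hc
    rw [← hδN, map_zero, this.eq, sub_self]
  · intro y hy
    rw [hxδ]
    apply ad_inj
    -- `ad y` lies in the generalized 0-eigenspace of `ad (ad A)`. The semisimple operator `ad S`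
    -- differs from `ad (ad A)` by the nilpotent `ad N`, so it acts there by the eigenvalue itself,
    -- that is, by 0. Hence [ad A, ad y] = [N, ad y].
    have hmem : ad ℝ L y ∈ ((ad ℝ (Module.End ℝ L) (ad ℝ L A)).genEigenspace 0) (2 : ℕ) := by
      rw [Module.End.mem_genEigenspace_nat, LinearMap.mem_ker, zero_smul, sub_zero, hpow]
      have : ((ad ℝ L A) ^ 2) y = ⁅A, ⁅A, y⁆⁆ := by rw [pow_two]; rfl
      rw [this, hy, map_zero]
    have h0 := Module.End.apply_eq_of_mem_of_comm_of_isFinitelySemisimple_of_isNil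
      (g := ad ℝ (Module.End ℝ L) S) hmem
      (LieAlgebra.commute_ad_of_commute (Algebra.commute_of_mem_adjoin_self hS₀))
      (LieAlgebra.ad_isSemisimple_of_isSemisimple hS).isFinitelySemisimple
      (by rw [hT, map_add, add_sub_cancel_right]
          exact LieAlgebra.ad_nilpotent_of_nilpotent (R := ℝ) hN)
    rw [zero_smul, ad_end] at h0
    rw [← hδN, ad_lie, hT, add_mul, mul_add, add_sub_add_comm, h0, add_zero]

/-- `ad x` and `ad B` commute, so their product is nilpotent and has trace zero. -/
theorem killingForm_eq_zero_of_isNilpotent {x B : L} (hx : IsNilpotent (LieAlgebra.ad ℝ L x))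
    (h : ⁅x, B⁆ = 0) : killingForm ℝ L x B = 0 := by
  have hc : Commute (LieAlgebra.ad ℝ L x) (LieAlgebra.ad ℝ L B) := by
    have h1 : LieAlgebra.ad ℝ L ⁅x, B⁆ = LieAlgebra.ad ℝ L x * LieAlgebra.ad ℝ L B -
      LieAlgebra.ad ℝ L B * LieAlgebra.ad ℝ L x := (LieAlgebra.ad ℝ L).map_lie x B
    rw [h, map_zero] at h1
    exact sub_eq_zero.1 h1.symm
  rw [killingForm_apply_apply]
  exact (LinearMap.isNilpotent_trace_of_isNilpotent (hc.isNilpotent_mul_right hx)).eq_zero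

namespace SymmetricDecomposition

variable (D : SymmetricDecomposition L)

theorem lie₁₀ {X Y : L} (hX : X ∈ D.g₁) (hY : Y ∈ D.g₀) : ⁅X, Y⁆ ∈ D.g₁ := by
  rw [← lie_skew]; exact D.g₁.neg_mem (D.lie₀₁ Y hY X hX)

theorem exists_add (X : L) : ∃ X₀ ∈ D.g₀, ∃ X₁ ∈ D.g₁, X₀ + X₁ = X :=
  Submodule.mem_sup.1 (by rw [D.isCompl.sup_eq_top]; trivial)

theorem eq_zero_of_mem {X : L} (h₀ : X ∈ D.g₀) (h₁ : X ∈ D.g₁) : X = 0 :=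
  Submodule.disjoint_def.1 D.isCompl.disjoint X h₀ h₁

theorem eq_zero_of_add_eq_zero {X Y : L} (hX : X ∈ D.g₀) (hY : Y ∈ D.g₁) (h : X + Y = 0) :
    X = 0 ∧ Y = 0 := by
  have : X = 0 := D.eq_zero_of_mem hX (by
    rw [eq_neg_of_add_eq_zero_left h]; exact D.g₁.neg_mem hY)
  exact ⟨this, by rwa [this, zero_add] at h⟩

/-- The two summands are orthogonal for the Killing form. -/
theorem killingForm_eq_zero {X Y : L} (hX : X ∈ D.g₀) (hY : Y ∈ D.g₁) :
    killingForm ℝ L X Y = 0 := by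
  set P := D.g₀.projection D.g₁ D.isCompl with hP
  set T := LieAlgebra.ad ℝ L X * LieAlgebra.ad ℝ L Y with hT
  have hP₀ : ∀ Z ∈ D.g₀, P Z = Z := fun Z hZ => by
    simpa [hP] using Submodule.projection_apply_left D.isCompl ⟨Z, hZ⟩
  have hP₁ : ∀ Z ∈ D.g₁, P Z = 0 := fun Z hZ => by
    simpa [hP] using hZ
  -- T interchanges 𝔤₀ and 𝔤₁, so its diagonal blocks for the decomposition vanish, and with them
  -- its trace.
  have h1 : P * T = T * (1 - P) := by
    ext Z
    obtain ⟨Z₀, h₀, Z₁, h₁, rfl⟩ := D.exists_add Z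
    simp only [hT, map_add, Module.End.mul_apply, LieAlgebra.ad_apply, LinearMap.sub_apply,
      Module.End.one_apply, hP₀ Z₀ h₀, hP₁ Z₁ h₁, sub_self, sub_zero, lie_zero, zero_add]
    rw [hP₁ _ (D.lie₀₁ X hX _ (D.lie₁₀ hY h₀)), hP₀ _ (D.lie₀₀ X hX _ (D.lie₁₁ Y hY _ h₁))]
    simp
  have hPP : P * P = P := by
    ext Z
    obtain ⟨Z₀, h₀, Z₁, h₁, rfl⟩ := D.exists_add Z
    simp [hP₀ Z₀ h₀, hP₁ Z₁ h₁]
  have h2 : LinearMap.trace ℝ L (P * T) = 0 := by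
    rw [← hPP, mul_assoc, LinearMap.trace_mul_comm, h1, mul_assoc, sub_mul, one_mul, hPP,
      sub_self, mul_zero, map_zero]
  have h3 : LinearMap.trace ℝ L (T * P) = LinearMap.trace ℝ L T := by
    have : T * P = T - P * T := by rw [h1]; noncomm_ring
    rw [this, map_sub, h2, sub_zero]
  rw [killingForm_apply_apply]
  change LinearMap.trace ℝ L T = 0
  rw [← h3, LinearMap.trace_mul_comm, h2]

end SymmetricDecomposition
end KillingAlgebra

/-! ### Regular elements and the action of 𝔞 between 𝔪 and 𝔟 -/

section CartanSubspace

variable {L : Type*} [LieRing L] [LieAlgebra ℝ L]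

namespace SymmetricDecomposition

variable {D : SymmetricDecomposition L} {a : Submodule ℝ L}

theorem mem_of_commute (ha : D.IsCartanSubspace a) {X : L} (hX : X ∈ D.g₁)
    (h : ∀ A ∈ a, ⁅X, A⁆ = 0) : X ∈ a := by
  have h' : ∀ A ∈ a, ⁅A, X⁆ = 0 := fun A hA => by rw [← lie_skew, h A hA, neg_zero]
  have := ha.maximal (a ⊔ Submodule.span ℝ {X}) le_sup_left
    (sup_le ha.le ((Submodule.span_singleton_le_iff_mem _ _).2 hX)) (by
      intro Y hY Z hZ
      obtain ⟨A, hA, Y', hY', rfl⟩ := Submodule.mem_sup.1 hY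
      obtain ⟨B, hB, Z', hZ', rfl⟩ := Submodule.mem_sup.1 hZ
      obtain ⟨s, rfl⟩ := Submodule.mem_span_singleton.1 hY'
      obtain ⟨t, rfl⟩ := Submodule.mem_span_singleton.1 hZ'
      simp [ha.abelian A hA B hB, h B hB, h' A hA])
  rw [← this]
  exact Submodule.mem_sup_right (Submodule.mem_span_singleton_self X)

theorem isCompl_killingPerp [FiniteDimensional ℝ L] (ha : D.IsCartanSubspace a) :
    IsCompl a (killingPerp a) :=
  (LinearMap.BilinForm.isCompl_orthogonal_iff_disjoint
    (LieModule.traceForm_isSymm ℝ L L).isRefl).2 ha.nondegenerate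

theorem eq_zero_of_orthogonal (ha : D.IsCartanSubspace a) {X : L} (hX : X ∈ a)
    (h : ∀ B ∈ a, killingForm ℝ L X B = 0) : X = 0 :=
  Submodule.disjoint_def.1 ha.nondegenerate X hX fun B hB => by
    change killingForm ℝ L B X = 0
    rw [killingForm_comm]; exact h B hB

/-- On `𝔤₁`, the square of `ad A`, `A ∈ 𝔞`, has the same kernel as `ad A`. -/
theorem lie_eq_zero_of_lie_lie_eq_zero [FiniteDimensional ℝ L] [LieAlgebra.IsKilling ℝ L]
    (ha : D.IsCartanSubspace a) {A V : L} (hA : A ∈ a) (hV : V ∈ D.g₁) (h : ⁅A, ⁅A, V⁆⁆ = 0) :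
    ⁅A, V⁆ = 0 := by
  -- Split x = x₀ + x₁. Since x commutes with 𝔞, so does x₁, and x₁ ∈ 𝔞 by maximality. Nilpotency
  -- makes x₁ orthogonal to 𝔞, so x₁ = 0. Then [A, V] = [x₀, V] lies in both 𝔤₀ and 𝔤₁.
  obtain ⟨x, hx, hxB, hxy⟩ := exists_nilpotent_part A
  obtain ⟨x₀, h₀, x₁, h₁, rfl⟩ := D.exists_add x
  have hcomm : ∀ B ∈ a, ⁅x₁, B⁆ = 0 := by
    intro B hB
    have := hxB B (ha.abelian A hA B hB)
    rw [add_lie, add_comm] at this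
    exact (D.eq_zero_of_add_eq_zero (D.lie₁₁ _ h₁ _ (ha.le hB)) (D.lie₀₁ _ h₀ _ (ha.le hB)) this).1
  have hx₁ : x₁ = 0 := by
    refine eq_zero_of_orthogonal ha (mem_of_commute ha h₁ hcomm) fun B hB => ?_
    have := killingForm_eq_zero_of_isNilpotent hx (hxB B (ha.abelian A hA B hB))
    rwa [map_add, LinearMap.add_apply, D.killingForm_eq_zero h₀ (ha.le hB), zero_add] at this
  have h2 := hxy V h
  rw [hx₁, add_zero] at h2
  exact D.eq_zero_of_mem (D.lie₁₁ _ (ha.le hA) _ hV) (h2 ▸ D.lie₀₁ _ h₀ _ hV)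

theorem m_le : D.m a ≤ D.g₁ := inf_le_right

theorem exists_add_m [FiniteDimensional ℝ L] (ha : D.IsCartanSubspace a) {X : L}
    (hX : X ∈ D.g₁) : ∃ A ∈ a, ∃ V ∈ D.m a, A + V = X := by
  obtain ⟨A, hA, Y, hY, rfl⟩ := Submodule.mem_sup.1
    (show X ∈ a ⊔ killingPerp a by rw [(isCompl_killingPerp ha).sup_eq_top]; trivial)
  exact ⟨A, hA, Y, ⟨hY, by simpa using D.g₁.sub_mem hX (ha.le hA)⟩, rfl⟩

theorem lie_lie_comm {L : Type*} [LieRing L] {A B V : L} (h : ⁅A, B⁆ = 0) : ⁅A, ⁅B, V⁆⁆ = ⁅B, ⁅A, V⁆⁆ := by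
  rw [leibniz_lie, h, zero_lie, zero_add]

/-- For Z centralizing 𝔞, `ad Z` is skew for the Killing form and commutes with `ad A` and `ad B`,
while `ad B ∘ ad A` is symmetric. Hence the pairing of [B, [A, V]] with [Z, V] equals its own
negative, and the pairing of Z with the double bracket reduces to it. -/
theorem lie_lie_mem_b (ha : D.IsCartanSubspace a) {A B V : L} (hA : A ∈ a) (hB : B ∈ a)
    (hV : V ∈ D.m a) : ⁅⁅A, V⁆, ⁅B, V⁆⁆ ∈ D.b a := by
  have hV₁ := m_le hV
  refine ⟨D.lie₀₀ _ (D.lie₁₁ _ (ha.le hA) _ hV₁) _ (D.lie₁₁ _ (ha.le hB) _ hV₁), fun Z hZ => ?_⟩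
  change killingForm ℝ L Z ⁅⁅A, V⁆, ⁅B, V⁆⁆ = 0
  have hZA := hZ.2 A hA
  have hZB := hZ.2 B hB
  have hAB : ⁅A, B⁆ = 0 := ha.abelian A hA B hB
  have e1 : ⁅Z, ⁅B, ⁅A, V⁆⁆⁆ = ⁅B, ⁅A, ⁅Z, V⁆⁆⁆ := by
    rw [lie_lie_comm hZB, lie_lie_comm hZA]
  have e2 : killingForm ℝ L ⁅B, ⁅A, V⁆⁆ ⁅Z, V⁆ = 0 := by
    have h1 : killingForm ℝ L ⁅B, ⁅A, V⁆⁆ ⁅Z, V⁆ = -killingForm ℝ L ⁅Z, ⁅B, ⁅A, V⁆⁆⁆ V := by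
      rw [killingForm_lie_swap Z, neg_neg]
    have h2 : killingForm ℝ L ⁅B, ⁅A, ⁅Z, V⁆⁆⁆ V = killingForm ℝ L ⁅B, ⁅A, V⁆⁆ ⁅Z, V⁆ := by
      rw [killingForm_lie_swap B, killingForm_lie_swap A, neg_neg, lie_lie_comm hAB,
        killingForm_comm]
    rw [e1, h2] at h1
    linarith
  have e3 : ⁅Z, ⁅B, V⁆⁆ = ⁅B, ⁅Z, V⁆⁆ := lie_lie_comm hZB
  rw [killingForm_comm, killingForm_lie_left, ← lie_skew ⁅B, V⁆ Z, e3, map_neg, killingForm_comm,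
    killingForm_lie_swap, neg_neg, killingForm_comm, e2]

/-- The Killing-orthogonal complement of [A, 𝔤₀] is 𝔤₀ plus the centralizer of A in 𝔤₁. This links
the two notions in play: a largest orbit means a smallest centralizer, so regular elements are those
whose centralizer in 𝔤₁ has dimension the rank. -/
theorem centralizer₁_finrank [FiniteDimensional ℝ L] [LieAlgebra.IsKilling ℝ L]
    (D : SymmetricDecomposition L) {A : L} (hA : A ∈ D.g₁) :
    finrank ℝ (D.orbitTangent A) +
      finrank ℝ (D.g₁ ⊓ LinearMap.ker (LieAlgebra.ad ℝ L A) : Submodule ℝ L) =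
      finrank ℝ D.g₁ := by
  have horth : (killingForm ℝ L).orthogonal (D.orbitTangent A) =
      D.g₀ ⊔ (D.g₁ ⊓ LinearMap.ker (LieAlgebra.ad ℝ L A)) := by
    ext X
    constructor
    · intro hX
      obtain ⟨X₀, h₀, X₁, h₁, rfl⟩ := D.exists_add X
      refine Submodule.add_mem_sup h₀ ⟨h₁, ?_⟩
      change ⁅A, X₁⁆ = 0
      refine (LieAlgebra.IsKilling.killingForm_nondegenerate ℝ L).1 _ fun Y => ?_
      obtain ⟨Y₀, hY₀, Y₁, hY₁, rfl⟩ := D.exists_add Y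
      have h2 : killingForm ℝ L ⁅A, Y₀⁆ (X₀ + X₁) = 0 := hX _ ⟨Y₀, hY₀, rfl⟩
      rw [map_add, killingForm_comm _ X₀, D.killingForm_eq_zero h₀ (D.lie₁₀ hA hY₀), zero_add,
        killingForm_comm] at h2
      rw [map_add, D.killingForm_eq_zero (D.lie₁₁ _ hA _ h₁) hY₁, add_zero, killingForm_lie_swap,
        h2, neg_zero]
    · intro hX
      obtain ⟨X₀, h₀, X₁, h₁, rfl⟩ := Submodule.mem_sup.1 hX
      rintro _ ⟨Y, hY, rfl⟩
      change killingForm ℝ L ⁅A, Y⁆ (X₀ + X₁) = 0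
      have h3 : ⁅A, X₁⁆ = 0 := h₁.2
      rw [map_add, killingForm_comm _ X₀, D.killingForm_eq_zero h₀ (D.lie₁₀ hA hY), zero_add,
        killingForm_lie_swap, h3, map_zero, neg_zero]
  have h1 := LinearMap.BilinForm.finrank_orthogonal
    (LieAlgebra.IsKilling.killingForm_nondegenerate ℝ L) (D.orbitTangent A)
  have h2 := Submodule.finrank_add_eq_of_isCompl D.isCompl
  have h3 : finrank ℝ (D.g₀ ⊔ (D.g₁ ⊓ LinearMap.ker (LieAlgebra.ad ℝ L A)) : Submodule ℝ L) =
      finrank ℝ D.g₀ +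
        finrank ℝ (D.g₁ ⊓ LinearMap.ker (LieAlgebra.ad ℝ L A) : Submodule ℝ L) := by
    rw [← Submodule.finrank_sup_add_finrank_inf_eq,
      (D.isCompl.disjoint.mono_right inf_le_left).eq_bot, finrank_bot, add_zero]
  have h4 : finrank ℝ (D.orbitTangent A) ≤ finrank ℝ L := Submodule.finrank_le _
  rw [horth, h3] at h1
  omega

theorem exists_finrank_centralizer_eq_rank (D : SymmetricDecomposition L) : ∃ X ∈ D.g₁,
    D.rank = finrank ℝ (D.g₁ ⊓ LinearMap.ker (LieAlgebra.ad ℝ L X) : Submodule ℝ L) :=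
  Nat.sInf_mem (s := {d | ∃ X ∈ D.g₁,
    d = finrank ℝ (D.g₁ ⊓ LinearMap.ker (LieAlgebra.ad ℝ L X) : Submodule ℝ L)})
    ⟨_, 0, D.g₁.zero_mem, rfl⟩

/-- The centralizer in `𝔤₁` of a regular element of `𝔞` is `𝔞`. -/
theorem mem_of_isRegular [FiniteDimensional ℝ L] [LieAlgebra.IsKilling ℝ L]
    (ha : D.IsCartanSubspace a) {A X : L} (hA : A ∈ a) (hreg : D.IsRegular A) (hX : X ∈ D.g₁)
    (h : ⁅A, X⁆ = 0) : X ∈ a := by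
  obtain ⟨X₀, hX₀, hr⟩ := D.exists_finrank_centralizer_eq_rank
  have h1 := D.centralizer₁_finrank hX₀
  have h2 := D.centralizer₁_finrank hreg.1
  have h3 := hreg.2 X₀ hX₀
  have h4 := ha.finrank_eq
  have hle : a ≤ D.g₁ ⊓ LinearMap.ker (LieAlgebra.ad ℝ L A) :=
    fun Y hY => ⟨ha.le hY, ha.abelian A hA Y hY⟩
  -- The centralizer of A contains 𝔞, and its dimension is at most the rank, which is dim 𝔞.
  rw [Submodule.eq_of_le_of_finrank_le hle (by omega)]
  exact ⟨hX, h⟩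

theorem eq_zero_of_isRegular [FiniteDimensional ℝ L] [LieAlgebra.IsKilling ℝ L]
    (ha : D.IsCartanSubspace a) {A V : L} (hA : A ∈ a) (hreg : D.IsRegular A) (hV : V ∈ D.m a)
    (h : ⁅A, V⁆ = 0) : V = 0 :=
  Submodule.disjoint_def.1 ha.nondegenerate V (mem_of_isRegular ha hA hreg hV.2 h) hV.1

/-- `ad A` maps `𝔪` onto `𝔟`, for a regular element `A` of `𝔞`. -/
theorem exists_lie_eq_of_isRegular [FiniteDimensional ℝ L] [LieAlgebra.IsKilling ℝ L]
    (ha : D.IsCartanSubspace a) {A Y : L} (hA : A ∈ a) (hreg : D.IsRegular A) (hY : Y ∈ D.b a) :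
    ∃ V ∈ D.m a, ⁅A, V⁆ = Y := by
  have hA₁ := ha.le hA
  have hmem : Y ∈ D.g₁.map (LieAlgebra.ad ℝ L A) := by
    -- It suffices that Y be orthogonal to everything orthogonal to [A, 𝔤₁]. The 𝔤₀-part X₀ of such
    -- an element commutes with A; so each [X₀, B] with B ∈ 𝔞 centralizes A, lies in 𝔞, and is
    -- orthogonal to 𝔞 by invariance of the form. It therefore vanishes, X₀ centralizes 𝔞, and Y ∈ 𝔟
    -- is orthogonal to X₀.
    rw [← LinearMap.BilinForm.orthogonal_orthogonal
      (LieAlgebra.IsKilling.killingForm_nondegenerate ℝ L)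
      (LieModule.traceForm_isSymm ℝ L L).isRefl (D.g₁.map (LieAlgebra.ad ℝ L A))]
    intro X hX
    obtain ⟨X₀, h₀, X₁, h₁, rfl⟩ := D.exists_add X
    have hAX : ⁅A, X₀⁆ = 0 := by
      refine (LieAlgebra.IsKilling.killingForm_nondegenerate ℝ L).1 _ fun Z => ?_
      obtain ⟨Z₀, hZ₀, Z₁, hZ₁, rfl⟩ := D.exists_add Z
      have h2 : killingForm ℝ L ⁅A, Z₁⁆ (X₀ + X₁) = 0 := hX _ ⟨Z₁, hZ₁, rfl⟩
      rw [map_add, D.killingForm_eq_zero (D.lie₁₁ _ hA₁ _ hZ₁) h₁, add_zero,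
        killingForm_comm] at h2
      rw [map_add, killingForm_comm _ Z₀, D.killingForm_eq_zero hZ₀ (D.lie₁₀ hA₁ h₀), zero_add,
        killingForm_lie_swap, h2, neg_zero]
    have hX₀ : X₀ ∈ D.centralizer₀ a := by
      refine ⟨h₀, fun B hB => ?_⟩
      have hXB : ⁅X₀, B⁆ ∈ a := by
        refine mem_of_isRegular ha hA hreg (D.lie₀₁ _ h₀ _ (ha.le hB)) ?_
        rw [leibniz_lie, hAX, ha.abelian A hA B hB, zero_lie, lie_zero, add_zero]
      refine eq_zero_of_orthogonal ha hXB fun C hC => ?_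
      rw [killingForm_lie_left, ha.abelian B hB C hC, map_zero]
    change killingForm ℝ L (X₀ + X₁) Y = 0
    rw [map_add, LinearMap.add_apply, killingForm_comm X₁, D.killingForm_eq_zero hY.1 h₁, add_zero]
    exact hY.2 X₀ hX₀
  obtain ⟨X, hX, rfl⟩ := hmem
  obtain ⟨B, hB, V, hV, rfl⟩ := exists_add_m ha hX
  refine ⟨V, hV, ?_⟩
  simp [ha.abelian A hA B hB]

theorem lie_mem_b' (ha : D.IsCartanSubspace a) {A X : L} (hA : A ∈ a) (hX : X ∈ D.m a) :
    ⁅A, X⁆ ∈ D.b a := by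
  rw [← lie_skew]; exact (D.b a).neg_mem (lie_mem_b ha hX hA)

variable (D) in
/-- The bracket `𝔪 → 𝔟` with an element of `𝔞`. -/
def adMB (ha : D.IsCartanSubspace a) : a →ₗ[ℝ] D.m a →ₗ[ℝ] D.b a :=
  LinearMap.mk₂ ℝ (fun A V => ⟨⁅(A : L), (V : L)⁆, lie_mem_b' ha A.2 V.2⟩)
    (fun A B V => by ext; simp) (fun c A V => by ext; simp)
    (fun A V W => by ext; simp) (fun c A V => by ext; simp)

@[simp]
theorem coe_adMB (ha : D.IsCartanSubspace a) (A : a) (V : D.m a) :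
    (D.adMB ha A V : L) = ⁅(A : L), (V : L)⁆ := rfl

theorem adMB_injective_of_isRegular [FiniteDimensional ℝ L] [LieAlgebra.IsKilling ℝ L]
    (ha : D.IsCartanSubspace a) {A : a} (hreg : D.IsRegular (A : L)) :
    Function.Injective (D.adMB ha A) := by
  rw [injective_iff_map_eq_zero]
  intro V hV
  exact Subtype.ext (eq_zero_of_isRegular ha A.2 hreg V.2 (congrArg Subtype.val hV))

theorem finrank_b_eq [FiniteDimensional ℝ L] [LieAlgebra.IsKilling ℝ L]
    (ha : D.IsCartanSubspace a) {A : a} (hreg : D.IsRegular (A : L)) :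
    finrank ℝ (D.b a) = finrank ℝ (D.m a) := by
  refine (LinearEquiv.ofBijective (D.adMB ha A)
    ⟨adMB_injective_of_isRegular ha hreg, ?_⟩).finrank_eq.symm
  intro Y
  obtain ⟨V, hV, h⟩ := exists_lie_eq_of_isRegular ha A.2 hreg Y.2
  exact ⟨⟨V, hV⟩, Subtype.ext h⟩

/-- If `ad A : 𝔪 → 𝔟` is bijective, then `ad A` is injective on `𝔟`. -/
theorem eq_zero_of_lie_b_eq_zero [FiniteDimensional ℝ L] [LieAlgebra.IsKilling ℝ L]
    (ha : D.IsCartanSubspace a) {A : a} (hs : Function.Surjective (D.adMB ha A)) {Y : L}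
    (hY : Y ∈ D.b a) (h : ⁅(A : L), Y⁆ = 0) : Y = 0 := by
  obtain ⟨V, hV⟩ := hs ⟨Y, hY⟩
  have hV' : ⁅(A : L), (V : L)⁆ = Y := congrArg Subtype.val hV
  rw [← hV'] at h ⊢
  exact lie_eq_zero_of_lie_lie_eq_zero ha A.2 (m_le V.2) h

/-- Every X centralizes itself, so rank zero is attained only at X = 0, whose centralizer is all of
𝔤₁. This settles the degenerate case k = 0, where s_1 is zero by convention. -/
theorem m_eq_bot_of_rank_eq_zero [FiniteDimensional ℝ L] (h : D.rank = 0) : D.m a = ⊥ := by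
  obtain ⟨X, hX, hr⟩ := D.exists_finrank_centralizer_eq_rank
  rw [h] at hr
  have h0 := Submodule.finrank_eq_zero.1 hr.symm
  have hX0 : X = 0 := by
    rw [← Submodule.mem_bot ℝ, ← h0]
    exact ⟨hX, lie_self X⟩
  rw [hX0, map_zero, LinearMap.ker_zero, inf_top_eq] at h0
  exact le_bot_iff.1 (h0 ▸ m_le)

/-- The first-order equation satisfied by the tangent vectors `(A, P)` and `(B, Q)` of a solution
through `V` follows from the same equations against a third vector `(C, R)`, if `ad C` is
bijective. -/
theorem adMB_eq_of_adMB_eq [FiniteDimensional ℝ L] [LieAlgebra.IsKilling ℝ L]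
    (ha : D.IsCartanSubspace a) {A B C : a} {P Q R V : D.m a}
    (hs : Function.Surjective (D.adMB ha C))
    (hA : ⁅(C : L), (P : L)⁆ - ⁅(A : L), (R : L)⁆ = ⁅⁅(C : L), (V : L)⁆, ⁅(A : L), (V : L)⁆⁆)
    (hB : ⁅(C : L), (Q : L)⁆ - ⁅(B : L), (R : L)⁆ = ⁅⁅(C : L), (V : L)⁆, ⁅(B : L), (V : L)⁆⁆) :
    ⁅(A : L), (Q : L)⁆ - ⁅(B : L), (P : L)⁆ = ⁅⁅(A : L), (V : L)⁆, ⁅(B : L), (V : L)⁆⁆ := by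
  -- The defect of the missing equation lies in 𝔟, where `ad C` is injective. After applying `ad C`
  -- and substituting the two known equations, the R-terms cancel because `ad A` and `ad B` commute,
  -- and the rest cancels by the Jacobi identity.
  rw [← sub_eq_zero]
  refine eq_zero_of_lie_b_eq_zero ha hs ((D.b a).sub_mem ((D.b a).sub_mem (lie_mem_b' ha A.2 Q.2)
    (lie_mem_b' ha B.2 P.2)) (lie_lie_mem_b ha A.2 B.2 V.2)) ?_
  have hCA : ⁅(C : L), (A : L)⁆ = 0 := ha.abelian _ C.2 _ A.2
  have hCB : ⁅(C : L), (B : L)⁆ = 0 := ha.abelian _ C.2 _ B.2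
  have hAB : ⁅(A : L), (B : L)⁆ = 0 := ha.abelian _ A.2 _ B.2
  rw [lie_sub, lie_sub, lie_lie_comm hCA, lie_lie_comm hCB, eq_add_of_sub_eq hA,
    eq_add_of_sub_eq hB, lie_add, lie_add, lie_lie_comm hAB, leibniz_lie (A : L) ⁅(C : L), (V : L)⁆,
    leibniz_lie (B : L) ⁅(C : L), (V : L)⁆, leibniz_lie (C : L) ⁅(A : L), (V : L)⁆,
    lie_lie_comm (V := (V : L)) hCA, lie_lie_comm (V := (V : L)) hCB, lie_lie_comm (V := (V : L)) hAB,
    ← lie_skew ⁅(B : L), ⁅(C : L), (V : L)⁆⁆]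
  abel

end SymmetricDecomposition
end CartanSubspace

/-! ### Calculus of vector-valued 1-forms -/

section Forms

variable {W : Type*} [NormedAddCommGroup W] [NormedSpace ℝ W] {H : Type*} [TopologicalSpace H]
  {I : ModelWithCorners ℝ W H} {N : Type*} [TopologicalSpace N] [ChartedSpace H N]
  {W' : Type*} [NormedAddCommGroup W'] [NormedSpace ℝ W'] {H' : Type*} [TopologicalSpace H']
  {J : ModelWithCorners ℝ W' H'} {M : Type*} [TopologicalSpace M] [ChartedSpace H' M]
  {F : Type*} [NormedAddCommGroup F] [NormedSpace ℝ F]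
  {F' : Type*} [NormedAddCommGroup F'] [NormedSpace ℝ F']

theorem localForm_apply (η : ∀ y : N, TangentSpace I y →L[ℝ] F) (y₀ : N) (z v : W) :
    localForm η y₀ z v =
      η ((extChartAt I y₀).symm z) (mfderiv 𝓘(ℝ, W) I (extChartAt I y₀).symm z v) := rfl

theorem mvfderiv_apply (f : M → F) (x : M) (v : TangentSpace J x) :
    mvfderiv J f x v = mfderiv J 𝓘(ℝ, F) f x v := rfl

/-- The pull-back of a 1-form. -/
def pullbackForm (Ψ : M → N) (η : ∀ y : N, TangentSpace I y →L[ℝ] F) (x : M) :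
    TangentSpace J x →L[ℝ] F :=
  (η (Ψ x)).comp (mfderiv J I Ψ x)

/-- The expression of a map in the charts at `x₀` and `y₀`. -/
def chartMap (I : ModelWithCorners ℝ W H) (J : ModelWithCorners ℝ W' H') (Ψ : M → N)
    (x₀ : M) (y₀ : N) (z : W') : W :=
  extChartAt I y₀ (Ψ ((extChartAt J x₀).symm z))

section Charts

variable [I.Boundaryless] [IsManifold I ∞ N]

theorem target_mem_nhds {y₀ : N} {z : W} (hz : z ∈ (extChartAt I y₀).target) :
    (extChartAt I y₀).target ∈ 𝓝 z := (isOpen_extChartAt_target y₀).mem_nhds hz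

theorem mdifferentiableAt_symm {y₀ : N} {z : W} (hz : z ∈ (extChartAt I y₀).target) :
    MDifferentiableAt 𝓘(ℝ, W) I (extChartAt I y₀).symm z := by
  have := mdifferentiableWithinAt_extChartAt_symm (I := I) hz
  rwa [I.range_eq_univ, mdifferentiableWithinAt_univ] at this

theorem mdifferentiableAt_chart {y₀ y : N} (hy : y ∈ (extChartAt I y₀).source) :
    MDifferentiableAt I 𝓘(ℝ, W) (extChartAt I y₀) y := by
  exact mdifferentiableAt_extChartAt (by rwa [extChartAt_source] at hy)

theorem mfderiv_chart_symm_apply {y₀ : N} {z : W} (hz : z ∈ (extChartAt I y₀).target) (v : W) :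
    mvfderiv I (extChartAt I y₀) ((extChartAt I y₀).symm z)
      (mfderiv 𝓘(ℝ, W) I (extChartAt I y₀).symm z v) = v := by
  have := mfderiv_extChartAt_comp_mfderivWithin_extChartAt_symm (I := I) hz
  rw [I.range_eq_univ, mfderivWithin_univ] at this
  exact congrArg (fun f : W →L[ℝ] W => f v) this

theorem mfderiv_symm_chart_apply {y₀ y : N} (hy : y ∈ (extChartAt I y₀).source)
    (v : TangentSpace I y) :
    mfderiv 𝓘(ℝ, W) I (extChartAt I y₀).symm (extChartAt I y₀ y)
      (mvfderiv I (extChartAt I y₀) y v) = v := by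
  have := mfderivWithin_extChartAt_symm_comp_mfderiv_extChartAt' (I := I) hy
  rw [I.range_eq_univ, mfderivWithin_univ] at this
  exact congrArg (fun f : W →L[ℝ] W => f v) this

variable [J.Boundaryless] [IsManifold J ∞ M]

theorem hasMFDerivAt_chartMap {Ψ : M → N} {x₀ : M} {y₀ : N} {z : W'}
    (hz : z ∈ (extChartAt J x₀).target)
    (hΨ : MDifferentiableAt J I Ψ ((extChartAt J x₀).symm z))
    (hy : Ψ ((extChartAt J x₀).symm z) ∈ (extChartAt I y₀).source) :
    HasMFDerivAt 𝓘(ℝ, W') 𝓘(ℝ, W) (chartMap I J Ψ x₀ y₀) z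
      ((mfderiv I 𝓘(ℝ, W) (extChartAt I y₀) (Ψ ((extChartAt J x₀).symm z))).comp
        ((mfderiv J I Ψ ((extChartAt J x₀).symm z)).comp
          (mfderiv 𝓘(ℝ, W') J (extChartAt J x₀).symm z))) :=
  (mdifferentiableAt_chart hy).hasMFDerivAt.comp z
    (hΨ.hasMFDerivAt.comp z (mdifferentiableAt_symm hz).hasMFDerivAt)

theorem fderiv_chartMap_apply {Ψ : M → N} {x₀ : M} {y₀ : N} {z : W'}
    (hz : z ∈ (extChartAt J x₀).target)
    (hΨ : MDifferentiableAt J I Ψ ((extChartAt J x₀).symm z))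
    (hy : Ψ ((extChartAt J x₀).symm z) ∈ (extChartAt I y₀).source) (v : W') :
    fderiv ℝ (chartMap I J Ψ x₀ y₀) z v =
      mvfderiv I (extChartAt I y₀) (Ψ ((extChartAt J x₀).symm z))
        (mfderiv J I Ψ ((extChartAt J x₀).symm z)
          (mfderiv 𝓘(ℝ, W') J (extChartAt J x₀).symm z v)) := by
  have h := (hasMFDerivAt_chartMap hz hΨ hy).mfderiv
  rw [mfderiv_eq_fderiv] at h
  exact congrArg (fun f : W' →L[ℝ] W => f v) h

theorem localForm_pullback_apply {Ψ : M → N} {x₀ : M} {y₀ : N} {z : W'}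
    (hz : z ∈ (extChartAt J x₀).target)
    (hΨ : MDifferentiableAt J I Ψ ((extChartAt J x₀).symm z))
    (hy : Ψ ((extChartAt J x₀).symm z) ∈ (extChartAt I y₀).source)
    (η : ∀ y : N, TangentSpace I y →L[ℝ] F) (v : W') :
    localForm (pullbackForm (J := J) Ψ η) x₀ z v =
      localForm η y₀ (chartMap I J Ψ x₀ y₀ z) (fderiv ℝ (chartMap I J Ψ x₀ y₀) z v) := by
  rw [fderiv_chartMap_apply hz hΨ hy]
  set x := (extChartAt J x₀).symm z
  set u : TangentSpace I (Ψ x) :=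
    mfderiv J I Ψ x (mfderiv 𝓘(ℝ, W') J (extChartAt J x₀).symm z v) with hu
  have h1 : localForm (pullbackForm (J := J) Ψ η) x₀ z v = η (Ψ x) u := rfl
  -- The two base points are equal only propositionally, so the vectors live in different tangent
  -- space types. Reading both vectors in the model space allows the equality of points to be
  -- substituted.
  have h2 : ∀ (y : N) (hyy : y = Ψ x) (u' : W), u' = u → η y u' = η (Ψ x) u := by
    rintro y rfl u' rfl; rfl
  rw [h1]
  symm
  exact h2 _ ((extChartAt I y₀).left_inv hy) _ (mfderiv_symm_chart_apply hy u)

theorem contDiffAt_chartMap {n : WithTop ℕ∞} [IsManifold I n N] [IsManifold J n M]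
    {x₀ : M} {y₀ : N} {z : W'} {Ψ : M → N}
    (hz : z ∈ (extChartAt J x₀).target)
    (hΨ : ContMDiffAt J I n Ψ ((extChartAt J x₀).symm z))
    (hy : Ψ ((extChartAt J x₀).symm z) ∈ (extChartAt I y₀).source) :
    ContDiffAt ℝ n (chartMap I J Ψ x₀ y₀) z := by
  rw [← contMDiffAt_iff_contDiffAt]
  have h1 : ContMDiffAt I 𝓘(ℝ, W) n (extChartAt I y₀) (Ψ ((extChartAt J x₀).symm z)) :=
    contMDiffAt_extChartAt' (by rwa [extChartAt_source] at hy)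
  have h2 : ContMDiffAt 𝓘(ℝ, W') J n (extChartAt J x₀).symm z :=
    (contMDiffOn_extChartAt_symm x₀).contMDiffAt (target_mem_nhds hz)
  exact h1.comp z (hΨ.comp z h2)

theorem eventually_chart {x₀ : M} {y₀ : N} {z : W'} {Ψ : M → N}
    (hz : z ∈ (extChartAt J x₀).target)
    (hΨ : ContMDiffAt J I 2 Ψ ((extChartAt J x₀).symm z))
    (hy : Ψ ((extChartAt J x₀).symm z) ∈ (extChartAt I y₀).source) :
    ∀ᶠ z' in 𝓝 z, z' ∈ (extChartAt J x₀).target ∧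
      ContMDiffAt J I 2 Ψ ((extChartAt J x₀).symm z') ∧
      Ψ ((extChartAt J x₀).symm z') ∈ (extChartAt I y₀).source := by
  have hc : ContinuousAt (extChartAt J x₀).symm z := continuousAt_extChartAt_symm'' hz
  have h1 : ∀ᶠ x in 𝓝 ((extChartAt J x₀).symm z), ContMDiffAt J I 2 Ψ x :=
    (contMDiffAt_iff_contMDiffAt_nhds (by simp)).1 hΨ
  have h2 := (hΨ.continuousAt.preimage_mem_nhds ((isOpen_extChartAt_source y₀).mem_nhds hy))
  filter_upwards [target_mem_nhds hz, hc.eventually h1, hc.eventually h2] with z' a b c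
  exact ⟨a, b, c⟩

theorem localForm_pullback_eventuallyEq {x₀ : M} {y₀ : N} {z : W'} {Ψ : M → N}
    (hz : z ∈ (extChartAt J x₀).target)
    (hΨ : ContMDiffAt J I 2 Ψ ((extChartAt J x₀).symm z))
    (hy : Ψ ((extChartAt J x₀).symm z) ∈ (extChartAt I y₀).source)
    (η : ∀ y : N, TangentSpace I y →L[ℝ] F) :
    localForm (pullbackForm (J := J) Ψ η) x₀ =ᶠ[𝓝 z] fun z' =>
      (localForm η y₀ (chartMap I J Ψ x₀ y₀ z')).comp (fderiv ℝ (chartMap I J Ψ x₀ y₀) z') := by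
  filter_upwards [eventually_chart hz hΨ hy] with z' ⟨h1, h2, h3⟩
  ext v
  exact localForm_pullback_apply h1 (h2.mdifferentiableAt (by simp)) h3 η v

/-- The exterior derivative commutes with pull-backs. -/
theorem localExtDeriv_pullback {x₀ : M} {y₀ : N} {z : W'} {Ψ : M → N}
    (hz : z ∈ (extChartAt J x₀).target)
    (hΨ : ContMDiffAt J I 2 Ψ ((extChartAt J x₀).symm z))
    (hy : Ψ ((extChartAt J x₀).symm z) ∈ (extChartAt I y₀).source)
    {η : ∀ y : N, TangentSpace I y →L[ℝ] F}
    (hη : DifferentiableAt ℝ (localForm η y₀) (chartMap I J Ψ x₀ y₀ z)) (v w : W') :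
    localExtDeriv (pullbackForm (J := J) Ψ η) x₀ z v w =
      localExtDeriv η y₀ (chartMap I J Ψ x₀ y₀ z) (fderiv ℝ (chartMap I J Ψ x₀ y₀) z v)
        (fderiv ℝ (chartMap I J Ψ x₀ y₀) z w) := by
  have hψ : ContDiffAt ℝ 2 (chartMap I J Ψ x₀ y₀) z := contDiffAt_chartMap hz hΨ hy
  have hsymm := hψ.isSymmSndFDerivAt (by simp)
  have h1 : HasFDerivAt (chartMap I J Ψ x₀ y₀) _ z :=
    (hψ.differentiableAt (by simp)).hasFDerivAt
  have h2 : HasFDerivAt (fderiv ℝ (chartMap I J Ψ x₀ y₀)) _ z :=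
    ((hψ.fderiv_right (m := 1) (by norm_num)).differentiableAt (by simp)).hasFDerivAt
  have h3 := (hη.hasFDerivAt.comp z h1).clm_comp h2
  have h4 := (localForm_pullback_eventuallyEq hz hΨ hy η).fderiv_eq.trans h3.fderiv
  unfold localExtDeriv
  rw [h4]
  -- The extra terms carry the second derivative of the chart expression of Ψ; they cancel by its
  -- symmetry.
  simp [hsymm v w]

end Charts

theorem localForm_clm_comp (P : F →L[ℝ] F') (η : ∀ y : N, TangentSpace I y →L[ℝ] F) (y₀ : N) :
    localForm (fun y => P.comp (η y)) y₀ = fun z => P.comp (localForm η y₀ z) := rfl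

theorem localExtDeriv_clm_comp (P : F →L[ℝ] F') {η : ∀ y : N, TangentSpace I y →L[ℝ] F} {y₀ : N}
    {z : W} (hη : DifferentiableAt ℝ (localForm η y₀) z) (v w : W) :
    localExtDeriv (fun y => P.comp (η y)) y₀ z v w = P (localExtDeriv η y₀ z v w) := by
  have : HasFDerivAt (fun z => P.comp (localForm η y₀ z)) _ z :=
    (ContinuousLinearMap.compL ℝ W F F' P).hasFDerivAt.comp z hη.hasFDerivAt
  unfold localExtDeriv
  rw [localForm_clm_comp, this.fderiv]
  simp

/-! ### Chart independence of the exterior derivative; pull-backs between manifolds -/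

section Intrinsic

variable [I.Boundaryless] [IsManifold I ∞ N] [J.Boundaryless] [IsManifold J ∞ M]

theorem localForm_chart (η : ∀ y : N, TangentSpace I y →L[ℝ] F) {y₀ y : N}
    (hy : y ∈ (extChartAt I y₀).source) (v : TangentSpace I y) :
    localForm η y₀ (extChartAt I y₀ y) (mvfderiv I (extChartAt I y₀) y v) = η y v := by
  have h2 : ∀ (y' : N) (_ : y' = y) (u' : W), u' = v → η y' u' = η y v := by
    rintro y' rfl u' rfl; rfl
  exact h2 _ ((extChartAt I y₀).left_inv hy) _ (mfderiv_symm_chart_apply hy v)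

theorem pullbackForm_id (η : ∀ y : N, TangentSpace I y →L[ℝ] F) :
    pullbackForm (J := I) id η = η := by
  funext y
  ext v
  change η y (mfderiv I I id y v) = η y v
  rw [mfderiv_id]; rfl

/-- The exterior derivative may be computed in any chart. -/
theorem extDerivOneForm_eq_localExtDeriv {η : ∀ y : N, TangentSpace I y →L[ℝ] F} {y₀ y : N}
    (hy : y ∈ (extChartAt I y₀).source)
    (hη : DifferentiableAt ℝ (localForm η y₀) (extChartAt I y₀ y)) (v w : TangentSpace I y) :
    extDerivOneForm η y v w = localExtDeriv η y₀ (extChartAt I y₀ y)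
      (mvfderiv I (extChartAt I y₀) y v) (mvfderiv I (extChartAt I y₀) y w) := by
  have hz : extChartAt I y y ∈ (extChartAt I y).target := mem_extChartAt_target y
  have hyy : (extChartAt I y).symm (extChartAt I y y) = y := extChartAt_to_inv y
  have hc : chartMap I I (id : N → N) y y₀ (extChartAt I y y) = extChartAt I y₀ y := by
    simp [chartMap]
  -- A change of chart is the pull-back under the identity, read in two different charts.
  have h := localExtDeriv_pullback (I := I) (J := I) (Ψ := id) (y₀ := y₀) hz contMDiffAt_id
    (by rw [hyy]; exact hy) (by rw [hc]; exact hη) (mvfderiv I (extChartAt I y) y v)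
    (mvfderiv I (extChartAt I y) y w)
  have h2 : ∀ v : TangentSpace I y, fderiv ℝ (chartMap I I (id : N → N) y y₀) (extChartAt I y y)
      (mvfderiv I (extChartAt I y) y v) =
      mvfderiv I (extChartAt I y₀) y v := by
    intro v
    refine (fderiv_chartMap_apply hz mdifferentiableAt_id (by rw [hyy]; exact hy) _).trans ?_
    have h3 : ∀ (y' : N) (_ : y' = y) (u' : W), u' = v →
        (mvfderiv I (extChartAt I y₀) y' (mfderiv I I id y' u') : W) =
          mvfderiv I (extChartAt I y₀) y v := by
      rintro y' rfl u' rfl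
      rw [mfderiv_id]; rfl
    exact h3 _ hyy _ (mfderiv_symm_chart_apply (mem_extChartAt_source y) v)
  rw [pullbackForm_id, h2, h2, hc] at h
  exact h

theorem extDerivOneForm_pullback {Ψ : M → N} {x : M} (hΨ : ContMDiffAt J I 2 Ψ x)
    {η : ∀ y : N, TangentSpace I y →L[ℝ] F} {y₀ : N} (hy : Ψ x ∈ (extChartAt I y₀).source)
    (hη : DifferentiableAt ℝ (localForm η y₀) (extChartAt I y₀ (Ψ x))) (v w : TangentSpace J x) :
    extDerivOneForm (pullbackForm (J := J) Ψ η) x v w =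
      extDerivOneForm η (Ψ x) (mfderiv J I Ψ x v) (mfderiv J I Ψ x w) := by
  have hz : extChartAt J x x ∈ (extChartAt J x).target := mem_extChartAt_target x
  have hxx : (extChartAt J x).symm (extChartAt J x x) = x := extChartAt_to_inv x
  have hc : chartMap I J Ψ x y₀ (extChartAt J x x) = extChartAt I y₀ (Ψ x) := by
    simp [chartMap]
  have h := localExtDeriv_pullback (I := I) (J := J) (Ψ := Ψ) (y₀ := y₀) hz
    (by rw [hxx]; exact hΨ) (by rw [hxx]; exact hy) (by rw [hc]; exact hη)
    (mvfderiv J (extChartAt J x) x v) (mvfderiv J (extChartAt J x) x w)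
  have h2 : ∀ v : TangentSpace J x, fderiv ℝ (chartMap I J Ψ x y₀) (extChartAt J x x)
      (mvfderiv J (extChartAt J x) x v) =
      mvfderiv I (extChartAt I y₀) (Ψ x) (mfderiv J I Ψ x v) := by
    intro v
    refine (fderiv_chartMap_apply hz (by rw [hxx]; exact hΨ.mdifferentiableAt (by simp))
      (by rw [hxx]; exact hy) _).trans ?_
    have h3 : ∀ (x' : M) (_ : x' = x) (u' : W'), u' = v →
        (mvfderiv I (extChartAt I y₀) (Ψ x') (mfderiv J I Ψ x' u') : W) =
          mvfderiv I (extChartAt I y₀) (Ψ x) (mfderiv J I Ψ x v) := by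
      rintro x' rfl u' rfl; rfl
    exact h3 _ hxx _ (mfderiv_symm_chart_apply (mem_extChartAt_source x) v)
  rw [h2, h2, hc] at h
  rw [extDerivOneForm_eq_localExtDeriv hy hη]
  exact h

end Intrinsic
end Forms

/-! ### The structure equation of a Lie group -/

section StructureEquation

variable {E : Type*} [NormedAddCommGroup E] [NormedSpace ℝ E] [FiniteDimensional ℝ E]
  {G : Type*} [TopologicalSpace G] [ChartedSpace E G] [Group G] [LieGroup 𝓘(ℝ, E) ∞ G]

instance : IsManifold 𝓘(ℝ, E) ∞ G := LieGroup.toContMDiffMul.toIsManifold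

/-- The left-invariant vector field with value `X` at `1`. -/
def leftField (X : LieAlg E G) (g : G) : TangentSpace 𝓘(ℝ, E) g :=
  mulInvariantVectorField (I := 𝓘(ℝ, E)) (G := G) (show GroupLieAlgebra 𝓘(ℝ, E) G from X) g

variable (G) in
/-- The differential at `1` of the preferred chart. -/
def oneChart : LieAlg E G →L[ℝ] E :=
  (mvfderiv 𝓘(ℝ, E) (extChartAt 𝓘(ℝ, E) (1 : G)) 1 :)

/-- The multiplication of `G` in the charts at `g₀` and `1`. -/
def chartMul (g₀ : G) : E × E → E :=
  chartMap 𝓘(ℝ, E) (𝓘(ℝ, E).prod 𝓘(ℝ, E)) (fun p : G × G => p.1 * p.2) (g₀, 1) g₀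

/-- The frame of left-invariant vector fields, in the chart at `g₀`. -/
def leftFrame (g₀ : G) (z : E) : LieAlg E G →L[ℝ] E :=
  (fderiv ℝ (chartMul g₀) (z, extChartAt 𝓘(ℝ, E) (1 : G) 1)).comp
    ((ContinuousLinearMap.inr ℝ E E).comp (oneChart G))

/-- `leftFrame` is built from the partial derivative of the multiplication in its second argument at
1. Smoothness of the product in both variables jointly is what makes this frame depend smoothly on
the point. -/
theorem contDiffAt_chartMul {g₀ : G} {z : E} (hz : z ∈ (extChartAt 𝓘(ℝ, E) g₀).target) :
    ContDiffAt ℝ ∞ (chartMul g₀) (z, extChartAt 𝓘(ℝ, E) (1 : G) 1) := by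
  have h1 : (extChartAt (𝓘(ℝ, E).prod 𝓘(ℝ, E)) ((g₀, 1) : G × G)).symm
      (z, extChartAt 𝓘(ℝ, E) (1 : G) 1) = ((extChartAt 𝓘(ℝ, E) g₀).symm z, 1) := by
    rw [extChartAt_prod]
    simp
  refine contDiffAt_chartMap ?_ ?_ ?_
  · rw [extChartAt_prod]
    exact ⟨hz, mem_extChartAt_target _⟩
  · exact (contMDiff_mul 𝓘(ℝ, E) ∞).contMDiffAt
  · rw [h1, mul_one]
    exact (extChartAt 𝓘(ℝ, E) g₀).map_target hz

theorem contDiffAt_leftFrame {g₀ : G} {z : E} (hz : z ∈ (extChartAt 𝓘(ℝ, E) g₀).target) :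
    ContDiffAt ℝ ∞ (leftFrame g₀) z := by
  have h1 : ContDiffAt ℝ ∞ (fun z : E => (z, extChartAt 𝓘(ℝ, E) (1 : G) 1)) z :=
    contDiffAt_id.prodMk contDiffAt_const
  have h2 := ((contDiffAt_chartMul hz).fderiv_right (m := ∞) (by simp)).comp z h1
  exact h2.clm_comp contDiffAt_const

theorem leftFrame_apply {g₀ : G} {z : E} (hz : z ∈ (extChartAt 𝓘(ℝ, E) g₀).target)
    (X : LieAlg E G) :
    leftFrame g₀ z X = mvfderiv 𝓘(ℝ, E) (extChartAt 𝓘(ℝ, E) g₀)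
      ((extChartAt 𝓘(ℝ, E) g₀).symm z)
      (leftField X ((extChartAt 𝓘(ℝ, E) g₀).symm z)) := by
  set g := (extChartAt 𝓘(ℝ, E) g₀).symm z with hg
  set u := extChartAt 𝓘(ℝ, E) (1 : G) 1 with hu
  have hu1 : (extChartAt 𝓘(ℝ, E) (1 : G)).symm u = 1 := extChartAt_to_inv _
  have hmul : MDifferentiableAt 𝓘(ℝ, E) 𝓘(ℝ, E) (fun x : G => g * x) 1 :=
    (contMDiff_mul_left (I := 𝓘(ℝ, E)) (n := ∞)).contMDiffAt.mdifferentiableAt (by simp)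
  have hgs : g ∈ (extChartAt 𝓘(ℝ, E) g₀).source := (extChartAt 𝓘(ℝ, E) g₀).map_target hz
  have h1 : (fun v => chartMul g₀ (z, v)) =
      chartMap 𝓘(ℝ, E) 𝓘(ℝ, E) (fun x : G => g * x) 1 g₀ := by
    funext v
    simp only [chartMul, chartMap, extChartAt_prod]
    rfl
  have h2 : HasFDerivAt (fun v : E => (z, v)) (ContinuousLinearMap.inr ℝ E E) u :=
    hasFDerivAt_prodMk_right z u
  have h3 := ((contDiffAt_chartMul hz).differentiableAt (by simp)).hasFDerivAt.comp u h2
  have h4 : leftFrame g₀ z X = fderiv ℝ (fun v => chartMul g₀ (z, v)) u (oneChart G X) := by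
    have h5 : HasFDerivAt (fun v => chartMul g₀ (z, v)) _ u := h3
    rw [h5.fderiv]; rfl
  rw [h4, h1]
  refine (fderiv_chartMap_apply (mem_extChartAt_target _) (by rw [hu1]; exact hmul)
    (by rw [hu1, mul_one]; exact hgs) _).trans ?_
  have h6 : ∀ (x' : G) (_ : x' = 1) (g' : G) (_ : g' = g) (X' : E), X' = X →
      (mvfderiv 𝓘(ℝ, E) (extChartAt 𝓘(ℝ, E) g₀) g'
        (mfderiv 𝓘(ℝ, E) 𝓘(ℝ, E) (fun x : G => g * x) x' X') : E) =
      mvfderiv 𝓘(ℝ, E) (extChartAt 𝓘(ℝ, E) g₀) g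
        (leftField X g) := by
    rintro x' rfl g' rfl X' rfl; rfl
  exact h6 _ hu1 _ (by rw [hu1, mul_one]) _
    (mfderiv_symm_chart_apply (I := 𝓘(ℝ, E)) (mem_extChartAt_source (1 : G))
      (show TangentSpace 𝓘(ℝ, E) (1 : G) from X))

theorem maurerCartan_leftField (g : G) (X : LieAlg E G) :
    maurerCartan g (leftField X g) = X := by
  have h := inverse_mfderiv_mul_left (I := 𝓘(ℝ, E)) (G := G) (g := g) (h := 1)
  have hmul : ∀ g x : G, MDifferentiableAt 𝓘(ℝ, E) 𝓘(ℝ, E) (fun x : G => g * x) x := fun g x =>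
    (contMDiff_mul_left (I := 𝓘(ℝ, E)) (n := ∞)).contMDiffAt.mdifferentiableAt (by simp)
  have h1 := mfderiv_comp (I := 𝓘(ℝ, E)) (I' := 𝓘(ℝ, E)) (I'' := 𝓘(ℝ, E)) (1 : G)
    (hmul g⁻¹ (g * 1)) (hmul g 1)
  have h2 : (fun x : G => g⁻¹ * x) ∘ (fun x => g * x) = id := by ext; simp
  rw [h2, mfderiv_id] at h1
  have h3 : ∀ (g' : G) (_ : g' = g) (Y : E), 
      (mfderiv 𝓘(ℝ, E) 𝓘(ℝ, E) (fun x : G => g⁻¹ * x) g' Y : E) =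
      mfderiv 𝓘(ℝ, E) 𝓘(ℝ, E) (fun x : G => g⁻¹ * x) g Y := by
    rintro g' rfl Y; rfl
  exact (h3 _ (mul_one g) _).symm.trans (congrArg (fun f : E →L[ℝ] E => f X) h1).symm

theorem localForm_leftFrame {g₀ : G} {z : E} (hz : z ∈ (extChartAt 𝓘(ℝ, E) g₀).target)
    (X : LieAlg E G) :
    localForm (maurerCartan (E := E) (G := G)) g₀ z (leftFrame g₀ z X) = X := by
  have hs := (extChartAt 𝓘(ℝ, E) g₀).map_target hz
  have h := localForm_chart (maurerCartan (E := E) (G := G)) hs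
    (leftField X ((extChartAt 𝓘(ℝ, E) g₀).symm z))
  rw [(extChartAt 𝓘(ℝ, E) g₀).right_inv hz, ← leftFrame_apply hz] at h
  exact h.trans (maurerCartan_leftField _ _)

theorem leftFrame_localForm {g₀ : G} {z : E} (hz : z ∈ (extChartAt 𝓘(ℝ, E) g₀).target) (v : E) :
    leftFrame g₀ z (localForm (maurerCartan (E := E) (G := G)) g₀ z v) = v := by
  have hinj : Function.Injective (leftFrame g₀ z) :=
    Function.LeftInverse.injective (localForm_leftFrame hz)
  have hsurj : Function.Surjective (leftFrame g₀ z) :=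
    ((LinearMap.injective_iff_surjective_of_finrank_eq_finrank
      (f := (leftFrame g₀ z).toLinearMap) rfl).1 hinj)
  obtain ⟨X, rfl⟩ := hsurj v
  rw [localForm_leftFrame hz]

theorem localForm_maurerCartan_eq_inverse {g₀ : G} {z : E}
    (hz : z ∈ (extChartAt 𝓘(ℝ, E) g₀).target) :
    localForm (maurerCartan (E := E) (G := G)) g₀ z = (leftFrame g₀ z).inverse :=
  (ContinuousLinearMap.inverse_eq (ContinuousLinearMap.ext (leftFrame_localForm hz))
    (ContinuousLinearMap.ext (localForm_leftFrame hz))).symm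

/-- In a chart the Maurer–Cartan form is the pointwise inverse of the smooth frame `leftFrame`, and
inversion of linear maps is smooth at an invertible one. -/
theorem contDiffAt_localForm_maurerCartan {g₀ : G} {z : E}
    (hz : z ∈ (extChartAt 𝓘(ℝ, E) g₀).target) :
    ContDiffAt ℝ ∞ (localForm (maurerCartan (E := E) (G := G)) g₀) z := by
  have := FiniteDimensional.complete ℝ (LieAlg E G)
  have h1 : (leftFrame g₀ z).IsInvertible :=
    ⟨ContinuousLinearEquiv.equivOfInverse (leftFrame g₀ z)
      (localForm (maurerCartan (E := E) (G := G)) g₀ z) (localForm_leftFrame hz)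
      (leftFrame_localForm hz), rfl⟩
  have h2 := h1.contDiffAt_map_inverse (n := ∞)
  refine (h2.comp z (contDiffAt_leftFrame hz)).congr_of_eventuallyEq ?_
  filter_upwards [target_mem_nhds hz] with z' hz'
  exact localForm_maurerCartan_eq_inverse hz'

theorem differentiableAt_localForm_maurerCartan {g₀ : G} {z : E}
    (hz : z ∈ (extChartAt 𝓘(ℝ, E) g₀).target) :
    DifferentiableAt ℝ (localForm (maurerCartan (E := E) (G := G)) g₀) z :=
  (contDiffAt_localForm_maurerCartan hz).differentiableAt (by simp)

open VectorField in
-- The bracket of the Lie algebra is that of left-invariant fields. The bracket of fields on a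
-- manifold is computed at g in the chart at g, which is why only the centre of the chart is
-- treated.
theorem lieBracket_leftFrame (g : G) (X Y : LieAlg E G) :
    lieBracket ℝ (fun z => leftFrame g z X) (fun z => leftFrame g z Y)
      (extChartAt 𝓘(ℝ, E) g g) = leftFrame g (extChartAt 𝓘(ℝ, E) g g) ⁅X, Y⁆ := by
  have := FiniteDimensional.complete ℝ E
  have hz := mem_extChartAt_target (I := 𝓘(ℝ, E)) g
  have h1 : ∀ X : LieAlg E G, mpullbackWithin 𝓘(ℝ, E) 𝓘(ℝ, E) (extChartAt 𝓘(ℝ, E) g).symm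
      (leftField X) (Set.range 𝓘(ℝ, E))
      =ᶠ[𝓝 (extChartAt 𝓘(ℝ, E) g g)] fun z => leftFrame g z X := by
    intro X
    filter_upwards [target_mem_nhds hz] with z hz'
    rw [leftFrame_apply hz', mpullbackWithin_apply]
    have h2 : (mfderivWithin 𝓘(ℝ, E) 𝓘(ℝ, E) (extChartAt 𝓘(ℝ, E) g).symm
        (Set.range 𝓘(ℝ, E)) z).inverse =
        mfderiv 𝓘(ℝ, E) 𝓘(ℝ, E) (extChartAt 𝓘(ℝ, E) g) ((extChartAt 𝓘(ℝ, E) g).symm z) :=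
      ContinuousLinearMap.inverse_eq
        (mfderivWithin_extChartAt_symm_comp_mfderiv_extChartAt hz')
        (mfderiv_extChartAt_comp_mfderivWithin_extChartAt_symm hz')
    rw [h2]; rfl
  have h3 := (h1 X).lieBracket_vectorField_eq (𝕜 := ℝ) (h1 Y)
  have h4 : mlieBracket 𝓘(ℝ, E) (leftField X)
      (leftField Y) g =
      leftField ⁅X, Y⁆ g :=
    (congrFun (mulInvariantVector_mlieBracket (I := 𝓘(ℝ, E)) (G := G) X Y) g).symm
  have h5 := mlieBracketWithin_apply (I := 𝓘(ℝ, E)) (V := leftField X) (W := leftField Y)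
    (s := Set.univ) (x₀ := g)
  rw [mlieBracketWithin_univ, h4] at h5
  have h6 : ∀ (g' : G) (_ : g' = g),
      mvfderiv 𝓘(ℝ, E) (extChartAt 𝓘(ℝ, E) g) g' (leftField ⁅X, Y⁆ g') =
        mvfderiv 𝓘(ℝ, E) (extChartAt 𝓘(ℝ, E) g) g (leftField ⁅X, Y⁆ g) := by
    rintro g' rfl; rfl
  have h7 : ∀ u : E, (mfderiv 𝓘(ℝ, E) 𝓘(ℝ, E) (extChartAt 𝓘(ℝ, E) g) g
      ((mfderiv 𝓘(ℝ, E) 𝓘(ℝ, E) (extChartAt 𝓘(ℝ, E) g) g).inverse u) : E) = u := fun u =>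
    (isInvertible_mfderiv_extChartAt (mem_extChartAt_source g)).self_apply_inverse u
  rw [leftFrame_apply hz, h6 _ (extChartAt_to_inv g), ← h3, h5]
  refine Eq.trans ?_ (h7 _).symm
  rw [Set.preimage_univ, Set.univ_inter, ModelWithCorners.range_eq_univ]
  exact (congrFun lieBracketWithin_univ _).symm

/-- The structure equation `dθ + [θ, θ] = 0` at the centre of a chart. -/
theorem localExtDeriv_maurerCartan_self (g : G) (v w : E) :
    localExtDeriv (maurerCartan (E := E) (G := G)) g (extChartAt 𝓘(ℝ, E) g g) v w =
      -⁅localForm (maurerCartan (E := E) (G := G)) g (extChartAt 𝓘(ℝ, E) g g) v,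
        localForm (maurerCartan (E := E) (G := G)) g (extChartAt 𝓘(ℝ, E) g g) w⁆ := by
  set z := extChartAt 𝓘(ℝ, E) g g with hzdef
  have hz : z ∈ (extChartAt 𝓘(ℝ, E) g).target := mem_extChartAt_target g
  set Θ := localForm (maurerCartan (E := E) (G := G)) g with hΘ
  have hΘ' := (differentiableAt_localForm_maurerCartan hz).hasFDerivAt
  have hΦ : ∀ X : LieAlg E G, HasFDerivAt (fun z => leftFrame g z X)
      (fderiv ℝ (fun z => leftFrame g z X) z) z := fun X =>
    (((contDiffAt_leftFrame hz).clm_apply contDiffAt_const).differentiableAt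
      (by simp)).hasFDerivAt
  -- Differentiate the constant function Θ(`leftFrame` X) = X. This trades derivatives of Θ for
  -- derivatives of the frame, whose antisymmetrization is a Lie bracket.
  have key : ∀ (X : LieAlg E G) (u : E), fderiv ℝ Θ z u (leftFrame g z X) =
      -Θ z (fderiv ℝ (fun z => leftFrame g z X) z u) := by
    intro X u
    have h1 := hΘ'.clm_apply (hΦ X)
    have h2 : (fun z => Θ z (leftFrame g z X)) =ᶠ[𝓝 z] fun _ => X := by
      filter_upwards [target_mem_nhds hz] with z' hz' using localForm_leftFrame hz' X
    have h3 := h1.fderiv.symm.trans (h2.fderiv_eq.trans (hasFDerivAt_const X z).fderiv)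
    have h4 := congrArg (fun f : E →L[ℝ] LieAlg E G => f u) h3
    simp only [add_apply, ContinuousLinearMap.comp_apply,
      ContinuousLinearMap.flip_apply, zero_apply] at h4
    exact eq_neg_of_add_eq_zero_right h4
  have h6 := lieBracket_leftFrame g (Θ z v) (Θ z w)
  rw [← hzdef, VectorField.lieBracket_eq] at h6
  have e1 : leftFrame g z (Θ z v) = v := leftFrame_localForm hz v
  have e2 : leftFrame g z (Θ z w) = w := leftFrame_localForm hz w
  have k1 := key (Θ z w) v
  have k2 := key (Θ z v) w
  simp only [e1, e2] at h6 k1 k2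
  unfold localExtDeriv
  rw [← hΘ, k1, k2, sub_neg_eq_add, neg_add_eq_sub, ← map_sub, ← neg_sub, h6, map_neg]
  rw [hΘ, localForm_leftFrame hz]

theorem extDerivOneForm_maurerCartan (g : G) (v w : TangentSpace 𝓘(ℝ, E) g) :
    extDerivOneForm (maurerCartan (E := E) (G := G)) g v w =
      -⁅maurerCartan g v, maurerCartan g w⁆ := by
  have h := localExtDeriv_maurerCartan_self g (mvfderiv 𝓘(ℝ, E) (extChartAt 𝓘(ℝ, E) g) g v)
    (mvfderiv 𝓘(ℝ, E) (extChartAt 𝓘(ℝ, E) g) g w)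
  rw [localForm_chart _ (mem_extChartAt_source g), localForm_chart _ (mem_extChartAt_source g)] at h
  exact h

/-- The structure equation `dθ + [θ, θ] = 0`. -/
theorem localExtDeriv_maurerCartan {g₀ : G} {z : E} (hz : z ∈ (extChartAt 𝓘(ℝ, E) g₀).target)
    (v w : E) :
    localExtDeriv (maurerCartan (E := E) (G := G)) g₀ z v w =
      -⁅localForm (maurerCartan (E := E) (G := G)) g₀ z v,
        localForm (maurerCartan (E := E) (G := G)) g₀ z w⁆ := by
  have hs := (extChartAt 𝓘(ℝ, E) g₀).map_target hz
  have hr := (extChartAt 𝓘(ℝ, E) g₀).right_inv hz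
  -- Chart independence carries the equation from the centre of one chart to every point of another.
  have h := extDerivOneForm_eq_localExtDeriv hs
    (by rw [hr]; exact differentiableAt_localForm_maurerCartan hz)
    (mfderiv 𝓘(ℝ, E) 𝓘(ℝ, E) (extChartAt 𝓘(ℝ, E) g₀).symm z v)
    (mfderiv 𝓘(ℝ, E) 𝓘(ℝ, E) (extChartAt 𝓘(ℝ, E) g₀).symm z w)
  rw [mfderiv_chart_symm_apply hz, mfderiv_chart_symm_apply hz, hr,
    extDerivOneForm_maurerCartan] at h
  exact h.symm

variable {W : Type*} [NormedAddCommGroup W] [NormedSpace ℝ W] {H : Type*} [TopologicalSpace H]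
  {J : ModelWithCorners ℝ W H} [J.Boundaryless]
  {M : Type*} [TopologicalSpace M] [ChartedSpace H M] [IsManifold J ∞ M]

theorem extDerivOneForm_pullback_maurerCartan {g : M → G} {x : M}
    (hg : ContMDiffAt J 𝓘(ℝ, E) ∞ g x) (v w : TangentSpace J x) :
    extDerivOneForm (pullbackForm (J := J) g (maurerCartan (E := E) (G := G))) x v w =
      -⁅pullbackForm (J := J) g (maurerCartan (E := E) (G := G)) x v,
        pullbackForm (J := J) g (maurerCartan (E := E) (G := G)) x w⁆ := by
  rw [extDerivOneForm_pullback (hg.of_le ENat.LEInfty.out) (mem_extChartAt_source (g x))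
    (differentiableAt_localForm_maurerCartan (mem_extChartAt_target (g x))),
    extDerivOneForm_maurerCartan]
  rfl

end StructureEquation

/-! ### The Pfaffian system of a tableau in a chart -/

section Coefficients

variable {E P X Y : Type*} [NormedAddCommGroup E] [NormedSpace ℝ E] [NormedAddCommGroup P]
  [NormedSpace ℝ P] [NormedAddCommGroup X] [NormedSpace ℝ X] [NormedAddCommGroup Y]
  [NormedSpace ℝ Y] (T₀ : X →L[ℝ] Y) (T₁ : P →L[ℝ] (X →L[ℝ] Y)) {Θ : E → E →L[ℝ] X}
  {f : E × P → E × P →L[ℝ] Y} {z : E × P}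

/-- The common shape of tableau systems in a chart: a fixed form Θ on the first factor, composed
with coefficients that are affine in the second factor. -/
theorem contDiffAt_of_coefficients (hΘ : ContDiffAt ℝ ∞ Θ z.1)
    (hf : ∀ᶠ z in 𝓝 z, f z = (T₀ - T₁ z.2).comp ((Θ z.1).comp (ContinuousLinearMap.fst ℝ E P))) :
    ContDiffAt ℝ ∞ f z := by
  refine ContDiffAt.congr_of_eventuallyEq ?_ hf
  refine ContDiffAt.clm_comp ?_ (ContDiffAt.clm_comp ?_ contDiffAt_const)
  · exact contDiffAt_const.sub (T₁.contDiff.contDiffAt.comp z contDiffAt_snd)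
  · exact hΘ.comp z contDiffAt_fst

theorem fderiv_of_coefficients (hΘ : DifferentiableAt ℝ Θ z.1)
    (hf : ∀ᶠ z in 𝓝 z, f z = (T₀ - T₁ z.2).comp ((Θ z.1).comp (ContinuousLinearMap.fst ℝ E P)))
    (v w : E × P) :
    fderiv ℝ f z v w = (T₀ - T₁ z.2) (fderiv ℝ Θ z.1 v.1 w.1) - T₁ v.2 (Θ z.1 w.1) := by
  have h1 : HasFDerivAt (fun z : E × P => T₀ - T₁ z.2)
      (-(T₁.comp (ContinuousLinearMap.snd ℝ E P))) z :=
    (T₁.comp (ContinuousLinearMap.snd ℝ E P)).hasFDerivAt.const_sub _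
  have h2 : HasFDerivAt (fun z : E × P => Θ z.1)
      ((fderiv ℝ Θ z.1).comp (ContinuousLinearMap.fst ℝ E P)) z :=
    hΘ.hasFDerivAt.comp z hasFDerivAt_fst
  have h3 := h1.clm_comp (h2.clm_comp (hasFDerivAt_const (ContinuousLinearMap.fst ℝ E P) z))
  have h4 : f =ᶠ[𝓝 z] _ := hf
  rw [h4.fderiv_eq, h3.fderiv]
  simp
  abel

end Coefficients

section TableauLocal

variable {E : Type*} [NormedAddCommGroup E] [NormedSpace ℝ E] [FiniteDimensional ℝ E]
  {G : Type*} [TopologicalSpace G] [ChartedSpace E G] [Group G] [LieGroup 𝓘(ℝ, E) ∞ G]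
  {P : Type*} [NormedAddCommGroup P] [NormedSpace ℝ P] [FiniteDimensional ℝ P]

theorem target_prod (y₀ : G × P) {z : E × P} :
    z ∈ (extChartAt (𝓘(ℝ, E).prod 𝓘(ℝ, P)) y₀).target ↔
      z.1 ∈ (extChartAt 𝓘(ℝ, E) y₀.1).target := by
  rw [extChartAt_prod]
  simp [chartAt_self_eq]

theorem symm_prod (y₀ : G × P) (z : E × P) :
    (extChartAt (𝓘(ℝ, E).prod 𝓘(ℝ, P)) y₀).symm z =
      ((extChartAt 𝓘(ℝ, E) y₀.1).symm z.1, z.2) := by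
  rw [extChartAt_prod]
  simp [chartAt_self_eq]

theorem localForm_maurerCartanProd_apply {y₀ : G × P} {z : E × P}
    (hz : z.1 ∈ (extChartAt 𝓘(ℝ, E) y₀.1).target) (v : E × P) :
    localForm (maurerCartanProd E G P) y₀ z v =
      localForm (maurerCartan (E := E) (G := G)) y₀.1 z.1 v.1 := by
  have hz' := (target_prod y₀).2 hz
  have h0 : ∀ z' : E × P, chartMap 𝓘(ℝ, E) (𝓘(ℝ, E).prod 𝓘(ℝ, P)) (Prod.fst : G × P → G) y₀ y₀.1 z' =
      extChartAt 𝓘(ℝ, E) y₀.1 ((extChartAt 𝓘(ℝ, E) y₀.1).symm z'.1) := by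
    intro z'
    simp only [chartMap, symm_prod]
  have h := localForm_pullback_apply (I := 𝓘(ℝ, E)) (Ψ := (Prod.fst : G × P → G)) (y₀ := y₀.1) hz'
    mdifferentiableAt_fst
    (by rw [symm_prod]; exact (extChartAt 𝓘(ℝ, E) y₀.1).map_target hz)
    (maurerCartan (E := E) (G := G)) v
  have h1 : chartMap 𝓘(ℝ, E) (𝓘(ℝ, E).prod 𝓘(ℝ, P)) (Prod.fst : G × P → G) y₀ y₀.1 =ᶠ[𝓝 z]
      Prod.fst := by
    have : ∀ᶠ z' : E × P in 𝓝 z, z'.1 ∈ (extChartAt 𝓘(ℝ, E) y₀.1).target :=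
      continuousAt_fst.eventually (target_mem_nhds hz)
    filter_upwards [this] with z' hz'
    rw [h0, (extChartAt 𝓘(ℝ, E) y₀.1).right_inv hz']
  rw [h1.fderiv_eq, h1.eq_of_nhds, fderiv_fst] at h
  exact h

variable {a b c : Submodule ℝ (LieAlg E G)}

/-- The linear part of the coefficients of the system of a tableau. -/
def tableauCoeff (h : IsSplitting a b c) (Q : P →ₗ[ℝ] (a →ₗ[ℝ] b)) :
    P →L[ℝ] (LieAlg E G →L[ℝ] b × c) :=
  LinearMap.toContinuousLinearMap
    { toFun := fun p => LinearMap.toContinuousLinearMap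
        (((Q p).comp (a.projectionOnto (b ⊔ c) h.left)).prod 0)
      map_add' := fun p q => by ext X <;> simp
      map_smul' := fun r p => by ext X <;> simp }

@[simp]
theorem tableauCoeff_apply (h : IsSplitting a b c) (Q : P →ₗ[ℝ] (a →ₗ[ℝ] b)) (p : P)
    (X : LieAlg E G) :
    tableauCoeff h Q p X = (Q p (a.projectionOnto (b ⊔ c) h.left X), 0) := rfl

/-- The constant part of the coefficients of the system of a tableau. -/
def tableauConst (h : IsSplitting a b c) : LieAlg E G →L[ℝ] b × c :=
  LinearMap.toContinuousLinearMap
    ((b.projectionOnto (a ⊔ c) h.middle).prod (c.projectionOnto (a ⊔ b) h.right))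

@[simp]
theorem tableauConst_apply (h : IsSplitting a b c) (X : LieAlg E G) :
    tableauConst h X =
      (b.projectionOnto (a ⊔ c) h.middle X, c.projectionOnto (a ⊔ b) h.right X) := rfl

variable (h : IsSplitting a b c) (Q : P →ₗ[ℝ] (a →ₗ[ℝ] b)) {k : ℕ} (A : Basis (Fin k) ℝ a)

theorem tableauSystem_form_apply (y : G × P)
    (v : TangentSpace (𝓘(ℝ, E).prod 𝓘(ℝ, P)) y) :
    (tableauSystem h Q A).form y v =
      (tableauConst h - tableauCoeff h Q y.2) (maurerCartanProd E G P y v) := by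
  refine Prod.ext ?_ ?_
  · rfl
  · exact (sub_zero _).symm

theorem localForm_tableauSystem {y₀ : G × P} {z : E × P}
    (hz : z.1 ∈ (extChartAt 𝓘(ℝ, E) y₀.1).target) :
    localForm (tableauSystem h Q A).form y₀ z = (tableauConst h - tableauCoeff h Q z.2).comp
      ((localForm (maurerCartan (E := E) (G := G)) y₀.1 z.1).comp
        (ContinuousLinearMap.fst ℝ E P)) := by
  refine ContinuousLinearMap.ext fun v => ?_
  rw [localForm_apply, tableauSystem_form_apply, ← localForm_apply (maurerCartanProd E G P),
    localForm_maurerCartanProd_apply hz, symm_prod]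
  rfl

theorem eventually_target {y₀ : G × P} {z : E × P}
    (hz : z.1 ∈ (extChartAt 𝓘(ℝ, E) y₀.1).target) :
    ∀ᶠ z' : E × P in 𝓝 z, z'.1 ∈ (extChartAt 𝓘(ℝ, E) y₀.1).target :=
  continuousAt_fst.eventually (target_mem_nhds hz)

theorem contDiffAt_localForm_tableauSystem {y₀ : G × P} {z : E × P}
    (hz : z.1 ∈ (extChartAt 𝓘(ℝ, E) y₀.1).target) :
    ContDiffAt ℝ ∞ (localForm (tableauSystem h Q A).form y₀) z := by
  refine contDiffAt_of_coefficients (tableauConst h) (tableauCoeff h Q)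
    (contDiffAt_localForm_maurerCartan hz) ?_
  filter_upwards [eventually_target hz] with z' hz'
  exact localForm_tableauSystem h Q A hz'

theorem differentiableAt_localForm_tableauSystem {y₀ : G × P} {z : E × P}
    (hz : z.1 ∈ (extChartAt 𝓘(ℝ, E) y₀.1).target) :
    DifferentiableAt ℝ (localForm (tableauSystem h Q A).form y₀) z :=
  (contDiffAt_localForm_tableauSystem h Q A hz).differentiableAt (by simp)

/-- The Leibniz rule for coefficients affine in p gives the two terms in `w.2` and `v.2`; the
structure equation replaces dθ by the bracket. -/
theorem localExtDeriv_tableauSystem {y₀ : G × P} {z : E × P}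
    (hz : z.1 ∈ (extChartAt 𝓘(ℝ, E) y₀.1).target) (v w : E × P) :
    localExtDeriv (tableauSystem h Q A).form y₀ z v w =
      tableauCoeff h Q w.2 (localForm (maurerCartan (E := E) (G := G)) y₀.1 z.1 v.1) -
      tableauCoeff h Q v.2 (localForm (maurerCartan (E := E) (G := G)) y₀.1 z.1 w.1) -
      (tableauConst h - tableauCoeff h Q z.2)
        ⁅localForm (maurerCartan (E := E) (G := G)) y₀.1 z.1 v.1,
          localForm (maurerCartan (E := E) (G := G)) y₀.1 z.1 w.1⁆ := by
  have h1 := fderiv_of_coefficients (f := localForm (tableauSystem h Q A).form y₀)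
    (tableauConst h) (tableauCoeff h Q) (differentiableAt_localForm_maurerCartan hz) (by
      filter_upwards [eventually_target hz] with z' hz'
      exact localForm_tableauSystem h Q A hz')
  have h5 := localExtDeriv_maurerCartan hz v.1 w.1
  rw [← neg_eq_iff_eq_neg] at h5
  rw [← h5]
  unfold localExtDeriv
  rw [h1, h1, map_neg, map_sub]
  abel

end TableauLocal

/-! ### Integral elements of the `G/G₀`-exterior differential system in a chart -/

section Splitting

variable {L : Type*} [LieRing L] [LieAlgebra ℝ L] {a b c : Submodule ℝ L}

theorem IsSplitting.add_eq (h : IsSplitting a b c) (X : L) :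
    (a.projectionOnto (b ⊔ c) h.left X : L) + b.projectionOnto (a ⊔ c) h.middle X +
      c.projectionOnto (a ⊔ b) h.right X = X := by
  obtain ⟨A, hA, Y, hY, rfl⟩ := Submodule.mem_sup.1
    (show X ∈ a ⊔ (b ⊔ c) by rw [h.left.sup_eq_top]; trivial)
  obtain ⟨B, hB, C, hC, rfl⟩ := Submodule.mem_sup.1 hY
  simp only [map_add]
  rw [Submodule.projectionOnto_apply_of_mem_left h.left hA,
    Submodule.projectionOnto_apply_of_mem_right h.left (Submodule.mem_sup_left hB),
    Submodule.projectionOnto_apply_of_mem_right h.left (Submodule.mem_sup_right hC),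
    Submodule.projectionOnto_apply_of_mem_left h.middle hB,
    Submodule.projectionOnto_apply_of_mem_right h.middle (Submodule.mem_sup_left hA),
    Submodule.projectionOnto_apply_of_mem_right h.middle (Submodule.mem_sup_right hC),
    Submodule.projectionOnto_apply_of_mem_left h.right hC,
    Submodule.projectionOnto_apply_of_mem_right h.right (Submodule.mem_sup_left hA),
    Submodule.projectionOnto_apply_of_mem_right h.right (Submodule.mem_sup_right hB)]
  simp [add_assoc]

theorem IsSplitting.left_apply (h : IsSplitting a b c) (A : a) (B : b) (C : c) :
    a.projectionOnto (b ⊔ c) h.left (A + B + C) = A := by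
  simp only [map_add]
  rw [Submodule.projectionOnto_apply_left,
    Submodule.projectionOnto_apply_of_mem_right h.left (Submodule.mem_sup_left B.2),
    Submodule.projectionOnto_apply_of_mem_right h.left (Submodule.mem_sup_right C.2)]
  simp

theorem IsSplitting.middle_apply (h : IsSplitting a b c) (A : a) (B : b) (C : c) :
    b.projectionOnto (a ⊔ c) h.middle (A + B + C) = B := by
  simp only [map_add]
  rw [Submodule.projectionOnto_apply_left,
    Submodule.projectionOnto_apply_of_mem_right h.middle (Submodule.mem_sup_left A.2),
    Submodule.projectionOnto_apply_of_mem_right h.middle (Submodule.mem_sup_right C.2)]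
  simp

theorem IsSplitting.right_apply (h : IsSplitting a b c) (A : a) (B : b) (C : c) :
    c.projectionOnto (a ⊔ b) h.right (A + B + C) = C := by
  simp only [map_add]
  rw [Submodule.projectionOnto_apply_left,
    Submodule.projectionOnto_apply_of_mem_right h.right (Submodule.mem_sup_left A.2),
    Submodule.projectionOnto_apply_of_mem_right h.right (Submodule.mem_sup_right B.2)]
  simp

theorem IsSplitting.finrank_eq [FiniteDimensional ℝ L] (h : IsSplitting a b c) :
    finrank ℝ L = finrank ℝ a + (finrank ℝ b + finrank ℝ c) := by
  have h1 := Submodule.finrank_add_eq_of_isCompl h.left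
  have h2 := Submodule.finrank_sup_add_finrank_inf_eq b c
  have h3 : b ⊓ c = ⊥ := (h.middle.disjoint.mono_right le_sup_right).eq_bot
  rw [h3, finrank_bot] at h2
  omega

end Splitting

section TerngLocal

variable {E : Type*} [NormedAddCommGroup E] [NormedSpace ℝ E] [FiniteDimensional ℝ E]
  {G : Type*} [TopologicalSpace G] [ChartedSpace E G] [Group G] [LieGroup 𝓘(ℝ, E) ∞ G]
  {D : SymmetricDecomposition (LieAlg E G)} {a n : Submodule ℝ (LieAlg E G)}
  (ha : D.IsCartanSubspace a) (hn : D.b a ⊔ n = D.g₀) (hn' : Disjoint (D.b a) n)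

/-- The `𝔞`-component `θ_𝔞` of the Maurer–Cartan form, in the chart at `y₀`. -/
def localAlpha (y₀ : G × D.m a) (z : E × D.m a) : E × D.m a →ₗ[ℝ] a :=
  (a.projectionOnto _ (SymmetricDecomposition.isSplitting ha hn hn').left).comp
    ((localForm (maurerCartan (E := E) (G := G)) y₀.1 z.1).toLinearMap.comp
      (LinearMap.fst ℝ E (D.m a)))

theorem cartanTableau_apply (V : D.m a) (X : a) :
    SymmetricDecomposition.cartanTableau ha V X = D.adMB ha X V := by
  refine Subtype.ext ?_
  exact lie_skew _ _

/-- The bracket `[[X, V], [Y, V]] ∈ 𝔟`. -/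
def curvatureTerm (V : D.m a) (X Y : a) : D.b a :=
  ⟨⁅⁅(X : LieAlg E G), (V : LieAlg E G)⁆, ⁅(Y : LieAlg E G), (V : LieAlg E G)⁆⁆,
    SymmetricDecomposition.lie_lie_mem_b ha X.2 Y.2 V.2⟩

variable {k : ℕ} (A : Basis (Fin k) ℝ a) {y₀ : G × D.m a} {z : E × D.m a}

theorem localForm_terngEDS_apply (hz : z.1 ∈ (extChartAt 𝓘(ℝ, E) y₀.1).target)
    (v : E × D.m a) :
    localForm (terngEDS ha hn hn' A).form y₀ z v =
      (tableauConst (SymmetricDecomposition.isSplitting ha hn hn')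
        (localForm (maurerCartan (E := E) (G := G)) y₀.1 z.1 v.1)) -
        (D.adMB ha (localAlpha ha hn hn' y₀ z v) z.2, 0) := by
  unfold terngEDS
  rw [localForm_tableauSystem _ _ _ hz]
  rw [ContinuousLinearMap.comp_apply, sub_apply]
  congr 1
  exact Prod.ext (cartanTableau_apply ha _ _) rfl

/-- An element of 𝔤 is the sum of its three components. The equations force the 𝔠-component to
vanish and the 𝔟-component to be [α, V], where α is the 𝔞-component. -/
theorem tableau_eq_zero_iff (V : D.m a) (X : LieAlg E G) :
    (tableauConst (SymmetricDecomposition.isSplitting ha hn hn') -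
        tableauCoeff (SymmetricDecomposition.isSplitting ha hn hn')
          (SymmetricDecomposition.cartanTableau ha) V) X = 0 ↔
      X = (a.projectionOnto _ (SymmetricDecomposition.isSplitting ha hn hn').left X : LieAlg E G) +
        ⁅(a.projectionOnto _ (SymmetricDecomposition.isSplitting ha hn hn').left X : LieAlg E G),
          (V : LieAlg E G)⁆ := by
  have hs := SymmetricDecomposition.isSplitting ha hn hn'
  rw [sub_apply, sub_eq_zero, tableauConst_apply, tableauCoeff_apply, cartanTableau_apply,
    Prod.mk.injEq]
  constructor
  · rintro ⟨h1, h2⟩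
    have h3 := hs.add_eq X
    rw [h1, h2] at h3
    simpa using h3.symm
  · intro h
    have h3 : X = (a.projectionOnto _ hs.left X : LieAlg E G) +
        (D.adMB ha (a.projectionOnto _ hs.left X) V : LieAlg E G) +
        ((0 : (D.m a ⊔ n : Submodule ℝ (LieAlg E G))) : LieAlg E G) := by
      simpa using h
    generalize a.projectionOnto _ hs.left X = α at h3
    rw [h3, hs.middle_apply, hs.right_apply]
    exact ⟨rfl, rfl⟩

/-- Here [α, β] = 0, and the cross terms [α, [β, V]] and [[α, V], β] cancel by the Jacobi identity.
The zero summands put the result in the form expected by the projection lemmas of a splitting. -/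
theorem lie_add_lie_add (α β : a) (V : D.m a) :
    ⁅(α : LieAlg E G) + ⁅(α : LieAlg E G), (V : LieAlg E G)⁆,
      (β : LieAlg E G) + ⁅(β : LieAlg E G), (V : LieAlg E G)⁆⁆ =
    ((0 : a) : LieAlg E G) + curvatureTerm ha V α β +
      ((0 : (D.m a ⊔ n : Submodule ℝ (LieAlg E G))) : LieAlg E G) := by
  have h0 : ⁅(α : LieAlg E G), (β : LieAlg E G)⁆ = 0 := ha.abelian _ α.2 _ β.2
  have h1 := SymmetricDecomposition.lie_lie_comm (V := (V : LieAlg E G)) h0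
  simp only [add_lie, lie_add, zero_add, Submodule.coe_zero, add_zero, h0, h1]
  rw [← lie_skew (β : LieAlg E G) ⁅(α : LieAlg E G), (V : LieAlg E G)⁆]
  simp only [curvatureTerm]
  abel

theorem localForm_terngEDS_eq_zero_iff (hz : z.1 ∈ (extChartAt 𝓘(ℝ, E) y₀.1).target)
    (v : E × D.m a) :
    localForm (terngEDS ha hn hn' A).form y₀ z v = 0 ↔
      localForm (maurerCartan (E := E) (G := G)) y₀.1 z.1 v.1 =
        (localAlpha ha hn hn' y₀ z v : LieAlg E G) +
          ⁅(localAlpha ha hn hn' y₀ z v : LieAlg E G), (z.2 : LieAlg E G)⁆ := by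
  unfold terngEDS
  rw [localForm_tableauSystem _ _ _ hz]
  exact tableau_eq_zero_iff ha hn hn' z.2 _

/-- On vectors annihilated by η the bracket of the Maurer–Cartan values lies in 𝔟. So the
𝔠-component of dη imposes no condition there, and only dim 𝔟 scalar equations remain for each pair.
-/
theorem localExtDeriv_terngEDS (hz : z.1 ∈ (extChartAt 𝓘(ℝ, E) y₀.1).target)
    {v w : E × D.m a}
    (hv : localForm (terngEDS ha hn hn' A).form y₀ z v = 0)
    (hw : localForm (terngEDS ha hn hn' A).form y₀ z w = 0) :
    localExtDeriv (terngEDS ha hn hn' A).form y₀ z v w =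
      (D.adMB ha (localAlpha ha hn hn' y₀ z v) w.2 - D.adMB ha (localAlpha ha hn hn' y₀ z w) v.2 -
        curvatureTerm ha z.2 (localAlpha ha hn hn' y₀ z v) (localAlpha ha hn hn' y₀ z w), 0) := by
  have hs := SymmetricDecomposition.isSplitting ha hn hn'
  have hv' := (localForm_terngEDS_eq_zero_iff ha hn hn' A hz v).1 hv
  have hw' := (localForm_terngEDS_eq_zero_iff ha hn hn' A hz w).1 hw
  have h := localExtDeriv_tableauSystem hs (SymmetricDecomposition.cartanTableau ha) A hz v w
  refine h.trans ?_
  have hbr : ⁅localForm (maurerCartan (E := E) (G := G)) y₀.1 z.1 v.1,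
      localForm (maurerCartan (E := E) (G := G)) y₀.1 z.1 w.1⁆ =
      ((0 : a) : LieAlg E G) +
      (curvatureTerm ha z.2
        (localAlpha ha hn hn' y₀ z v) (localAlpha ha hn hn' y₀ z w) : D.b a) +
      ((0 : (D.m a ⊔ n : Submodule ℝ (LieAlg E G))) : LieAlg E G) := by
    rw [hv', hw', lie_add_lie_add ha]
  rw [hbr]
  have e1 := hs.left_apply 0 (curvatureTerm ha z.2
        (localAlpha ha hn hn' y₀ z v) (localAlpha ha hn hn' y₀ z w)) 0
  have e2 := hs.middle_apply 0 (curvatureTerm ha z.2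
        (localAlpha ha hn hn' y₀ z v) (localAlpha ha hn hn' y₀ z w)) 0
  have e3 := hs.right_apply 0 (curvatureTerm ha z.2
        (localAlpha ha hn hn' y₀ z v) (localAlpha ha hn hn' y₀ z w)) 0
  rw [sub_apply, tableauConst_apply, tableauCoeff_apply, tableauCoeff_apply, tableauCoeff_apply,
    e1, e2, e3, cartanTableau_apply, cartanTableau_apply, map_zero]
  simp only [Prod.mk_sub_mk, sub_zero]
  rfl

end TerngLocal

/-! ### Polar spaces and frame equations in terms of the exterior derivative -/

section BilinearExtDeriv

variable {W : Type*} [NormedAddCommGroup W] [NormedSpace ℝ W] {H : Type*} [TopologicalSpace H]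
  {I : ModelWithCorners ℝ W H} {N : Type*} [TopologicalSpace N] [ChartedSpace H N]
  {F : Type*} [NormedAddCommGroup F] [NormedSpace ℝ F]

/-- The exterior derivative in a chart, as a continuous bilinear map. -/
def localExtDerivL (η : ∀ y : N, TangentSpace I y →L[ℝ] F) (y₀ : N) (z : W) : W →L[ℝ] W →L[ℝ] F :=
  fderiv ℝ (localForm η y₀) z - (fderiv ℝ (localForm η y₀) z).flip

theorem localExtDeriv_swap (η : ∀ y : N, TangentSpace I y →L[ℝ] F) (y₀ : N) (z v w : W) :
    localExtDeriv η y₀ z v w = -localExtDeriv η y₀ z w v := by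
  simp [localExtDeriv]

theorem localExtDeriv_self (η : ∀ y : N, TangentSpace I y →L[ℝ] F) (y₀ : N) (z v : W) :
    localExtDeriv η y₀ z v v = 0 := sub_self _

theorem PfaffianSystem.mem_polarSpace {k : ℕ} (S : PfaffianSystem I N F k) {y₀ : N} {p : ℕ}
    {q : W × (Fin p → W)} {v : W} :
    v ∈ S.polarSpace y₀ q ↔ localForm S.form y₀ q.1 v = 0 ∧
      ∀ i, localExtDeriv S.form y₀ q.1 v (q.2 i) = 0 := by
  unfold PfaffianSystem.polarSpace
  rw [Submodule.mem_inf, Submodule.mem_iInf]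
  rfl

theorem PfaffianSystem.frameEquations_eq_zero_iff {k : ℕ} (S : PfaffianSystem I N F k) {y₀ : N}
    {p : ℕ} {q : W × (Fin p → W)} :
    S.frameEquations y₀ p q = 0 ↔ (∀ i, localForm S.form y₀ q.1 (q.2 i) = 0) ∧
      ∀ i j, localExtDeriv S.form y₀ q.1 (q.2 i) (q.2 j) = 0 := by
  unfold PfaffianSystem.frameEquations
  simp only [Prod.mk_eq_zero, funext_iff, Pi.zero_apply]

end BilinearExtDeriv

/-! ### Polar equations of the G/G₀-system -/

section TerngLocal

variable {E : Type*} [NormedAddCommGroup E] [NormedSpace ℝ E] [FiniteDimensional ℝ E]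
  {G : Type*} [TopologicalSpace G] [ChartedSpace E G] [Group G] [LieGroup 𝓘(ℝ, E) ∞ G]
  {D : SymmetricDecomposition (LieAlg E G)} {a n : Submodule ℝ (LieAlg E G)}
  (ha : D.IsCartanSubspace a) (hn : D.b a ⊔ n = D.g₀) (hn' : Disjoint (D.b a) n)
  {k : ℕ} (A : Basis (Fin k) ℝ a) {y₀ : G × D.m a} {z : E × D.m a}

theorem exists_localForm_maurerCartan_eq {g₀ : G} {z : E}
    (hz : z ∈ (extChartAt 𝓘(ℝ, E) g₀).target) (X : LieAlg E G) :
    ∃ u : E, localForm (maurerCartan (E := E) (G := G)) g₀ z u = X :=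
  ⟨_, localForm_leftFrame hz X⟩

theorem exists_localForm_terngEDS_eq (hz : z.1 ∈ (extChartAt 𝓘(ℝ, E) y₀.1).target)
    (α : a) (V : D.m a) (x : D.b a × (D.m a ⊔ n : Submodule ℝ (LieAlg E G))) :
    ∃ v : E × D.m a, localForm (terngEDS ha hn hn' A).form y₀ z v = x ∧
      localAlpha ha hn hn' y₀ z v = α ∧ v.2 = V := by
  have hs := SymmetricDecomposition.isSplitting ha hn hn'
  -- The summand [α, V] at the base point compensates the tableau term of the form, so that the
  -- value of the form is exactly x.
  obtain ⟨u, hu⟩ := exists_localForm_maurerCartan_eq hz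
    ((α : LieAlg E G) + (D.adMB ha α z.2 + x.1 : D.b a) + x.2)
  have hα : localAlpha ha hn hn' y₀ z (u, V) = α := by
    refine (congrArg _ hu).trans (hs.left_apply _ _ _)
  refine ⟨(u, V), ?_, hα, rfl⟩
  rw [localForm_terngEDS_apply ha hn hn' A hz, hα, hu, tableauConst_apply, hs.middle_apply,
    hs.right_apply]
  simp

theorem exists_tangent (hz : z.1 ∈ (extChartAt 𝓘(ℝ, E) y₀.1).target) (α : a) (V : D.m a) :
    ∃ v : E × D.m a, localForm (terngEDS ha hn hn' A).form y₀ z v = 0 ∧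
      localAlpha ha hn hn' y₀ z v = α ∧ v.2 = V :=
  exists_localForm_terngEDS_eq ha hn hn' A hz α V 0

theorem localForm_terngEDS_vertical (hz : z.1 ∈ (extChartAt 𝓘(ℝ, E) y₀.1).target)
    (V : D.m a) : localForm (terngEDS ha hn hn' A).form y₀ z (0, V) = 0 := by
  have h : localAlpha ha hn hn' y₀ z (0, V) = 0 := by simp [localAlpha]
  rw [localForm_terngEDS_apply ha hn hn' A hz, h, map_zero]
  simp

theorem localExtDeriv_terngEDS_vertical (hz : z.1 ∈ (extChartAt 𝓘(ℝ, E) y₀.1).target)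
    (v : E × D.m a) (V : D.m a) :
    localExtDeriv (terngEDS ha hn hn' A).form y₀ z v (0, V) =
      (D.adMB ha (localAlpha ha hn hn' y₀ z v) V, 0) := by
  refine (localExtDeriv_tableauSystem (SymmetricDecomposition.isSplitting ha hn hn')
    (SymmetricDecomposition.cartanTableau ha) A hz v (0, V)).trans ?_
  rw [map_zero, map_zero, lie_zero, map_zero, sub_zero, sub_zero, tableauCoeff_apply,
    cartanTableau_apply]
  rfl

/-- The linear map `w ↦ (η(w), dη(v, w)_𝔟)`. -/
def polarMap (y₀ : G × D.m a) (z v : E × D.m a) :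
    E × D.m a →ₗ[ℝ] (D.b a × (D.m a ⊔ n : Submodule ℝ (LieAlg E G))) × D.b a :=
  (localForm (terngEDS ha hn hn' A).form y₀ z).toLinearMap.prod
    ((LinearMap.fst ℝ _ _).comp (localExtDerivL (terngEDS ha hn hn' A).form y₀ z v).toLinearMap)

theorem polarMap_apply (v w : E × D.m a) : polarMap ha hn hn' A y₀ z v w =
    (localForm (terngEDS ha hn hn' A).form y₀ z w,
      (localExtDeriv (terngEDS ha hn hn' A).form y₀ z v w).1) := rfl

/-- Vertical vectors (0, V) are annihilated by η and change dη(v, ·) by the bracket with the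
𝔞-component of v. So the value of η can be adjusted first, and that of dη independently. -/
theorem polarMap_surjective (hz : z.1 ∈ (extChartAt 𝓘(ℝ, E) y₀.1).target) {v : E × D.m a}
    (hv : Function.Surjective (D.adMB ha (localAlpha ha hn hn' y₀ z v))) :
    Function.Surjective (polarMap ha hn hn' A y₀ z v) := by
  rintro ⟨x, y⟩
  obtain ⟨w, hw, -, -⟩ := exists_localForm_terngEDS_eq ha hn hn' A hz 0 0 x
  obtain ⟨V, hV⟩ := hv (y - (localExtDeriv (terngEDS ha hn hn' A).form y₀ z v w).1)
  refine ⟨w + (0, V), ?_⟩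
  rw [map_add, polarMap_apply, polarMap_apply, hw, localForm_terngEDS_vertical ha hn hn' A hz,
    localExtDeriv_terngEDS_vertical ha hn hn' A hz, hV]
  simp

theorem finrank_model (ha : D.IsCartanSubspace a) (hn : D.b a ⊔ n = D.g₀)
    (hn' : Disjoint (D.b a) n) : finrank ℝ (E × D.m a) = finrank ℝ a + finrank ℝ (D.m a) +
    finrank ℝ (D.b a × (D.m a ⊔ n : Submodule ℝ (LieAlg E G))) := by
  have h := (SymmetricDecomposition.isSplitting ha hn hn').finrank_eq
  have h' : finrank ℝ (LieAlg E G) = finrank ℝ E := rfl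
  rw [finrank_prod, finrank_prod]
  omega

theorem finrank_polarSpace_zero {q : (E × D.m a) × (Fin 0 → E × D.m a)}
    (hz : q.1.1 ∈ (extChartAt 𝓘(ℝ, E) y₀.1).target) :
    finrank ℝ ((terngEDS ha hn hn' A).polarSpace y₀ q) = finrank ℝ a + finrank ℝ (D.m a) := by
  have h1 : (terngEDS ha hn hn' A).polarSpace y₀ q =
      LinearMap.ker (localForm (terngEDS ha hn hn' A).form y₀ q.1).toLinearMap := by
    ext v
    rw [PfaffianSystem.mem_polarSpace]
    simp
  have h2 := LinearMap.finrank_range_add_finrank_ker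
    (localForm (terngEDS ha hn hn' A).form y₀ q.1).toLinearMap
  have h3 : LinearMap.range (localForm (terngEDS ha hn hn' A).form y₀ q.1).toLinearMap = ⊤ := by
    rw [LinearMap.range_eq_top]
    intro x
    obtain ⟨v, hv, -⟩ := exists_localForm_terngEDS_eq ha hn hn' A hz 0 0 x
    exact ⟨v, hv⟩
  rw [h3, finrank_top] at h2
  have h4 := finrank_model (E := E) (G := G) ha hn hn'
  rw [h1]
  omega

variable [LieAlgebra.IsKilling ℝ (LieAlg E G)]

/-- The relations `dη(e, v) = dη(e, w) = 0` imply `dη(v, w) = 0` for vectors annihilated by `η`,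
if `ad` of the `𝔞`-component of `e` is onto. -/
theorem localExtDeriv_eq_zero_of_fst (hz : z.1 ∈ (extChartAt 𝓘(ℝ, E) y₀.1).target)
    {e v w : E × D.m a} (he : localForm (terngEDS ha hn hn' A).form y₀ z e = 0)
    (hs : Function.Surjective (D.adMB ha (localAlpha ha hn hn' y₀ z e)))
    (hv : localForm (terngEDS ha hn hn' A).form y₀ z v = 0)
    (hw : localForm (terngEDS ha hn hn' A).form y₀ z w = 0)
    (hev : (localExtDeriv (terngEDS ha hn hn' A).form y₀ z e v).1 = 0)
    (hew : (localExtDeriv (terngEDS ha hn hn' A).form y₀ z e w).1 = 0) :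
    localExtDeriv (terngEDS ha hn hn' A).form y₀ z v w = 0 := by
  rw [localExtDeriv_terngEDS ha hn hn' A hz he hv, sub_eq_zero] at hev
  rw [localExtDeriv_terngEDS ha hn hn' A hz he hw, sub_eq_zero] at hew
  rw [localExtDeriv_terngEDS ha hn hn' A hz hv hw]
  refine Prod.ext ?_ rfl
  rw [Prod.fst_zero, sub_eq_zero]
  exact Subtype.ext (SymmetricDecomposition.adMB_eq_of_adMB_eq ha hs (congrArg Subtype.val hev)
    (congrArg Subtype.val hew))

theorem frameEquations_eq_zero_of_fst {p : ℕ} {q : (E × D.m a) × (Fin (p + 1) → E × D.m a)}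
    (hz : q.1.1 ∈ (extChartAt 𝓘(ℝ, E) y₀.1).target)
    (hs : Function.Surjective (D.adMB ha (localAlpha ha hn hn' y₀ q.1 (q.2 0))))
    (h0 : ∀ i, localForm (terngEDS ha hn hn' A).form y₀ q.1 (q.2 i) = 0)
    (h1 : ∀ i : Fin p,
      (localExtDeriv (terngEDS ha hn hn' A).form y₀ q.1 (q.2 0) (q.2 i.succ)).1 = 0) :
    (terngEDS ha hn hn' A).frameEquations y₀ (p + 1) q = 0 := by
  rw [PfaffianSystem.frameEquations_eq_zero_iff]
  have h2 : ∀ i, (localExtDeriv (terngEDS ha hn hn' A).form y₀ q.1 (q.2 0) (q.2 i)).1 = 0 := by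
    intro i
    refine Fin.cases ?_ (fun i => h1 i) i
    rw [localExtDeriv_self]; rfl
  exact ⟨h0, fun i j => localExtDeriv_eq_zero_of_fst ha hn hn' A hz (h0 0) hs (h0 i) (h0 j)
    (h2 i) (h2 j)⟩

/-- The equations against the first vector imply those against all the others, so the polar space
does not shrink after the first step of the flag. -/
theorem polarSpace_succ {p : ℕ} {q : (E × D.m a) × (Fin (p + 1) → E × D.m a)}
    (hz : q.1.1 ∈ (extChartAt 𝓘(ℝ, E) y₀.1).target)
    (hs : Function.Surjective (D.adMB ha (localAlpha ha hn hn' y₀ q.1 (q.2 0))))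
    (hq : (terngEDS ha hn hn' A).frameEquations y₀ (p + 1) q = 0) :
    (terngEDS ha hn hn' A).polarSpace y₀ q =
      LinearMap.ker (polarMap ha hn hn' A y₀ q.1 (q.2 0)) := by
  rw [PfaffianSystem.frameEquations_eq_zero_iff] at hq
  ext v
  rw [PfaffianSystem.mem_polarSpace, LinearMap.mem_ker]
  refine Iff.trans ?_ (Prod.ext_iff (x := polarMap ha hn hn' A y₀ q.1 (q.2 0) v) (y := 0)).symm
  constructor
  · rintro ⟨hv, h⟩
    refine ⟨hv, ?_⟩
    rw [polarMap_apply, localExtDeriv_swap, h 0, neg_zero]; rfl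
  · rintro ⟨hv, h⟩
    refine ⟨hv, fun i => ?_⟩
    refine localExtDeriv_eq_zero_of_fst ha hn hn' A hz (hq.1 0) hs hv (hq.1 i) h ?_
    rw [hq.2 0 i]; rfl

/-- Of the total dimension dim 𝔞 + dim 𝔪 + rank η, the surjective polar map removes rank η and dim 𝔟
= dim 𝔪. -/
theorem finrank_polarSpace_succ (hab : finrank ℝ (D.b a) = finrank ℝ (D.m a)) {p : ℕ}
    {q : (E × D.m a) × (Fin (p + 1) → E × D.m a)}
    (hz : q.1.1 ∈ (extChartAt 𝓘(ℝ, E) y₀.1).target)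
    (hs : Function.Surjective (D.adMB ha (localAlpha ha hn hn' y₀ q.1 (q.2 0))))
    (hq : (terngEDS ha hn hn' A).frameEquations y₀ (p + 1) q = 0) :
    finrank ℝ ((terngEDS ha hn hn' A).polarSpace y₀ q) = finrank ℝ a := by
  rw [polarSpace_succ ha hn hn' A hz hs hq]
  have h2 := LinearMap.finrank_range_add_finrank_ker (polarMap ha hn hn' A y₀ q.1 (q.2 0))
  rw [LinearMap.range_eq_top.2 (polarMap_surjective ha hn hn' A hz hs), finrank_top] at h2
  have h4 := finrank_model (E := E) (G := G) ha hn hn'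
  rw [finrank_prod (M := D.b a × (D.m a ⊔ n : Submodule ℝ (LieAlg E G)))] at h2
  omega

end TerngLocal

/-! ### Ordinary flags -/

section Calculus

variable {X Y Z : Type*} [NormedAddCommGroup X] [NormedSpace ℝ X] [NormedAddCommGroup Y]
  [NormedSpace ℝ Y] [NormedAddCommGroup Z] [NormedSpace ℝ Z]

theorem hasFDerivAt_comp_fst {f : X → Z} {q : X × Y} (hf : DifferentiableAt ℝ f q.1) :
    HasFDerivAt (fun q : X × Y => f q.1)
      ((fderiv ℝ f q.1).comp (ContinuousLinearMap.fst ℝ X Y)) q :=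
  hf.hasFDerivAt.comp q hasFDerivAt_fst

end Calculus

section Chart

variable {W : Type*} [NormedAddCommGroup W] [NormedSpace ℝ W] {H : Type*} [TopologicalSpace H]
  {I : ModelWithCorners ℝ W H} {N : Type*} [TopologicalSpace N] [ChartedSpace H N]
  {F : Type*} [NormedAddCommGroup F] [NormedSpace ℝ F]

theorem injective_mvfderiv_chart [I.Boundaryless] [IsManifold I ∞ N] (y : N) :
    Function.Injective (mvfderiv I (extChartAt I y) y) := by
  intro v w h
  have hv := mfderiv_symm_chart_apply (mem_extChartAt_source (I := I) y) v
  rw [h] at hv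
  exact hv.symm.trans (mfderiv_symm_chart_apply (mem_extChartAt_source (I := I) y) w)

theorem surjective_mvfderiv_chart [I.Boundaryless] [IsManifold I ∞ N] (y : N) :
    Function.Surjective (mvfderiv I (extChartAt I y) y) := by
  intro w
  have h := mfderiv_chart_symm_apply (mem_extChartAt_target (I := I) y) w
  have h2 : ∀ (y' : N) (_ : y' = y) (u : W), mvfderiv I (extChartAt I y) y' u = w →
      ∃ v, mvfderiv I (extChartAt I y) y v = w := by
    rintro y' rfl u hu; exact ⟨u, hu⟩
  exact h2 _ (extChartAt_to_inv y) _ h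

namespace PfaffianSystem

variable [FiniteDimensional ℝ F] {k : ℕ} (S : PfaffianSystem I N F k)

/-- A criterion for an integral element to be Kähler-ordinary: locally, the equations
`η(e_i) = 0` and the components `π(dη(e_0, e_i)) = 0` suffice, and the corresponding polar
equations are independent. -/
theorem exists_ordinary_equations {B : Type*} [NormedAddCommGroup B] [NormedSpace ℝ B]
    [FiniteDimensional ℝ B] (π : F →L[ℝ] B) {y₀ : N} {p : ℕ} {q₀ : W × (Fin (p + 1) → W)}
    (hη : ContDiffAt ℝ ∞ (localForm S.form y₀) q₀.1)
    (hsurj : Function.Surjective fun w => (localForm S.form y₀ q₀.1 w,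
      π (localExtDeriv S.form y₀ q₀.1 (q₀.2 0) w)))
    (hloc : ∀ᶠ q in 𝓝 q₀, (∀ i, localForm S.form y₀ q.1 (q.2 i) = 0) →
      (∀ i : Fin p, π (localExtDeriv S.form y₀ q.1 (q.2 0) (q.2 i.succ)) = 0) →
      S.frameEquations y₀ (p + 1) q = 0) :
    ∃ (c : ℕ) (l : ((Fin (p + 1) → F) × (Fin (p + 1) → Fin (p + 1) → F)) →L[ℝ] (Fin c → ℝ)),
      Function.Surjective (fderiv ℝ (fun q => l (S.frameEquations y₀ (p + 1) q)) q₀) ∧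
      ∀ᶠ q in 𝓝 q₀, l (S.frameEquations y₀ (p + 1) q) = 0 →
        S.frameEquations y₀ (p + 1) q = 0 := by
  let Φ : ((Fin (p + 1) → F) × (Fin p → B)) ≃L[ℝ]
      (Fin (finrank ℝ ((Fin (p + 1) → F) × (Fin p → B))) → ℝ) :=
    ContinuousLinearEquiv.ofFinrankEq (by simp)
  let l₀ : ((Fin (p + 1) → F) × (Fin (p + 1) → Fin (p + 1) → F)) →L[ℝ]
      (Fin (p + 1) → F) × (Fin p → B) :=
    (ContinuousLinearMap.fst ℝ _ _).prod (ContinuousLinearMap.pi fun i : Fin p =>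
      π.comp ((ContinuousLinearMap.proj i.succ).comp
        ((ContinuousLinearMap.proj (R := ℝ) (φ := fun _ : Fin (p + 1) => Fin (p + 1) → F) 0).comp
          (ContinuousLinearMap.snd ℝ _ _))))
  refine ⟨_, Φ.toContinuousLinearMap.comp l₀, ?_, ?_⟩
  · have h1 : HasFDerivAt (fun q : W × (Fin (p + 1) → W) => localForm S.form y₀ q.1)
        ((fderiv ℝ (localForm S.form y₀) q₀.1).comp (ContinuousLinearMap.fst ℝ _ _)) q₀ :=
      hasFDerivAt_comp_fst (hη.differentiableAt (by simp))
    have h2 : ∀ i, HasFDerivAt (fun q : W × (Fin (p + 1) → W) => q.2 i)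
        ((ContinuousLinearMap.proj (R := ℝ) (φ := fun _ : Fin (p + 1) => W) i).comp
          (ContinuousLinearMap.snd ℝ _ _)) q₀ := fun i =>
      ((ContinuousLinearMap.proj (R := ℝ) (φ := fun _ : Fin (p + 1) => W) i).comp
          (ContinuousLinearMap.snd ℝ W _)).hasFDerivAt
    have h3 : DifferentiableAt ℝ (fderiv ℝ (localForm S.form y₀)) q₀.1 :=
      (hη.fderiv_right (m := 1) (show (2 : WithTop ℕ∞) ≤ ∞ from ENat.LEInfty.out)).differentiableAt
        (by simp)
    have h4 := hasFDerivAt_comp_fst (Y := Fin (p + 1) → W) (Z := W →L[ℝ] W →L[ℝ] F)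
      (f := fderiv ℝ (localForm S.form y₀)) (q := q₀) h3
    have h5 := (hasFDerivAt_pi.2 fun i : Fin (p + 1) => h1.clm_apply (h2 i)).prodMk
      (hasFDerivAt_pi.2 fun i : Fin p => π.hasFDerivAt.comp q₀
        (((h4.clm_apply (h2 0)).clm_apply (h2 i.succ)).sub
          ((h4.clm_apply (h2 i.succ)).clm_apply (h2 0))))
    have h6 : (fun q => Φ.toContinuousLinearMap.comp l₀ (S.frameEquations y₀ (p + 1) q)) =
        Φ ∘ fun q => l₀ (S.frameEquations y₀ (p + 1) q) := rfl
    rw [h6, Φ.comp_fderiv]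
    have h7 := HasFDerivAt.fderiv (𝕜 := ℝ)
      (f := fun q => l₀ (S.frameEquations y₀ (p + 1) q)) h5
    rw [h7]
    refine Φ.surjective.comp ?_
    rintro ⟨x, y⟩
    -- The base point stays fixed and only the frame vectors vary. The system is triangular: δ₀ is
    -- chosen for η(e_0) alone (the second entry 0 plays no role), and each later vector then
    -- absorbs the change in dη(e_0, e_i) caused by δ₀.
    obtain ⟨δ₀, hδ₀⟩ := hsurj (x 0, 0)
    choose δ hδ using fun i : Fin p => hsurj
      (x i.succ, y i - π (localExtDeriv S.form y₀ q₀.1 δ₀ (q₀.2 i.succ)))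
    refine ⟨(0, Fin.cons δ₀ δ), Prod.ext (funext fun i => ?_) (funext fun i => ?_)⟩
    · refine Fin.cases ?_ (fun i => ?_) i
      · simpa using congrArg Prod.fst hδ₀
      · simpa using congrArg Prod.fst (hδ i)
    · have h8 := congrArg Prod.snd (hδ i)
      simp only [localExtDeriv, map_sub] at h8
      rw [eq_sub_iff_add_eq] at h8
      simp [← h8]
      abel
  · filter_upwards [hloc] with q hq h
    have h' : l₀ (S.frameEquations y₀ (p + 1) q) = 0 := Φ.map_eq_zero_iff.1 h
    exact hq (fun i => congrFun (congrArg Prod.fst h') i)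
      (fun i => congrFun (congrArg Prod.snd h') i)

theorem isKahlerOrdinary_zero (y : N) (e : Fin 0 → TangentSpace I y) : S.IsKahlerOrdinary y e where
  linearIndependent := linearIndependent_empty_type
  integral := Subsingleton.elim _ _
  ordinary := ⟨0, 0, fun _ => ⟨0, Subsingleton.elim _ _⟩, .of_forall fun _ _ => Subsingleton.elim _ _⟩

end PfaffianSystem

end Chart

/-! ### Openness and genericity of surjectivity in a linear family of maps -/

section Open

variable {X Y Z : Type*} [NormedAddCommGroup X] [NormedSpace ℝ X] [FiniteDimensional ℝ X]
  [NormedAddCommGroup Y] [NormedSpace ℝ Y] [FiniteDimensional ℝ Y]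
  [NormedAddCommGroup Z] [NormedSpace ℝ Z] [FiniteDimensional ℝ Z]

theorem isOpen_setOf_surjective_apply (T : X →ₗ[ℝ] Y →ₗ[ℝ] Z) (h : finrank ℝ Z = finrank ℝ Y) :
    IsOpen {x | Function.Surjective (T x)} := by
  have h1 : {x | Function.Surjective (T x)} =
      (fun x => (LinearMap.toContinuousLinearMap (T x) : Y →L[ℝ] Z)) ⁻¹'
        {L : Y →L[ℝ] Z | Function.Injective L} := by
    ext x
    exact (LinearMap.injective_iff_surjective_of_finrank_eq_finrank h.symm).symm
  rw [h1]
  refine ContinuousLinearMap.isOpen_injective.preimage ?_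
  exact ((LinearMap.toContinuousLinearMap : (Y →ₗ[ℝ] Z) ≃ₗ[ℝ] (Y →L[ℝ] Z)).toLinearMap.comp
    T).continuous_of_finiteDimensional

/-- In a pencil of linear maps containing an isomorphism, all but finitely many are onto. -/
theorem eventually_surjective_add_smul (T : X →ₗ[ℝ] Y →ₗ[ℝ] Z) (h : finrank ℝ Z = finrank ℝ Y)
    (x : X) {u : X} (hu : Function.Surjective (T u)) :
    ∀ᶠ t : ℝ in 𝓝[≠] 0, Function.Surjective (T (x + t • u)) := by
  have hu' : Function.Injective (T u) :=
    (LinearMap.injective_iff_surjective_of_finrank_eq_finrank h.symm).2 hu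
  let e := LinearEquiv.ofBijective (T u) ⟨hu', hu⟩
  -- T(x) + t T(u) has a kernel exactly when t is an eigenvalue of −T(u)⁻¹ T(x).
  let f : Module.End ℝ Y := -(e.symm.toLinearMap.comp (T x))
  have hfin : {μ : ℝ | f.HasEigenvalue μ}.Finite := f.finite_hasEigenvalue
  -- Zero may itself be an eigenvalue, since T(x) need not be onto; hence the punctured
  -- neighbourhood.
  have h1 : ({μ : ℝ | f.HasEigenvalue μ} \ {0})ᶜ ∈ 𝓝 (0 : ℝ) :=
    (hfin.subset Set.sdiff_subset).isClosed.isOpen_compl.mem_nhds (by simp)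
  filter_upwards [nhdsWithin_le_nhds h1, self_mem_nhdsWithin] with t ht ht0
  have ht' : ¬ f.HasEigenvalue t := fun hh => ht ⟨hh, ht0⟩
  refine (LinearMap.injective_iff_surjective_of_finrank_eq_finrank h.symm).1 ?_
  rw [injective_iff_map_eq_zero]
  intro y hy
  by_contra hne
  refine ht' (Module.End.hasEigenvalue_of_hasEigenvector (x := y) ⟨?_, hne⟩)
  rw [Module.End.mem_eigenspace_iff]
  have h2 : T x y = -(t • e y) := by
    rw [eq_neg_iff_add_eq_zero]
    have h3 : e y = T u y := rfl
    rw [h3]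
    simpa using hy
  simp [f, h2]

end Open

/-! ### Frames of integral elements and a lower bound for polar spaces -/

section Frames

variable {W : Type*} [NormedAddCommGroup W] [NormedSpace ℝ W] {H : Type*} [TopologicalSpace H]
  {I : ModelWithCorners ℝ W H} {N : Type*} [TopologicalSpace N] [ChartedSpace H N]
  {F : Type*} [NormedAddCommGroup F] [NormedSpace ℝ F] {k : ℕ} (S : PfaffianSystem I N F k)

namespace PfaffianSystem

theorem frameEquations_comp_eq_zero {y₀ : N} {p p' : ℕ} (i : Fin p' → Fin p) {z : W}
    {ε : Fin p → W} (h : S.frameEquations y₀ p (z, ε) = 0) :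
    S.frameEquations y₀ p' (z, fun j => ε (i j)) = 0 := by
  rw [frameEquations_eq_zero_iff] at h ⊢
  exact ⟨fun j => h.1 (i j), fun j l => h.2 (i j) (i l)⟩

variable [I.Boundaryless] [IsManifold I ∞ N]

theorem isIntegralElement_span {y : N} {e : Fin k → TangentSpace I y} (he : LinearIndependent ℝ e)
    (h : S.frameEquations y k (localFrame y e) = 0) (hind : S.indep y e ≠ 0) :
    S.IsIntegralElement y (Submodule.span ℝ (Set.range e)) := by
  rw [frameEquations_eq_zero_iff] at h
  refine ⟨by rw [finrank_span_eq_card he, Fintype.card_fin], ?_, ?_,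
    e, fun i => Submodule.subset_span ⟨i, rfl⟩, hind⟩
  · have h1 : Submodule.span ℝ (Set.range e) ≤ LinearMap.ker (S.form y).toLinearMap := by
      rw [Submodule.span_le]
      rintro _ ⟨i, rfl⟩
      exact (localForm_chart S.form (mem_extChartAt_source y) (e i)).symm.trans (h.1 i)
    exact fun v hv => h1 hv
  · let B : W →L[ℝ] W →L[ℝ] F := localExtDerivL S.form y (extChartAt I y y)
    let φ := mvfderiv I (extChartAt I y) y
    have h1 : ∀ i, Submodule.span ℝ (Set.range e) ≤
        LinearMap.ker ((B (φ (e i))).comp φ).toLinearMap := by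
      intro i
      rw [Submodule.span_le]
      rintro _ ⟨j, rfl⟩
      exact h.2 i j
    have h2 : ∀ w ∈ Submodule.span ℝ (Set.range e), Submodule.span ℝ (Set.range e) ≤
        LinearMap.ker ((B.flip (φ w)).comp φ).toLinearMap := by
      intro w hw
      rw [Submodule.span_le]
      rintro _ ⟨j, rfl⟩
      exact h1 j hw
    exact fun v hv w hw => h2 w hw hv

theorem frame_mem_polarSpace {y : N} {e : Fin k → TangentSpace I y}
    (h : S.IsKahlerOrdinary y e) {p : ℕ} (i : Fin p → Fin k) (j : Fin k) :
    mvfderiv I (extChartAt I y) y (e j) ∈ S.polarSpace y (localFrame y fun l => e (i l)) := by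
  have h0 := (frameEquations_eq_zero_iff S).1 h.integral
  rw [mem_polarSpace]
  exact ⟨h0.1 j, fun l => h0.2 j (i l)⟩

/-- The whole integral element E_k is contained in the polar space of each of its subspaces. -/
theorem le_finrank_polarSpace [FiniteDimensional ℝ W] {y : N} {e : Fin k → TangentSpace I y}
    (h : S.IsKahlerOrdinary y e) {p : ℕ} (i : Fin p → Fin k) :
    k ≤ finrank ℝ (S.polarSpace y (localFrame y fun l => e (i l))) := by
  have h1 : LinearIndependent ℝ fun j => mvfderiv I (extChartAt I y) y (e j) :=
    h.linearIndependent.map' (mvfderiv I (extChartAt I y) y).toLinearMap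
      (LinearMap.ker_eq_bot.2 (injective_mvfderiv_chart y))
  have h2 := finrank_span_eq_card h1
  rw [Fintype.card_fin] at h2
  refine h2.symm.le.trans (Submodule.finrank_mono ?_)
  rw [Submodule.span_le]
  rintro _ ⟨j, rfl⟩
  exact frame_mem_polarSpace S h i j

end PfaffianSystem

end Frames

/-! ### Involution and Cartan characters of the G/G₀-system -/

section Flags

variable {E : Type*} [NormedAddCommGroup E] [NormedSpace ℝ E] [FiniteDimensional ℝ E]
  {G : Type*} [TopologicalSpace G] [ChartedSpace E G] [Group G] [LieGroup 𝓘(ℝ, E) ∞ G]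
  {D : SymmetricDecomposition (LieAlg E G)} {a n : Submodule ℝ (LieAlg E G)}
  (ha : D.IsCartanSubspace a) (hn : D.b a ⊔ n = D.g₀) (hn' : Disjoint (D.b a) n)
  {k : ℕ} (A : Basis (Fin k) ℝ a)

theorem extChartAt_fst_mem_target (y : G × D.m a) :
    (extChartAt (𝓘(ℝ, E).prod 𝓘(ℝ, D.m a)) y y).1 ∈ (extChartAt 𝓘(ℝ, E) y.1).target :=
  (target_prod y).1 (mem_extChartAt_target y)

theorem continuousAt_localAlpha {y₀ : G × D.m a} {q₀ : (E × D.m a) × (E × D.m a)}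
    (hz : q₀.1.1 ∈ (extChartAt 𝓘(ℝ, E) y₀.1).target) :
    ContinuousAt (fun q : (E × D.m a) × (E × D.m a) => localAlpha ha hn hn' y₀ q.1 q.2) q₀ := by
  have h1 : ContinuousAt (localForm (maurerCartan (E := E) (G := G)) y₀.1) q₀.1.1 :=
    (contDiffAt_localForm_maurerCartan hz).continuousAt
  have h2 : ContinuousAt (fun q : (E × D.m a) × (E × D.m a) =>
      localForm (maurerCartan (E := E) (G := G)) y₀.1 q.1.1 q.2.1) q₀ :=
    (h1.comp (x := q₀) (f := fun q : (E × D.m a) × (E × D.m a) => q.1.1)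
      (by fun_prop)).clm_apply (by fun_prop)
  exact (LinearMap.continuous_of_finiteDimensional (a.projectionOnto _
    (SymmetricDecomposition.isSplitting ha hn hn').left)).continuousAt.comp h2

theorem eventually_surjective_adMB (hab : finrank ℝ (D.b a) = finrank ℝ (D.m a))
    {y₀ : G × D.m a} {p : ℕ} {q₀ : (E × D.m a) × (Fin (p + 1) → E × D.m a)}
    (hz : q₀.1.1 ∈ (extChartAt 𝓘(ℝ, E) y₀.1).target)
    (hs : Function.Surjective (D.adMB ha (localAlpha ha hn hn' y₀ q₀.1 (q₀.2 0)))) :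
    ∀ᶠ q in 𝓝 q₀, q.1.1 ∈ (extChartAt 𝓘(ℝ, E) y₀.1).target ∧
      Function.Surjective (D.adMB ha (localAlpha ha hn hn' y₀ q.1 (q.2 0))) := by
  refine Filter.Eventually.and (continuousAt_fst.eventually (eventually_target hz)) ?_
  have hc : ContinuousAt (fun q : (E × D.m a) × (Fin (p + 1) → E × D.m a) => (q.1, q.2 0)) q₀ := by
    fun_prop
  exact ((continuousAt_localAlpha ha hn hn' (q₀ := (q₀.1, q₀.2 0)) hz).comp
    (x := q₀) (f := fun q : (E × D.m a) × (Fin (p + 1) → E × D.m a) => (q.1, q.2 0)) hc).eventually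
    ((isOpen_setOf_surjective_apply (D.adMB ha) hab).mem_nhds hs)

theorem isKahlerRegular_zero (y : G × D.m a)
    (e : Fin 0 → TangentSpace (𝓘(ℝ, E).prod 𝓘(ℝ, D.m a)) y) :
    (terngEDS ha hn hn' A).IsKahlerRegular y e where
  toIsKahlerOrdinary := PfaffianSystem.isKahlerOrdinary_zero _ y e
  regular := by
    have hz := extChartAt_fst_mem_target (E := E) y
    have h1 : ∀ᶠ q : (E × D.m a) × (Fin 0 → E × D.m a) in
        𝓝 (PfaffianSystem.localFrame y e), q.1.1 ∈ (extChartAt 𝓘(ℝ, E) y.1).target :=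
      continuousAt_fst.eventually (eventually_target hz)
    filter_upwards [h1] with q hq _
    rw [finrank_polarSpace_zero ha hn hn' A hq, finrank_polarSpace_zero ha hn hn' A hz]

variable [LieAlgebra.IsKilling ℝ (LieAlg E G)]

/-- Only the first vector matters: surjectivity of `ad` of its 𝔞-component is an open condition, and
wherever it holds it gives both independent equations and a polar space of dimension dim 𝔞. -/
theorem isKahlerRegular_succ (hab : finrank ℝ (D.b a) = finrank ℝ (D.m a)) (y : G × D.m a) {p : ℕ}
    {e : Fin (p + 1) → TangentSpace (𝓘(ℝ, E).prod 𝓘(ℝ, D.m a)) y} (he : LinearIndependent ℝ e)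
    (h0 : (terngEDS ha hn hn' A).frameEquations y (p + 1) (PfaffianSystem.localFrame y e) = 0)
    (hs : Function.Surjective (D.adMB ha (localAlpha ha hn hn' y
      (PfaffianSystem.localFrame y e).1 ((PfaffianSystem.localFrame y e).2 0)))) :
    (terngEDS ha hn hn' A).IsKahlerRegular y e := by
  have hz := extChartAt_fst_mem_target (E := E) y
  have hev := eventually_surjective_adMB ha hn hn' hab (q₀ := PfaffianSystem.localFrame y e) hz hs
  refine ⟨⟨he, h0, ?_⟩, ?_⟩
  · refine PfaffianSystem.exists_ordinary_equations _ (ContinuousLinearMap.fst ℝ _ _)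
      (contDiffAt_localForm_tableauSystem _ _ _ hz)
      (polarMap_surjective ha hn hn' A hz hs) ?_
    filter_upwards [hev] with q hq h1 h2
    exact frameEquations_eq_zero_of_fst ha hn hn' A hq.1 hq.2 h1 h2
  · filter_upwards [hev] with q hq h1
    rw [finrank_polarSpace_succ ha hn hn' A hab hq.1 hq.2 h1,
      finrank_polarSpace_succ ha hn hn' A hab hz hs h0]

/-- Through every point there is an integral element on which `θ_𝔞` takes the values `A_i`. -/
theorem exists_integral_frame (hA : ∀ i, D.IsRegular (A i : LieAlg E G)) {y₀ : G × D.m a}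
    {z : E × D.m a} (hz : z.1 ∈ (extChartAt 𝓘(ℝ, E) y₀.1).target) :
    ∃ ε : Fin k → E × D.m a, (∀ i, localAlpha ha hn hn' y₀ z (ε i) = A i) ∧
      (terngEDS ha hn hn' A).frameEquations y₀ k (z, ε) = 0 := by
  cases k with
  | zero => exact ⟨Fin.elim0, fun i => i.elim0, Subsingleton.elim _ _⟩
  | succ k =>
    have hi := SymmetricDecomposition.adMB_injective_of_isRegular ha (hA 0)
    have hs := (LinearMap.injective_iff_surjective_of_finrank_eq_finrank
      (SymmetricDecomposition.finrank_b_eq ha (hA 0)).symm).1 hi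
    let T := LinearEquiv.ofBijective _ ⟨hi, hs⟩
    -- The 𝔪-components W_i solve [A_0, W_i] = [[A_0, V], [A_i, V]]. In particular W_0 = 0, so the
    -- equation between the vectors 0 and i has no further term.
    choose ε h1 h2 h3 using fun i : Fin (k + 1) => exists_tangent ha hn hn' A hz (A i)
      (T.symm (curvatureTerm ha z.2 (A 0) (A i)))
    refine ⟨ε, h2, frameEquations_eq_zero_of_fst ha hn hn' A hz (q := (z, ε)) ?_ h1 fun i => ?_⟩
    · rw [h2]; exact hs
    · have h0 : curvatureTerm ha z.2 (A 0) (A 0) = 0 := Subtype.ext (lie_self _)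
      have h4 : D.adMB ha (A 0) (T.symm (curvatureTerm ha z.2 (A 0) (A i.succ))) =
          curvatureTerm ha z.2 (A 0) (A i.succ) := T.apply_symm_apply _
      rw [localExtDeriv_terngEDS ha hn hn' A hz (h1 0) (h1 i.succ), h2, h2, h3, h3, h0,
        T.symm.map_zero, LinearMap.map_zero (D.adMB ha (A i.succ)), sub_zero, h4, sub_self]

theorem localAlpha_chart (y : G × D.m a) (v : TangentSpace (𝓘(ℝ, E).prod 𝓘(ℝ, D.m a)) y) :
    localAlpha ha hn hn' y (extChartAt (𝓘(ℝ, E).prod 𝓘(ℝ, D.m a)) y y)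
      (mvfderiv (𝓘(ℝ, E).prod 𝓘(ℝ, D.m a)) (extChartAt (𝓘(ℝ, E).prod 𝓘(ℝ, D.m a)) y) y v) =
    a.projectionOnto _ (SymmetricDecomposition.isSplitting ha hn hn').left
      (maurerCartanProd E G (D.m a) y v) := by
  have h := localForm_chart (maurerCartanProd E G (D.m a)) (mem_extChartAt_source y) v
  have h' := localForm_maurerCartanProd_apply (extChartAt_fst_mem_target (E := E) y)
    (mvfderiv (𝓘(ℝ, E).prod 𝓘(ℝ, D.m a)) (extChartAt (𝓘(ℝ, E).prod 𝓘(ℝ, D.m a)) y) y v)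
  exact congrArg (a.projectionOnto _ (SymmetricDecomposition.isSplitting ha hn hn').left)
    (h'.symm.trans h)

theorem inInvolution_terngEDS (hA : ∀ i, D.IsRegular (A i : LieAlg E G)) :
    (terngEDS ha hn hn' A).InInvolution := by
  intro y
  obtain ⟨ε, h1, h2⟩ := exists_integral_frame ha hn hn' A hA (extChartAt_fst_mem_target (E := E) y)
  choose e he using fun i =>
    surjective_mvfderiv_chart (I := 𝓘(ℝ, E).prod 𝓘(ℝ, D.m a)) y (ε i)
  have hfr : PfaffianSystem.localFrame y e =
      (extChartAt (𝓘(ℝ, E).prod 𝓘(ℝ, D.m a)) y y, ε) := Prod.ext rfl (funext he)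
  have hα : ∀ i, a.projectionOnto _ (SymmetricDecomposition.isSplitting ha hn hn').left
      (maurerCartanProd E G (D.m a) y (e i)) = A i := by
    intro i
    rw [← localAlpha_chart ha hn hn', he, h1]
  have hli : LinearIndependent ℝ e := by
    refine LinearIndependent.of_comp ((a.projectionOnto _
      (SymmetricDecomposition.isSplitting ha hn hn').left).comp
        (maurerCartanProd E G (D.m a) y).toLinearMap) ?_
    convert A.linearIndependent using 1
    exact funext hα
  have hint : (terngEDS ha hn hn' A).frameEquations y k (PfaffianSystem.localFrame y e) = 0 := by
    rw [hfr]; exact h2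
  have hreg : ∀ (p : ℕ) (hp : p ≤ k),
      (terngEDS ha hn hn' A).IsKahlerRegular y (fun j => e (Fin.castLE hp j)) := by
    intro p hp
    cases p with
    | zero => exact isKahlerRegular_zero ha hn hn' A y _
    | succ p =>
      refine isKahlerRegular_succ ha hn hn' A
        (SymmetricDecomposition.finrank_b_eq ha (hA (Fin.castLE hp 0))) y
        (hli.comp _ (Fin.castLE_injective hp))
        (PfaffianSystem.frameEquations_comp_eq_zero _ (Fin.castLE hp) hint) ?_
      have h3 : localAlpha ha hn hn' y (extChartAt (𝓘(ℝ, E).prod 𝓘(ℝ, D.m a)) y y)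
          (mvfderiv (𝓘(ℝ, E).prod 𝓘(ℝ, D.m a)) (extChartAt (𝓘(ℝ, E).prod 𝓘(ℝ, D.m a)) y) y
            (e (Fin.castLE hp 0))) = A (Fin.castLE hp 0) := by
        rw [localAlpha_chart, hα]
      have h4 := (LinearMap.injective_iff_surjective_of_finrank_eq_finrank
        (SymmetricDecomposition.finrank_b_eq ha (hA (Fin.castLE hp 0))).symm).1
        (SymmetricDecomposition.adMB_injective_of_isRegular ha (hA (Fin.castLE hp 0)))
      rw [← h3] at h4
      exact h4
  have hie := PfaffianSystem.isIntegralElement_span _ hli hint (by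
    have h5 : (terngEDS ha hn hn' A).indep y e = A.det A := congrArg A.det (funext hα)
    rw [h5, Basis.det_self]
    exact one_ne_zero)
  exact ⟨_, hie, e, rfl, hie, fun p hp => hreg p hp.le, (hreg k le_rfl).toIsKahlerOrdinary⟩

/-- The 𝔞-component of the given vector may be singular. Adding t·d, where d is annihilated by η and
has a regular 𝔞-component, gives for generic small t a vector whose `ad` is onto. It still spans an
integral element, dη being alternating, so regularity carries its polar dimension back to t = 0. -/
theorem finrank_polarSpace_one (hA : ∀ i, D.IsRegular (A i : LieAlg E G)) (hk : 0 < k)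
    {y : G × D.m a} {e : Fin 1 → TangentSpace (𝓘(ℝ, E).prod 𝓘(ℝ, D.m a)) y}
    (he : (terngEDS ha hn hn' A).IsKahlerRegular y e) :
    finrank ℝ ((terngEDS ha hn hn' A).polarSpace y (PfaffianSystem.localFrame y e)) =
      finrank ℝ a := by
  have hz := extChartAt_fst_mem_target (E := E) y
  have hab := SymmetricDecomposition.finrank_b_eq ha (hA ⟨0, hk⟩)
  set q₀ := PfaffianSystem.localFrame y e with hq₀
  obtain ⟨d, hd, hdα, -⟩ := exists_tangent ha hn hn' A hz (A ⟨0, hk⟩) 0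
  have h0 := (PfaffianSystem.frameEquations_eq_zero_iff _).1 he.integral
  have hs := eventually_surjective_add_smul (D.adMB ha) hab
    (localAlpha ha hn hn' y q₀.1 (q₀.2 0)) (u := A ⟨0, hk⟩)
    ((LinearMap.injective_iff_surjective_of_finrank_eq_finrank hab.symm).1
      (SymmetricDecomposition.adMB_injective_of_isRegular ha (hA ⟨0, hk⟩)))
  have hc : Continuous fun t : ℝ => ((q₀.1, fun _ => q₀.2 0 + t • d) :
      (E × D.m a) × (Fin 1 → E × D.m a)) := by fun_prop
  have hc0 : ((q₀.1, fun _ => q₀.2 0 + (0 : ℝ) • d) : (E × D.m a) × (Fin 1 → E × D.m a)) = q₀ := by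
    refine Prod.ext rfl (funext fun i => ?_)
    rw [Subsingleton.elim i 0]
    simp
  have hr0 := he.regular
  rw [← hq₀, ← hc0] at hr0
  have hr := hc.continuousAt.tendsto.eventually hr0
  rw [hc0] at hr
  obtain ⟨t, ht, hrt⟩ := (hs.and (nhdsWithin_le_nhds hr)).exists
  have hform : localForm (terngEDS ha hn hn' A).form y q₀.1 (q₀.2 0 + t • d) = 0 := by
    rw [map_add, map_smul]
    have h1 : localForm (terngEDS ha hn hn' A).form y q₀.1 (q₀.2 0) = 0 := h0.1 0
    have h2 : localForm (terngEDS ha hn hn' A).form y q₀.1 d = 0 := hd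
    rw [h1, h2, smul_zero, add_zero]
  have hfe : (terngEDS ha hn hn' A).frameEquations y 1 (q₀.1, fun _ => q₀.2 0 + t • d) = 0 :=
    (PfaffianSystem.frameEquations_eq_zero_iff _).2
      ⟨fun _ => hform, fun _ _ => localExtDeriv_self _ _ _ _⟩
  rw [← hrt hfe]
  refine finrank_polarSpace_succ ha hn hn' A hab hz ?_ hfe
  have h3 : localAlpha ha hn hn' y q₀.1 (q₀.2 0 + t • d) =
      localAlpha ha hn hn' y q₀.1 (q₀.2 0) + t • A ⟨0, hk⟩ := by
    rw [map_add, map_smul]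
    exact congrArg (fun x => localAlpha ha hn hn' y q₀.1 (q₀.2 0) + t • x) hdα
  rw [← h3] at ht
  exact ht

theorem polarCodim_zero (hk : 0 < k) (y : G × D.m a)
    (e : Fin k → TangentSpace (𝓘(ℝ, E).prod 𝓘(ℝ, D.m a)) y) :
    (terngEDS ha hn hn' A).polarCodim y e 0 =
      finrank ℝ (E × D.m a) - (k + finrank ℝ (D.m a) : ℕ) := by
  have hfa : finrank ℝ a = k := by rw [finrank_eq_card_basis A, Fintype.card_fin]
  rw [PfaffianSystem.polarCodim, dif_pos hk,
    finrank_polarSpace_zero ha hn hn' A (extChartAt_fst_mem_target (E := E) y), hfa]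

/-- For 0 < p < k the polar space of E_p lies in that of E_1, of dimension k, and contains E_k. From
p = k on, the value agrees with the default in the definition. -/
theorem polarCodim_pos (hA : ∀ i, D.IsRegular (A i : LieAlg E G)) {y : G × D.m a}
    {e : Fin k → TangentSpace (𝓘(ℝ, E).prod 𝓘(ℝ, D.m a)) y}
    (he : (terngEDS ha hn hn' A).IsOrdinaryFlag y e) {p : ℕ} (hp : 0 < p) :
    (terngEDS ha hn hn' A).polarCodim y e p = finrank ℝ (E × D.m a) - k := by
  have hfa : finrank ℝ a = k := by rw [finrank_eq_card_basis A, Fintype.card_fin]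
  rw [PfaffianSystem.polarCodim]
  split_ifs with hpk
  · have h1 := finrank_polarSpace_one ha hn hn' A hA (hp.trans hpk)
      (he.regular 1 ((Nat.succ_le_of_lt hp).trans_lt hpk))
    have h2 := PfaffianSystem.le_finrank_polarSpace _ he.ordinary (Fin.castLE hpk.le)
    have h3 : (terngEDS ha hn hn' A).polarSpace y
        (PfaffianSystem.localFrame y fun j => e (Fin.castLE hpk.le j)) ≤
        (terngEDS ha hn hn' A).polarSpace y (PfaffianSystem.localFrame y fun j =>
          e (Fin.castLE ((Nat.succ_le_of_lt hp).trans_lt hpk).le j)) := by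
      intro v hv
      rw [PfaffianSystem.mem_polarSpace] at hv ⊢
      refine ⟨hv.1, fun i => ?_⟩
      exact hv.2 (Fin.castLE (Nat.succ_le_of_lt hp) i)
    have h4 := Submodule.finrank_mono h3
    rw [h1, hfa] at h4
    rw [le_antisymm h4 h2]
  · rfl

theorem generalSolutionDependsOn_terngEDS (hA : ∀ i, D.IsRegular (A i : LieAlg E G)) :
    (terngEDS ha hn hn' A).GeneralSolutionDependsOn (finrank ℝ (D.m a)) 1 := by
  refine ⟨inInvolution_terngEDS ha hn hn' A hA, fun y e he => ⟨?_, fun j hj => ?_⟩⟩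
  · rw [PfaffianSystem.cartanCharacter]
    split_ifs with hk
    · rw [polarCodim_pos ha hn hn' A hA he Nat.one_pos, polarCodim_zero ha hn hn' A hk]
      push_cast
      ring
    -- Case k = 0: the character is zero by convention, and the rank is zero, so 𝔪 is trivial.
    · have hfa : finrank ℝ a = 0 := by
        rw [finrank_eq_card_basis A, Fintype.card_fin]; omega
      rw [ha.finrank_eq] at hfa
      rw [SymmetricDecomposition.m_eq_bot_of_rank_eq_zero hfa]
      simp
  · obtain ⟨j, rfl⟩ : ∃ i, j = i + 2 := ⟨j - 2, by omega⟩
    rw [PfaffianSystem.cartanCharacter]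
    split_ifs with hk
    · rw [polarCodim_pos ha hn hn' A hA he (by omega), polarCodim_pos ha hn hn' A hA he (by omega),
        sub_self]
    · rfl

end Flags

/-! ### Primitives of closed 1-forms -/

/-- On a simply connected, locally path-connected space, a family of functions on an open cover
whose differences are locally constant can be corrected by locally constant functions to a global
function. -/
theorem exists_global_of_locally_constant_differences {M : Type*} [TopologicalSpace M]
    [SimplyConnectedSpace M] [LocallyPathConnectedSpace M] {F : Type*} [AddCommGroup F]
    (U : M → Set M) (hU : ∀ i, IsOpen (U i)) (hmem : ∀ i, i ∈ U i) (f : M → M → F)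
    (hf : ∀ i j, ∀ x ∈ U i ∩ U j, ∀ᶠ x' in 𝓝 x, f i x' - f j x' = f i x - f j x) :
    ∃ h : M → F, ∀ x, ∃ c : F, ∀ᶠ x' in 𝓝 x, h x' = f x x' + c := by
  -- The constants c_i for which the f_i + c_i agree form a bundle with fibre F and transition
  -- functions f_i − f_j. These are locally constant, so with the discrete topology on F the bundle
  -- is a covering space.
  let _ : TopologicalSpace F := ⊥
  have : DiscreteTopology F := ⟨rfl⟩
  let Z : FiberBundleCore M M F :=
    { baseSet := U
      isOpen_baseSet := hU
      indexAt := id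
      mem_baseSet_at := hmem
      coordChange := fun i j x v => v + (f i x - f j x)
      coordChange_self := fun i x _ v => by simp
      continuousOn_coordChange := by
        rintro i j ⟨x, v⟩ ⟨hx, -⟩
        refine ContinuousAt.continuousWithinAt ?_
        have h1 : ContinuousAt (fun p : M × F => f i p.1 - f j p.1) (x, v) := by
          refine continuousAt_const.congr (f := fun _ => f i x - f j x) ?_
          have := (continuousAt_fst (p := (x, v))).eventually (hf i j x hx)
          filter_upwards [this] with p hp
          exact hp.symm
        exact (continuous_of_discreteTopology (f := fun p : F × F => p.1 + p.2)).continuousAt.comp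
          (f := fun p : M × F => (p.2, f i p.1 - f j p.1)) (continuousAt_snd.prodMk h1)
      coordChange_comp := fun i j k x _ v => by abel }
  have hcov : IsCoveringMap (Bundle.TotalSpace.proj : Z.TotalSpace → M) :=
    FiberBundle.isCoveringMap
  obtain ⟨x₀⟩ : Nonempty M := inferInstance
  -- Simple connectedness lifts the identity, which gives a global section.
  obtain ⟨s, ⟨-, hs⟩, -⟩ := hcov.existsUnique_continuousMap_lifts (ContinuousMap.id M) x₀
    (⟨x₀, (0 : F)⟩ : Z.TotalSpace) rfl
  have hs' : ∀ x, (s x).1 = x := fun x => congrFun hs x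
  let v : M → M → F := fun i x => (Z.localTriv i (s x)).2
  let w : M → F := fun x => (s x).2
  have hv : ∀ i x, v i x = w x + (f x x - f i x) := by
    intro i x
    have h1 : v i x = w x + (f (s x).1 (s x).1 - f i (s x).1) := rfl
    rw [h1, hs']
  -- By `hv`, f_i + v_i does not depend on i, so near x the function equals f_x + v_x. There v_x is
  -- locally constant, being continuous with discrete values.
  refine ⟨fun x => f x x + v x x, fun x => ⟨v x x, ?_⟩⟩
  have hc : ContinuousAt (v x) x := by
    have h2 : s x ∈ (Z.localTriv x).source := by
      rw [FiberBundleCore.mem_localTriv_source, hs']; exact hmem x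
    have h1 : ContinuousAt (Z.localTriv x) (s x) :=
      (Z.localTriv x).toOpenPartialHomeomorph.continuousAt h2
    exact continuousAt_snd.comp (h1.comp s.continuous.continuousAt)
  have h3 : ∀ᶠ x' in 𝓝 x, v x x' = v x x :=
    hc.eventually (IsOpen.mem_nhds (isOpen_discrete {v x x}) rfl)
  filter_upwards [h3] with x' hx'
  rw [← hx', hv, hv]
  abel

section Primitive

variable {W : Type*} [NormedAddCommGroup W] [NormedSpace ℝ W]
  {M : Type*} [TopologicalSpace M] [ChartedSpace W M] [IsManifold 𝓘(ℝ, W) ∞ M]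
  {F : Type*} [NormedAddCommGroup F] [NormedSpace ℝ F]

/-- `df = α` at `x`. -/
def IsPrimitiveAt (f : M → F) (α : ∀ x : M, TangentSpace 𝓘(ℝ, W) x →L[ℝ] F) (x : M) : Prop :=
  MDifferentiableAt 𝓘(ℝ, W) 𝓘(ℝ, F) f x ∧ mvfderiv 𝓘(ℝ, W) f x = α x

variable {f f' : M → F} {α : ∀ x : M, TangentSpace 𝓘(ℝ, W) x →L[ℝ] F} {x x₀ : M} {z : W}

theorem IsPrimitiveAt.hasFDerivAt (hz : z ∈ (extChartAt 𝓘(ℝ, W) x₀).target)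
    (h : IsPrimitiveAt f α ((extChartAt 𝓘(ℝ, W) x₀).symm z)) :
    HasFDerivAt (fun z => f ((extChartAt 𝓘(ℝ, W) x₀).symm z)) (localForm α x₀ z) z := by
  have h1 := h.1.hasMFDerivAt.comp z (mdifferentiableAt_symm hz).hasMFDerivAt
  have h2 := hasMFDerivAt_iff_hasFDerivAt.1 h1
  refine h2.congr_fderiv (ContinuousLinearMap.ext fun v => ?_)
  exact congrArg (fun T : W →L[ℝ] F => T (mfderiv 𝓘(ℝ, W) 𝓘(ℝ, W) (extChartAt 𝓘(ℝ, W) x₀).symm z v))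
    h.2

theorem isPrimitiveAt_of_hasFDerivAt {f₀ : W → F} (hx : x ∈ (extChartAt 𝓘(ℝ, W) x₀).source)
    (h : HasFDerivAt f₀ (localForm α x₀ (extChartAt 𝓘(ℝ, W) x₀ x)) (extChartAt 𝓘(ℝ, W) x₀ x)) :
    IsPrimitiveAt (fun x => f₀ (extChartAt 𝓘(ℝ, W) x₀ x)) α x := by
  have h1 := (hasMFDerivAt_iff_hasFDerivAt.2 h).comp x (mdifferentiableAt_chart hx).hasMFDerivAt
  refine ⟨h1.mdifferentiableAt, ContinuousLinearMap.ext fun v => ?_⟩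
  have h2 : mfderiv 𝓘(ℝ, W) 𝓘(ℝ, F) (fun x => f₀ (extChartAt 𝓘(ℝ, W) x₀ x)) x v =
      localForm α x₀ (extChartAt 𝓘(ℝ, W) x₀ x) (mvfderiv 𝓘(ℝ, W) (extChartAt 𝓘(ℝ, W) x₀) x v) :=
    congrArg (fun T : W →L[ℝ] F => T v) h1.mfderiv
  exact h2.trans (localForm_chart α hx v)

theorem IsPrimitiveAt.congr_add_const {c : F} (h : IsPrimitiveAt f α x)
    (hf : ∀ᶠ x' in 𝓝 x, f' x' = f x' + c) : IsPrimitiveAt f' α x := by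
  have h1 : HasMFDerivAt 𝓘(ℝ, F) 𝓘(ℝ, F) (fun y : F => y + c) (f x) (ContinuousLinearMap.id ℝ F) :=
    hasMFDerivAt_iff_hasFDerivAt.2 ((hasFDerivAt_id _).add_const c)
  have h2 := (h1.comp x h.1.hasMFDerivAt).congr_of_eventuallyEq hf
  refine ⟨h2.mdifferentiableAt, ?_⟩
  rw [← h.2]
  exact ContinuousLinearMap.ext fun v => congrArg (fun T : W →L[ℝ] F => T v) h2.mfderiv

/-- In a chart the derivative of the primitive is the smooth local form, so differentiability
improves to smoothness. -/
theorem contMDiff_of_isPrimitiveAt (h : ∀ x, IsPrimitiveAt f α x)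
    (hα : ∀ x₀ z, z ∈ (extChartAt 𝓘(ℝ, W) x₀).target → ContDiffAt ℝ ∞ (localForm α x₀) z) :
    ContMDiff 𝓘(ℝ, W) 𝓘(ℝ, F) ∞ f := by
  intro x₀
  have ho := isOpen_extChartAt_target (I := 𝓘(ℝ, W)) x₀
  have h1 : ContDiffOn ℝ ∞ (fun z => f ((extChartAt 𝓘(ℝ, W) x₀).symm z))
      (extChartAt 𝓘(ℝ, W) x₀).target := by
    rw [contDiffOn_infty_iff_fderiv_of_isOpen ho]
    refine ⟨fun z hz => ((h _).hasFDerivAt hz).differentiableAt.differentiableWithinAt, ?_⟩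
    have h2 : ContDiffOn ℝ ∞ (localForm α x₀) (extChartAt 𝓘(ℝ, W) x₀).target :=
      fun z hz => (hα x₀ z hz).contDiffWithinAt
    exact h2.congr fun z hz => ((h _).hasFDerivAt hz).fderiv
  have h3 : ContMDiffAt 𝓘(ℝ, W) 𝓘(ℝ, F) ∞ (fun x => f ((extChartAt 𝓘(ℝ, W) x₀).symm
      (extChartAt 𝓘(ℝ, W) x₀ x))) x₀ := by
    have h4 : ContMDiffAt 𝓘(ℝ, W) 𝓘(ℝ, F) ∞ (fun z => f ((extChartAt 𝓘(ℝ, W) x₀).symm z))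
        (extChartAt 𝓘(ℝ, W) x₀ x₀) :=
      (h1.contDiffAt (ho.mem_nhds (mem_extChartAt_target x₀))).contMDiffAt
    exact h4.comp x₀ contMDiffAt_extChartAt
  refine h3.congr_of_eventuallyEq ?_
  filter_upwards [extChartAt_source_mem_nhds (I := 𝓘(ℝ, W)) x₀] with x hx
  rw [(extChartAt 𝓘(ℝ, W) x₀).left_inv hx]

theorem eventually_sub_eq_of_isPrimitiveAt (h : ∀ᶠ x' in 𝓝 x, IsPrimitiveAt f α x')
    (h' : ∀ᶠ x' in 𝓝 x, IsPrimitiveAt f' α x') :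
    ∀ᶠ x' in 𝓝 x, f x' - f' x' = f x - f' x := by
  set z := extChartAt 𝓘(ℝ, W) x x with hzdef
  have hz : z ∈ (extChartAt 𝓘(ℝ, W) x).target := mem_extChartAt_target x
  have hxx : (extChartAt 𝓘(ℝ, W) x).symm z = x := extChartAt_to_inv x
  have hc : ContinuousAt (extChartAt 𝓘(ℝ, W) x).symm z := continuousAt_extChartAt_symm x
  have h1 : ∀ᶠ z' in 𝓝 z, z' ∈ (extChartAt 𝓘(ℝ, W) x).target ∧
      IsPrimitiveAt f α ((extChartAt 𝓘(ℝ, W) x).symm z') ∧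
      IsPrimitiveAt f' α ((extChartAt 𝓘(ℝ, W) x).symm z') := by
    rw [← hxx] at h h'
    exact Filter.Eventually.and (target_mem_nhds hz) ((hc.eventually h).and (hc.eventually h'))
  obtain ⟨r, hr, hball⟩ := Metric.eventually_nhds_iff_ball.1 h1
  have hd : ∀ z' ∈ Metric.ball z r, HasFDerivAt (fun z => f ((extChartAt 𝓘(ℝ, W) x).symm z) -
      f' ((extChartAt 𝓘(ℝ, W) x).symm z)) (0 : W →L[ℝ] F) z' := by
    intro z' hz'
    obtain ⟨t1, t2, t3⟩ := hball z' hz'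
    exact ((t2.hasFDerivAt t1).sub (t3.hasFDerivAt t1)).congr_fderiv (sub_self _)
  obtain ⟨c, hc'⟩ := Metric.isOpen_ball.exists_is_const_of_fderiv_eq_zero
    (convex_ball z r).isPreconnected
    (fun z' hz' => (hd z' hz').differentiableAt.differentiableWithinAt)
    (fun z' hz' => (hd z' hz').fderiv)
  have h2 : ∀ᶠ x' in 𝓝 x, extChartAt 𝓘(ℝ, W) x x' ∈ Metric.ball z r :=
    (continuousAt_extChartAt x).eventually (Metric.ball_mem_nhds z hr)
  filter_upwards [h2, extChartAt_source_mem_nhds (I := 𝓘(ℝ, W)) x] with x' hx' hs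
  have h3 := hc' _ hx'
  have h4 := hc' z (Metric.mem_ball_self hr)
  rw [(extChartAt 𝓘(ℝ, W) x).left_inv hs] at h3
  rw [hxx] at h4
  rw [h3, h4]

/-- The Poincaré lemma on a ball contained in the target of the chart. -/
theorem exists_local_primitive (x₀ : M)
    (hα : ∀ z ∈ (extChartAt 𝓘(ℝ, W) x₀).target, DifferentiableAt ℝ (localForm α x₀) z)
    (hd : ∀ z ∈ (extChartAt 𝓘(ℝ, W) x₀).target, ∀ v w, localExtDeriv α x₀ z v w = 0)
    [CompleteSpace F] :
    ∃ U : Set M, IsOpen U ∧ x₀ ∈ U ∧ ∃ f : M → F, ∀ x ∈ U, IsPrimitiveAt f α x := by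
  obtain ⟨r, hr, hball⟩ := Metric.mem_nhds_iff.1
    (target_mem_nhds (mem_extChartAt_target (I := 𝓘(ℝ, W)) x₀))
  obtain ⟨f₀, hf₀⟩ := (convex_ball (extChartAt 𝓘(ℝ, W) x₀ x₀)
    r).exists_forall_hasFDerivAt_of_fderiv_symmetric
    Metric.isOpen_ball (fun z hz => (hα z (hball hz)).differentiableWithinAt)
    (fun z hz v w => sub_eq_zero.1 (hd z (hball hz) v w))
  refine ⟨(extChartAt 𝓘(ℝ, W) x₀).source ∩ extChartAt 𝓘(ℝ, W) x₀ ⁻¹'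
    Metric.ball (extChartAt 𝓘(ℝ, W) x₀ x₀) r, ?_, ?_,
    fun x => f₀ (extChartAt 𝓘(ℝ, W) x₀ x), fun x hx => ?_⟩
  · exact (continuousOn_extChartAt x₀).isOpen_inter_preimage (isOpen_extChartAt_source x₀)
      Metric.isOpen_ball
  · exact ⟨mem_extChartAt_source x₀, Metric.mem_ball_self hr⟩
  · exact isPrimitiveAt_of_hasFDerivAt hx.1 (hf₀ _ hx.2)

theorem exists_global_primitive [SimplyConnectedSpace M] [CompleteSpace F]
    (hα : ∀ x₀, ∀ z ∈ (extChartAt 𝓘(ℝ, W) x₀).target, DifferentiableAt ℝ (localForm α x₀) z)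
    (hd : ∀ x₀, ∀ z ∈ (extChartAt 𝓘(ℝ, W) x₀).target, ∀ v w, localExtDeriv α x₀ z v w = 0) :
    ∃ f : M → F, ∀ x, IsPrimitiveAt f α x := by
  have : LocallyPathConnectedSpace M := ChartedSpace.locallyPathConnectedSpace W M
  choose U hU hmem f hf using fun x₀ => exists_local_primitive x₀ (hα x₀) (hd x₀)
  have hev : ∀ i, ∀ x ∈ U i, ∀ᶠ x' in 𝓝 x, IsPrimitiveAt (f i) α x' := fun i x hx => by
    filter_upwards [(hU i).mem_nhds hx] with x' hx' using hf i x' hx'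
  obtain ⟨h, hh⟩ := exists_global_of_locally_constant_differences U hU hmem f fun i j x hx =>
    eventually_sub_eq_of_isPrimitiveAt (hev i x hx.1) (hev j x hx.2)
  refine ⟨h, fun x => ?_⟩
  obtain ⟨c, hc⟩ := hh x
  exact (hf x x (hmem x)).congr_add_const hc

/-- The inverse function theorem on a manifold. -/
theorem isLocalDiffeomorph_of_bijective [FiniteDimensional ℝ W] [FiniteDimensional ℝ F]
    (hf : ContMDiff 𝓘(ℝ, W) 𝓘(ℝ, F) ∞ f)
    (hb : ∀ x, Function.Bijective (mvfderiv 𝓘(ℝ, W) f x)) :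
    IsLocalDiffeomorph 𝓘(ℝ, W) 𝓘(ℝ, F) ∞ f := by
  have := FiniteDimensional.complete ℝ W
  intro x₀
  let f₀ : W → F := fun z => f ((extChartAt 𝓘(ℝ, W) x₀).symm z)
  have hp : ∀ x, IsPrimitiveAt f (fun x => mvfderiv 𝓘(ℝ, W) f x) x := fun x =>
    ⟨(hf x).mdifferentiableAt (by simp), rfl⟩
  have hd : ∀ z ∈ (extChartAt 𝓘(ℝ, W) x₀).target, ∃ T : W ≃L[ℝ] F,
      HasFDerivAt f₀ (T : W →L[ℝ] F) z := by
    intro z hz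
    have h1 := (hp ((extChartAt 𝓘(ℝ, W) x₀).symm z)).hasFDerivAt hz
    have h2 : Function.Injective (localForm (fun x => mvfderiv 𝓘(ℝ, W) f x) x₀ z) := by
      intro v w h
      have h3 := (hb _).1 h
      have h4 := congrArg (mvfderiv 𝓘(ℝ, W) (extChartAt 𝓘(ℝ, W) x₀)
        ((extChartAt 𝓘(ℝ, W) x₀).symm z)) h3
      exact (mfderiv_chart_symm_apply hz v).symm.trans (h4.trans (mfderiv_chart_symm_apply hz w))
    have h3 : finrank ℝ W = finrank ℝ F :=
      (LinearEquiv.ofBijective (mvfderiv 𝓘(ℝ, W) f x₀).toLinearMap (hb x₀)).finrank_eq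
    refine ⟨(LinearEquiv.ofInjectiveOfFinrankEq (localForm (fun x => mvfderiv 𝓘(ℝ, W) f x)
      x₀ z).toLinearMap h2 h3).toContinuousLinearEquiv, ?_⟩
    exact h1.congr_fderiv (ContinuousLinearMap.ext fun v => rfl)
  have hsm : ∀ z ∈ (extChartAt 𝓘(ℝ, W) x₀).target, ContDiffAt ℝ ∞ f₀ z := by
    intro z hz
    have := contDiffAt_chartMap (I := 𝓘(ℝ, F)) (y₀ := f x₀) hz (hf _) (by simp [chartAt_self_eq])
    have he : chartMap 𝓘(ℝ, F) 𝓘(ℝ, W) f x₀ (f x₀) = f₀ := by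
      funext z; simp [chartMap, chartAt_self_eq, f₀]
    rwa [he] at this
  have hz₀ := mem_extChartAt_target (I := 𝓘(ℝ, W)) x₀
  obtain ⟨T₀, hT₀⟩ := hd _ hz₀
  let h₀ := (hsm _ hz₀).toOpenPartialHomeomorph f₀ hT₀ (by simp)
  have hcoe : ∀ z, h₀ z = f₀ z := fun z => rfl
  -- The chart followed by the local inverse-function homeomorphism of f read in that chart.
  let Φ : OpenPartialHomeomorph M F := (chartAt W x₀).trans h₀
  have hΦ : ∀ x ∈ Φ.source, Φ x = f x := by
    intro x hx
    have hx' : x ∈ (chartAt W x₀).source := hx.1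
    change f ((chartAt W x₀).symm (chartAt W x₀ x)) = f x
    rw [(chartAt W x₀).left_inv hx']
  refine ⟨⟨Φ.toPartialEquiv, Φ.open_source, Φ.open_target, ?_, ?_⟩, ?_, ?_⟩
  · exact hf.contMDiffOn.congr hΦ
  · have h1 : ContMDiffOn 𝓘(ℝ, F) 𝓘(ℝ, W) ∞ h₀.symm Φ.target := by
      intro y hy
      have hy1 : y ∈ h₀.target := hy.1
      have hy2 : h₀.symm y ∈ (extChartAt 𝓘(ℝ, W) x₀).target := by
        simpa using hy.2
      -- Smoothness of the inverse is needed on the whole target, hence invertibility of the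
      -- derivative at every point and not only at the centre.
      obtain ⟨T, hT⟩ := hd _ hy2
      exact (h₀.contDiffAt_symm hy1 hT (hsm _ hy2)).contMDiffAt.contMDiffWithinAt
    exact (contMDiffOn_chart_symm (I := 𝓘(ℝ, W)) (x := x₀)).comp h1 fun y hy => hy.2
  · refine ⟨mem_chart_source W x₀, ?_⟩
    exact (hsm _ hz₀).mem_toOpenPartialHomeomorph_source hT₀ (by simp)
  · exact fun x hx => (hΦ x hx).symm

end Primitive

/-! ### Integral manifolds and framed solutions -/

section Zero

variable {W : Type*} [NormedAddCommGroup W] [NormedSpace ℝ W] {H : Type*} [TopologicalSpace H]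
  {I : ModelWithCorners ℝ W H} {N : Type*} [TopologicalSpace N] [ChartedSpace H N]
  {W' : Type*} [NormedAddCommGroup W'] [NormedSpace ℝ W'] {H' : Type*} [TopologicalSpace H']
  {J : ModelWithCorners ℝ W' H'} {M : Type*} [TopologicalSpace M] [ChartedSpace H' M]
  {F : Type*} [NormedAddCommGroup F] [NormedSpace ℝ F]

theorem extDerivOneForm_zero (y : N) (v w : TangentSpace I y) :
    extDerivOneForm (fun y : N => (0 : TangentSpace I y →L[ℝ] F)) y v w = 0 := by
  have h : localForm (fun y : N => (0 : TangentSpace I y →L[ℝ] F)) y = fun _ => 0 := rfl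
  unfold extDerivOneForm localExtDeriv
  rw [h]
  simp

variable [I.Boundaryless] [IsManifold I ∞ N] [J.Boundaryless] [IsManifold J ∞ M]

theorem contDiffAt_localForm_pullback {Ψ : M → N} {x₀ : M} {y₀ : N} {z : W'}
    (hz : z ∈ (extChartAt J x₀).target)
    (hΨ : ContMDiffAt J I ∞ Ψ ((extChartAt J x₀).symm z))
    (hy : Ψ ((extChartAt J x₀).symm z) ∈ (extChartAt I y₀).source)
    {η : ∀ y : N, TangentSpace I y →L[ℝ] F}
    (hη : ContDiffAt ℝ ∞ (localForm η y₀) (chartMap I J Ψ x₀ y₀ z)) :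
    ContDiffAt ℝ ∞ (localForm (pullbackForm (J := J) Ψ η) x₀) z := by
  refine ContDiffAt.congr_of_eventuallyEq ?_
    (localForm_pullback_eventuallyEq hz (hΨ.of_le ENat.LEInfty.out) hy η)
  have h1 := contDiffAt_chartMap hz hΨ hy
  exact (hη.comp z h1).clm_comp (h1.fderiv_right (m := ∞) (by simp))

end Zero

section Framed

variable {E : Type*} [NormedAddCommGroup E] [NormedSpace ℝ E] [FiniteDimensional ℝ E]
  {G : Type*} [TopologicalSpace G] [ChartedSpace E G] [Group G] [LieGroup 𝓘(ℝ, E) ∞ G]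
  {D : SymmetricDecomposition (LieAlg E G)} {a n : Submodule ℝ (LieAlg E G)}
  (ha : D.IsCartanSubspace a) (hn : D.b a ⊔ n = D.g₀) (hn' : Disjoint (D.b a) n)
  {EM : Type*} [NormedAddCommGroup EM] [NormedSpace ℝ EM]
  {M : Type*} [TopologicalSpace M] [ChartedSpace EM M]

/-- The `𝔞`-component of the pull-back `g⁻¹ dg` of the Maurer–Cartan form. -/
def alphaForm (g : M → G) (x : M) : TangentSpace 𝓘(ℝ, EM) x →L[ℝ] a :=
  (LinearMap.toContinuousLinearMap (a.projectionOnto _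
    (SymmetricDecomposition.isSplitting ha hn hn').left)).comp
      (pullbackForm (J := 𝓘(ℝ, EM)) g (maurerCartan (E := E) (G := G)) x)

theorem alphaForm_apply (g : M → G) (x : M) (v : TangentSpace 𝓘(ℝ, EM) x) :
    alphaForm ha hn hn' g x v = a.projectionOnto _
      (SymmetricDecomposition.isSplitting ha hn hn').left
      (pullbackForm (J := 𝓘(ℝ, EM)) g (maurerCartan (E := E) (G := G)) x v) := rfl

/-- `g⁻¹ dg = θ_𝔞 + [θ_𝔞, V]` at `x`, and `θ_𝔞` is an isomorphism. -/
def IsTangentAt (g : M → G) (V : M → D.m a) (x : M) : Prop :=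
  Function.Bijective (alphaForm (EM := EM) ha hn hn' g x) ∧
    pullbackForm (J := 𝓘(ℝ, EM)) g (maurerCartan (E := E) (G := G)) x =
      (addLie a (V x : LieAlg E G)).comp (alphaForm ha hn hn' g x)

theorem addLie_apply (X : LieAlg E G) (B : a) :
    addLie a X B = (B : LieAlg E G) + ⁅(B : LieAlg E G), X⁆ := rfl

theorem projectionOnto_addLie (V : D.m a) (B : a) : a.projectionOnto _
    (SymmetricDecomposition.isSplitting ha hn hn').left (addLie a (V : LieAlg E G) B) = B := by
  have h := (SymmetricDecomposition.isSplitting ha hn hn').left_apply B (D.adMB ha B V) 0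
  rw [Submodule.coe_zero, add_zero] at h
  exact h

theorem maurerCartanProd_mfderiv {g : M → G} {V : M → D.m a} {x : M}
    (hg : MDifferentiableAt 𝓘(ℝ, EM) 𝓘(ℝ, E) g x)
    (hV : MDifferentiableAt 𝓘(ℝ, EM) 𝓘(ℝ, D.m a) V x) (v : TangentSpace 𝓘(ℝ, EM) x) :
    maurerCartanProd E G (D.m a) (g x, V x)
      (mfderiv 𝓘(ℝ, EM) (𝓘(ℝ, E).prod 𝓘(ℝ, D.m a)) (fun x => (g x, V x)) x v) =
    pullbackForm (J := 𝓘(ℝ, EM)) g (maurerCartan (E := E) (G := G)) x v := by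
  have h := (hasMFDerivAt_fst (I := 𝓘(ℝ, E)) (I' := 𝓘(ℝ, D.m a)) (g x, V x)).comp x
    (hg.prodMk hV).hasMFDerivAt
  have h1 : mfderiv 𝓘(ℝ, EM) 𝓘(ℝ, E) g x v = mfderiv (𝓘(ℝ, E).prod 𝓘(ℝ, D.m a)) 𝓘(ℝ, E)
      Prod.fst (g x, V x)
      (mfderiv 𝓘(ℝ, EM) (𝓘(ℝ, E).prod 𝓘(ℝ, D.m a)) (fun x => (g x, V x)) x v) := by
    rw [mfderiv_fst]
    exact congrArg (fun T : EM →L[ℝ] E => T v) h.mfderiv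
  exact congrArg (maurerCartan (g x)) h1.symm

variable {k : ℕ} (A : Basis (Fin k) ℝ a)

theorem terngEDS_form_mfderiv {g : M → G} {V : M → D.m a} {x : M}
    (hg : MDifferentiableAt 𝓘(ℝ, EM) 𝓘(ℝ, E) g x)
    (hV : MDifferentiableAt 𝓘(ℝ, EM) 𝓘(ℝ, D.m a) V x) (v : TangentSpace 𝓘(ℝ, EM) x) :
    (terngEDS ha hn hn' A).form (g x, V x)
      (mfderiv 𝓘(ℝ, EM) (𝓘(ℝ, E).prod 𝓘(ℝ, D.m a)) (fun x => (g x, V x)) x v) = 0 ↔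
    pullbackForm (J := 𝓘(ℝ, EM)) g (maurerCartan (E := E) (G := G)) x v =
      addLie a (V x : LieAlg E G) (alphaForm ha hn hn' g x v) := by
  have h := tableauSystem_form_apply (SymmetricDecomposition.isSplitting ha hn hn')
    (SymmetricDecomposition.cartanTableau ha) A (g x, V x)
    (mfderiv 𝓘(ℝ, EM) (𝓘(ℝ, E).prod 𝓘(ℝ, D.m a)) (fun x => (g x, V x)) x v)
  rw [maurerCartanProd_mfderiv hg hV] at h
  have h' : (terngEDS ha hn hn' A).form (g x, V x)
      (mfderiv 𝓘(ℝ, EM) (𝓘(ℝ, E).prod 𝓘(ℝ, D.m a)) (fun x => (g x, V x)) x v) = _ := h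
  rw [h']
  exact tableau_eq_zero_iff ha hn hn' (V x) _

theorem terngEDS_indep_mfderiv {g : M → G} {V : M → D.m a} {x : M}
    (hg : MDifferentiableAt 𝓘(ℝ, EM) 𝓘(ℝ, E) g x)
    (hV : MDifferentiableAt 𝓘(ℝ, EM) 𝓘(ℝ, D.m a) V x) (v : Fin k → TangentSpace 𝓘(ℝ, EM) x) :
    (terngEDS ha hn hn' A).indep (g x, V x) (fun i =>
      mfderiv 𝓘(ℝ, EM) (𝓘(ℝ, E).prod 𝓘(ℝ, D.m a)) (fun x => (g x, V x)) x (v i)) =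
    A.det fun i => alphaForm ha hn hn' g x (v i) :=
  congrArg A.det (funext fun i => congrArg (a.projectionOnto _
    (SymmetricDecomposition.isSplitting ha hn hn').left) (maurerCartanProd_mfderiv hg hV (v i)))

variable [FiniteDimensional ℝ EM] [IsManifold 𝓘(ℝ, EM) ∞ M]

/-- The independence condition makes α onto 𝔞, hence bijective as dim M = dim 𝔞. Conversely,
bijectivity of α gives the immersion and independence conditions. -/
theorem isIntegralManifold_iff (hk : finrank ℝ EM = k) {g : M → G} {V : M → D.m a} :
    (terngEDS ha hn hn' A).IsIntegralManifold (EM := EM) (fun x => (g x, V x)) ↔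
      ContMDiff 𝓘(ℝ, EM) 𝓘(ℝ, E) ∞ g ∧ ContMDiff 𝓘(ℝ, EM) 𝓘(ℝ, D.m a) ∞ V ∧
        ∀ x, IsTangentAt (EM := EM) ha hn hn' g V x := by
  have hfa : finrank ℝ a = k := by rw [finrank_eq_card_basis A, Fintype.card_fin]
  constructor
  · intro h
    have hg : ContMDiff 𝓘(ℝ, EM) 𝓘(ℝ, E) ∞ g := ((contMDiff_prod_iff _).1 h.smooth).1
    have hV : ContMDiff 𝓘(ℝ, EM) 𝓘(ℝ, D.m a) ∞ V := ((contMDiff_prod_iff _).1 h.smooth).2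
    refine ⟨hg, hV, fun x => ?_⟩
    have hgx := (hg x).mdifferentiableAt (by simp)
    have hVx := (hV x).mdifferentiableAt (by simp)
    refine ⟨?_, ContinuousLinearMap.ext fun v =>
      (terngEDS_form_mfderiv ha hn hn' A hgx hVx v).1 ((h.integral x).form_eq_zero _ ⟨v, rfl⟩)⟩
    obtain ⟨e, he, hdet⟩ := (h.integral x).indep_ne_zero
    choose v hv using he
    have he' : e = fun i => mfderiv 𝓘(ℝ, EM) (𝓘(ℝ, E).prod 𝓘(ℝ, D.m a))
      (fun x => (g x, V x)) x (v i) := funext fun i => (hv i).symm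
    rw [he', terngEDS_indep_mfderiv ha hn hn' A hgx hVx] at hdet
    have hspan := (A.is_basis_iff_det.2 (isUnit_iff_ne_zero.2 hdet)).2
    have hsurj : Function.Surjective (alphaForm (EM := EM) ha hn hn' g x).toLinearMap := by
      rw [← LinearMap.range_eq_top, eq_top_iff, ← hspan, Submodule.span_le]
      rintro _ ⟨i, rfl⟩
      exact ⟨v i, rfl⟩
    exact ⟨(LinearMap.injective_iff_surjective_of_finrank_eq_finrank
      (f := (alphaForm (EM := EM) ha hn hn' g x).toLinearMap) (hk.trans hfa.symm)).2 hsurj, hsurj⟩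
  · rintro ⟨hg, hV, h⟩
    have hg' := fun x => (hg x).mdifferentiableAt (n := ∞) (by simp)
    have hV' := fun x => (hV x).mdifferentiableAt (n := ∞) (by simp)
    have hform : ∀ x v, (terngEDS ha hn hn' A).form (g x, V x)
        (mfderiv 𝓘(ℝ, EM) (𝓘(ℝ, E).prod 𝓘(ℝ, D.m a)) (fun x => (g x, V x)) x v) = 0 := fun x v =>
      (terngEDS_form_mfderiv ha hn hn' A (hg' x) (hV' x) v).2
        (congrArg (fun T : EM →L[ℝ] LieAlg E G => T v) (h x).2)
    have himm : ∀ x, Function.Injective (mfderiv 𝓘(ℝ, EM) (𝓘(ℝ, E).prod 𝓘(ℝ, D.m a))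
        (fun x => (g x, V x)) x) := by
      intro x v w hvw
      refine (h x).1.1 ?_
      rw [alphaForm_apply, alphaForm_apply, ← maurerCartanProd_mfderiv (hg' x) (hV' x),
        ← maurerCartanProd_mfderiv (hg' x) (hV' x), hvw]
    refine ⟨hg.prodMk hV, himm, fun x => ⟨?_, ?_, ?_, ?_⟩⟩
    · exact (LinearMap.finrank_range_of_inj (f := (mfderiv 𝓘(ℝ, EM) (𝓘(ℝ, E).prod 𝓘(ℝ, D.m a))
        (fun x => (g x, V x)) x).toLinearMap) (himm x)).trans hk
    · rintro _ ⟨v, rfl⟩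
      exact hform x v
    · rintro _ ⟨v, rfl⟩ _ ⟨w, rfl⟩
      have h1 := extDerivOneForm_pullback (J := 𝓘(ℝ, EM)) (x := x)
        (((hg.prodMk hV) x).of_le ENat.LEInfty.out) (mem_extChartAt_source (g x, V x))
        (differentiableAt_localForm_tableauSystem (SymmetricDecomposition.isSplitting ha hn hn')
          (SymmetricDecomposition.cartanTableau ha) A
          (extChartAt_fst_mem_target (E := E) (g x, V x))) v w
      refine h1.symm.trans ?_
      -- The pull-back of η vanishes identically on M, so the condition on dη is automatic.
      have h2 : pullbackForm (J := 𝓘(ℝ, EM)) (fun x => (g x, V x))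
          (tableauSystem (SymmetricDecomposition.isSplitting ha hn hn')
            (SymmetricDecomposition.cartanTableau ha) A).form = fun _ => 0 :=
        funext fun x => ContinuousLinearMap.ext fun v => hform x v
      rw [h2]
      exact extDerivOneForm_zero x v w
    · choose v hv using fun i => (h x).1.2 (A i)
      refine ⟨_, fun i => ⟨v i, rfl⟩, ?_⟩
      have h1 := terngEDS_indep_mfderiv ha hn hn' A (hg' x) (hV' x) v
      have h2 : (fun i => alphaForm (EM := EM) ha hn hn' g x (v i)) = A := funext hv
      rw [h2, Basis.det_self] at h1
      intro h3
      exact one_ne_zero (h1.symm.trans h3)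

end Framed

/-! ### Inclusions of open submanifolds -/

section Opens

variable {W : Type*} [NormedAddCommGroup W] [NormedSpace ℝ W]
  {M : Type*} [TopologicalSpace M] [ChartedSpace W M] [IsManifold 𝓘(ℝ, W) ∞ M]

/-- The chart of U at u is the chart of M restricted to U; both charts have bijective derivatives,
so the inclusion has one too. -/
theorem bijective_mfderiv_coe (U : TopologicalSpace.Opens M) (u : U) :
    Function.Bijective (mfderiv 𝓘(ℝ, W) 𝓘(ℝ, W) (Subtype.val : U → M) u) := by
  have h1 : MDifferentiableAt 𝓘(ℝ, W) 𝓘(ℝ, W) (Subtype.val : U → M) u :=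
    (contMDiff_subtype_val (n := ∞) u).mdifferentiableAt (by simp)
  have h2 := (mdifferentiableAt_chart (I := 𝓘(ℝ, W))
    (mem_extChartAt_source (u : M))).hasMFDerivAt.comp u h1.hasMFDerivAt
  have h3 : extChartAt 𝓘(ℝ, W) (u : M) ∘ (Subtype.val : U → M) = extChartAt 𝓘(ℝ, W) u := by
    funext x
    simp only [Function.comp, mfld_simps]
    rfl
  rw [h3] at h2
  have h4 : ∀ v, mvfderiv 𝓘(ℝ, W) (extChartAt 𝓘(ℝ, W) u) u v =
      mvfderiv 𝓘(ℝ, W) (extChartAt 𝓘(ℝ, W) (u : M)) (u : M)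
        (mfderiv 𝓘(ℝ, W) 𝓘(ℝ, W) (Subtype.val : U → M) u v) := fun v =>
    congrArg (fun T : W →L[ℝ] W => T v) h2.mfderiv
  constructor
  · intro v w h
    refine injective_mvfderiv_chart (I := 𝓘(ℝ, W)) u ?_
    rw [h4, h4, h]
  · intro w
    obtain ⟨v, hv⟩ := surjective_mvfderiv_chart (I := 𝓘(ℝ, W)) u
      (mvfderiv 𝓘(ℝ, W) (extChartAt 𝓘(ℝ, W) (u : M)) (u : M) w)
    exact ⟨v, injective_mvfderiv_chart (I := 𝓘(ℝ, W)) (u : M) ((h4 v).symm.trans hv)⟩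

end Opens

/-! ### Closedness of the 𝔞-component and the comparison with framed solutions -/

section Framed

variable {E : Type*} [NormedAddCommGroup E] [NormedSpace ℝ E] [FiniteDimensional ℝ E]
  {G : Type*} [TopologicalSpace G] [ChartedSpace E G] [Group G] [LieGroup 𝓘(ℝ, E) ∞ G]
  {D : SymmetricDecomposition (LieAlg E G)} {a n : Submodule ℝ (LieAlg E G)}
  (ha : D.IsCartanSubspace a) (hn : D.b a ⊔ n = D.g₀) (hn' : Disjoint (D.b a) n)
  {EM : Type*} [NormedAddCommGroup EM] [NormedSpace ℝ EM] [FiniteDimensional ℝ EM]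
  {M : Type*} [TopologicalSpace M] [ChartedSpace EM M] [IsManifold 𝓘(ℝ, EM) ∞ M]

theorem contDiffAt_localForm_alphaForm {g : M → G} (hg : ContMDiff 𝓘(ℝ, EM) 𝓘(ℝ, E) ∞ g) (x₀ : M)
    {z : EM} (hz : z ∈ (extChartAt 𝓘(ℝ, EM) x₀).target) :
    ContDiffAt ℝ ∞ (localForm (alphaForm (EM := EM) ha hn hn' g) x₀) z := by
  have hs := mem_extChartAt_source (I := 𝓘(ℝ, E)) (g ((extChartAt 𝓘(ℝ, EM) x₀).symm z))
  have h1 := contDiffAt_localForm_pullback (J := 𝓘(ℝ, EM)) (I := 𝓘(ℝ, E)) hz (hg _) hs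
    (contDiffAt_localForm_maurerCartan ((extChartAt 𝓘(ℝ, E) _).map_source hs))
  exact (contDiffAt_const (c := LinearMap.toContinuousLinearMap (a.projectionOnto _
    (SymmetricDecomposition.isSplitting ha hn hn').left))).clm_comp h1

/-- dα is the 𝔞-component of −[θ, θ]. For θ = α + [α, V] this bracket lies in 𝔟, so its 𝔞-component
is zero. -/
theorem localExtDeriv_alphaForm {g : M → G} (hg : ContMDiff 𝓘(ℝ, EM) 𝓘(ℝ, E) ∞ g)
    {V : M → D.m a} (h : ∀ x, IsTangentAt (EM := EM) ha hn hn' g V x) (x₀ : M)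
    {z : EM} (hz : z ∈ (extChartAt 𝓘(ℝ, EM) x₀).target) (v w : EM) :
    localExtDeriv (alphaForm (EM := EM) ha hn hn' g) x₀ z v w = 0 := by
  have hs := mem_extChartAt_source (I := 𝓘(ℝ, E)) (g ((extChartAt 𝓘(ℝ, EM) x₀).symm z))
  have ht := (extChartAt 𝓘(ℝ, E) (g ((extChartAt 𝓘(ℝ, EM) x₀).symm z))).map_source hs
  have h0 : DifferentiableAt ℝ (localForm (pullbackForm (J := 𝓘(ℝ, EM)) g
      (maurerCartan (E := E) (G := G))) x₀) z :=
    (contDiffAt_localForm_pullback (J := 𝓘(ℝ, EM)) (I := 𝓘(ℝ, E)) hz (hg _) hs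
      (contDiffAt_localForm_maurerCartan ht)).differentiableAt (by simp)
  have h1 := localExtDeriv_clm_comp (LinearMap.toContinuousLinearMap (a.projectionOnto _
    (SymmetricDecomposition.isSplitting ha hn hn').left)) h0 v w
  refine h1.trans ?_
  have h2 := localExtDeriv_pullback (J := 𝓘(ℝ, EM)) (I := 𝓘(ℝ, E)) hz
    ((hg _).of_le ENat.LEInfty.out) hs (differentiableAt_localForm_maurerCartan ht) v w
  have h3 := localExtDeriv_maurerCartan ht
    (fderiv ℝ (chartMap 𝓘(ℝ, E) 𝓘(ℝ, EM) g x₀ (g ((extChartAt 𝓘(ℝ, EM) x₀).symm z))) z v)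
    (fderiv ℝ (chartMap 𝓘(ℝ, E) 𝓘(ℝ, EM) g x₀ (g ((extChartAt 𝓘(ℝ, EM) x₀).symm z))) z w)
  have h4 : ∀ v : EM, localForm (maurerCartan (E := E) (G := G))
      (g ((extChartAt 𝓘(ℝ, EM) x₀).symm z))
      (chartMap 𝓘(ℝ, E) 𝓘(ℝ, EM) g x₀ (g ((extChartAt 𝓘(ℝ, EM) x₀).symm z)) z)
      (fderiv ℝ (chartMap 𝓘(ℝ, E) 𝓘(ℝ, EM) g x₀ (g ((extChartAt 𝓘(ℝ, EM) x₀).symm z))) z v) =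
      addLie a (V ((extChartAt 𝓘(ℝ, EM) x₀).symm z) : LieAlg E G)
        (localForm (alphaForm (EM := EM) ha hn hn' g) x₀ z v) := by
    intro v
    refine (localForm_pullback_apply hz ((hg _).mdifferentiableAt (by simp)) hs
      (maurerCartan (E := E) (G := G)) v).symm.trans ?_
    exact congrArg (fun T : EM →L[ℝ] LieAlg E G => T (mfderiv 𝓘(ℝ, EM) 𝓘(ℝ, EM)
      (extChartAt 𝓘(ℝ, EM) x₀).symm z v)) (h ((extChartAt 𝓘(ℝ, EM) x₀).symm z)).2
  have h5 : localExtDeriv (pullbackForm (J := 𝓘(ℝ, EM)) g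
      (maurerCartan (E := E) (G := G))) x₀ z v w = -⁅_, _⁆ := h2.trans h3
  rw [h5]
  change a.projectionOnto _ (SymmetricDecomposition.isSplitting ha hn hn').left (-⁅localForm
    (maurerCartan (E := E) (G := G)) _ (chartMap 𝓘(ℝ, E) 𝓘(ℝ, EM) g x₀ _ z) _, localForm
    (maurerCartan (E := E) (G := G)) _ (chartMap 𝓘(ℝ, E) 𝓘(ℝ, EM) g x₀ _ z) _⁆) = 0
  rw [h4, h4, addLie_apply, addLie_apply, lie_add_lie_add ha, map_neg,
    (SymmetricDecomposition.isSplitting ha hn hn').left_apply, neg_zero]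

/-- Projecting g⁻¹dg = df + [df, V] to 𝔞 gives α = df, so f is a primitive of α. Conversely a
primitive is smooth and a local diffeomorphism, and flatness is the pulled-back structure equation.
-/
theorem isFramedSolution_iff {g : M → G} {V : M → D.m a} :
    IsFramedSolution (EM := EM) D g V ↔
      ContMDiff 𝓘(ℝ, EM) 𝓘(ℝ, E) ∞ g ∧ ContMDiff 𝓘(ℝ, EM) 𝓘(ℝ, D.m a) ∞ V ∧
        (∀ x, IsTangentAt (EM := EM) ha hn hn' g V x) ∧
        ∃ f : M → a, ∀ x, IsPrimitiveAt f (alphaForm (EM := EM) ha hn hn' g) x := by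
  constructor
  · rintro ⟨hg, f, hf, h⟩
    have hα : ∀ x, alphaForm (EM := EM) ha hn hn' g x = mvfderiv 𝓘(ℝ, EM) f x := by
      intro x
      refine ContinuousLinearMap.ext fun v => ?_
      have h1 : pullbackForm (J := 𝓘(ℝ, EM)) g (maurerCartan (E := E) (G := G)) x v =
          addLie a (V x : LieAlg E G) (mvfderiv 𝓘(ℝ, EM) f x v) :=
        congrArg (fun T : EM →L[ℝ] LieAlg E G => T v) (h x)
      rw [alphaForm_apply, h1, projectionOnto_addLie ha hn hn']
    refine ⟨hg, hf.smooth, fun x => ⟨?_, ?_⟩, f, fun x => ⟨?_, (hα x).symm⟩⟩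
    · rw [hα]
      exact ((hf.localDiffeo x).mfderivToContinuousLinearEquiv (by simp)).bijective
    · rw [hα]; exact h x
    · exact (hf.localDiffeo.contMDiff x).mdifferentiableAt (by simp)
  · rintro ⟨hg, hV, h, f, hf⟩
    have hfs : ContMDiff 𝓘(ℝ, EM) 𝓘(ℝ, a) ∞ f := contMDiff_of_isPrimitiveAt hf
      fun x₀ z hz => contDiffAt_localForm_alphaForm ha hn hn' hg x₀ hz
    have hform : ∀ x, pullbackForm (J := 𝓘(ℝ, EM)) g (maurerCartan (E := E) (G := G)) x =
        solutionForm (EM := EM) D f V x := by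
      intro x
      rw [(h x).2, ← (hf x).2]; rfl
    refine ⟨hg, f, ⟨?_, hV, ?_⟩, hform⟩
    · exact isLocalDiffeomorph_of_bijective hfs fun x => by rw [(hf x).2]; exact (h x).1
    · intro x v w
      rw [← (funext hform : pullbackForm (J := 𝓘(ℝ, EM)) g (maurerCartan (E := E) (G := G)) = _),
        extDerivOneForm_pullback_maurerCartan (hg x), neg_add_cancel]

theorem pullbackForm_maurerCartan_coe {g : M → G} (U : TopologicalSpace.Opens M) (u : U)
    (hg : MDifferentiableAt 𝓘(ℝ, EM) 𝓘(ℝ, E) g u) (v : TangentSpace 𝓘(ℝ, EM) u) :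
    pullbackForm (J := 𝓘(ℝ, EM)) (fun u : U => g u) (maurerCartan (E := E) (G := G)) u v =
      pullbackForm (J := 𝓘(ℝ, EM)) g (maurerCartan (E := E) (G := G)) (u : M)
        (mfderiv 𝓘(ℝ, EM) 𝓘(ℝ, EM) (Subtype.val : U → M) u v) := by
  have h1 : MDifferentiableAt 𝓘(ℝ, EM) 𝓘(ℝ, EM) (Subtype.val : U → M) u :=
    (contMDiff_subtype_val (n := ∞) u).mdifferentiableAt (by simp)
  have h2 := (hg.hasMFDerivAt.comp u h1.hasMFDerivAt).mfderiv
  exact congrArg (maurerCartan (g u)) (congrArg (fun T : EM →L[ℝ] E => T v) h2)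

theorem alphaForm_coe {g : M → G} (U : TopologicalSpace.Opens M) (u : U)
    (hg : MDifferentiableAt 𝓘(ℝ, EM) 𝓘(ℝ, E) g u) (v : TangentSpace 𝓘(ℝ, EM) u) :
    alphaForm (EM := EM) ha hn hn' (fun u : U => g u) u v = alphaForm ha hn hn' g (u : M)
        (mfderiv 𝓘(ℝ, EM) 𝓘(ℝ, EM) (Subtype.val : U → M) u v) :=
  congrArg (a.projectionOnto _ (SymmetricDecomposition.isSplitting ha hn hn').left)
    (pullbackForm_maurerCartan_coe U u hg v)

theorem isTangentAt_coe {g : M → G} {V : M → D.m a} (U : TopologicalSpace.Opens M) (u : U)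
    (hg : MDifferentiableAt 𝓘(ℝ, EM) 𝓘(ℝ, E) g u) :
    IsTangentAt (EM := EM) ha hn hn' (fun u : U => g u) (fun u => V u) u ↔
      IsTangentAt (EM := EM) ha hn hn' g V (u : M) := by
  have hb := bijective_mfderiv_coe (W := EM) U u
  have h1 : (alphaForm (EM := EM) ha hn hn' (fun u : U => g u) u : EM → a) =
      alphaForm ha hn hn' g (u : M) ∘ mfderiv 𝓘(ℝ, EM) 𝓘(ℝ, EM) (Subtype.val : U → M) u :=
    funext fun v => alphaForm_coe ha hn hn' U u hg v
  refine and_congr ?_ ⟨fun h => ContinuousLinearMap.ext fun w => ?_,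
    fun h => ContinuousLinearMap.ext fun v => ?_⟩
  · exact (iff_of_eq (congrArg Function.Bijective h1)).trans (Function.Bijective.of_comp_iff _ hb)
  · obtain ⟨v, rfl⟩ := hb.2 w
    refine (pullbackForm_maurerCartan_coe U u hg v).symm.trans ?_
    refine (congrArg (fun T : EM →L[ℝ] LieAlg E G => T v) h).trans ?_
    exact congrArg (addLie a (V u : LieAlg E G)) (alphaForm_coe ha hn hn' U u hg v)
  · refine (pullbackForm_maurerCartan_coe U u hg v).trans ?_
    refine (congrArg (fun T : EM →L[ℝ] LieAlg E G =>
      T (mfderiv 𝓘(ℝ, EM) 𝓘(ℝ, EM) (Subtype.val : U → M) u v)) h).trans ?_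
    exact congrArg (addLie a (V u : LieAlg E G)) (alphaForm_coe ha hn hn' U u hg v).symm

theorem isPrimitiveAt_coe {g : M → G} {f : M → a} (U : TopologicalSpace.Opens M) (u : U)
    (hg : MDifferentiableAt 𝓘(ℝ, EM) 𝓘(ℝ, E) g u)
    (hf : IsPrimitiveAt f (alphaForm (EM := EM) ha hn hn' g) (u : M)) :
    IsPrimitiveAt (fun u : U => f u) (alphaForm (EM := EM) ha hn hn' fun u : U => g u) u := by
  have h1 : MDifferentiableAt 𝓘(ℝ, EM) 𝓘(ℝ, EM) (Subtype.val : U → M) u :=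
    (contMDiff_subtype_val (n := ∞) u).mdifferentiableAt (by simp)
  have h2 := hf.1.hasMFDerivAt.comp u h1.hasMFDerivAt
  refine ⟨h2.mdifferentiableAt, ContinuousLinearMap.ext fun v => ?_⟩
  refine (congrArg (fun T : EM →L[ℝ] a => T v) h2.mfderiv).trans ?_
  refine Eq.trans ?_ (alphaForm_coe ha hn hn' U u hg v).symm
  exact congrArg (fun T : EM →L[ℝ] a =>
    T (mfderiv 𝓘(ℝ, EM) 𝓘(ℝ, EM) (Subtype.val : U → M) u v)) hf.2

variable {k : ℕ} (A : Basis (Fin k) ℝ a)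

theorem isIntegralManifold_of_isFramedSolution (hk : finrank ℝ EM = k) {g : M → G} {V : M → D.m a}
    (h : IsFramedSolution (EM := EM) D g V) :
    (terngEDS ha hn hn' A).IsIntegralManifold (EM := EM) fun x => (g x, V x) := by
  rw [isFramedSolution_iff ha hn hn'] at h
  rw [isIntegralManifold_iff ha hn hn' A hk]
  exact ⟨h.1, h.2.1, h.2.2.1⟩

theorem isIntegralManifold_iff_isFramedSolution [SimplyConnectedSpace M] (hk : finrank ℝ EM = k)
    {g : M → G} {V : M → D.m a} :
    (terngEDS ha hn hn' A).IsIntegralManifold (EM := EM) (fun x => (g x, V x)) ↔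
      IsFramedSolution (EM := EM) D g V := by
  refine ⟨fun h => ?_, isIntegralManifold_of_isFramedSolution ha hn hn' A hk⟩
  rw [isIntegralManifold_iff ha hn hn' A hk] at h
  rw [isFramedSolution_iff ha hn hn']
  have := FiniteDimensional.complete ℝ a
  exact ⟨h.1, h.2.1, h.2.2, exists_global_primitive
    (fun x₀ z hz => (contDiffAt_localForm_alphaForm ha hn hn' h.1 x₀ hz).differentiableAt (by simp))
    (fun x₀ z hz v w => localExtDeriv_alphaForm ha hn hn' h.1 h.2.2 x₀ hz v w)⟩

theorem isIntegralManifold_iff_locally_isFramedSolution (hk : finrank ℝ EM = k)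
    {g : M → G} {V : M → D.m a} :
    (terngEDS ha hn hn' A).IsIntegralManifold (EM := EM) (fun x => (g x, V x)) ↔
      ∀ x : M, ∃ U : TopologicalSpace.Opens M, x ∈ U ∧
        IsFramedSolution (EM := EM) (M := U) D (fun u => g u) (fun u => V u) := by
  rw [isIntegralManifold_iff ha hn hn' A hk]
  constructor
  · rintro ⟨hg, hV, h⟩ x
    have := FiniteDimensional.complete ℝ a
    obtain ⟨U, hU, hx, f, hf⟩ := exists_local_primitive x
      (fun z hz => (contDiffAt_localForm_alphaForm ha hn hn' hg x hz).differentiableAt (by simp))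
      (fun z hz v w => localExtDeriv_alphaForm ha hn hn' hg h x hz v w)
    refine ⟨⟨U, hU⟩, hx, (isFramedSolution_iff ha hn hn').2 ⟨?_, ?_, fun u => ?_,
      fun u => f u, fun u => ?_⟩⟩
    · exact hg.comp contMDiff_subtype_val
    · exact hV.comp contMDiff_subtype_val
    · exact (isTangentAt_coe ha hn hn' ⟨U, hU⟩ u ((hg u).mdifferentiableAt (by simp))).2 (h u)
    · exact isPrimitiveAt_coe ha hn hn' ⟨U, hU⟩ u ((hg u).mdifferentiableAt (by simp)) (hf u u.2)
  -- No gluing of the local functions f is needed: smoothness is local, and the remaining condition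
  -- is pointwise and does not involve f.
  · intro h
    choose U hU hfr using h
    simp only [isFramedSolution_iff ha hn hn'] at hfr
    have hg : ContMDiff 𝓘(ℝ, EM) 𝓘(ℝ, E) ∞ g := fun x =>
      contMDiffAt_subtype_iff.1 ((hfr x).1 ⟨x, hU x⟩)
    refine ⟨hg, fun x => contMDiffAt_subtype_iff.1 ((hfr x).2.1 ⟨x, hU x⟩), fun x => ?_⟩
    exact (isTangentAt_coe ha hn hn' (U x) ⟨x, hU x⟩ ((hg x).mdifferentiableAt (by simp))).1
      ((hfr x).2.2.1 ⟨x, hU x⟩)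

end Framed

/-! ### Solutions on open subsets of `𝔞` -/

section ModelSpace

variable {W F : Type*} [NormedAddCommGroup W] [NormedSpace ℝ W] [NormedAddCommGroup F]
  [NormedSpace ℝ F]

theorem localForm_modelSpace (η : W → W →L[ℝ] F) (y₀ : W) :
    localForm (I := 𝓘(ℝ, W)) (N := W) η y₀ = η := by
  funext z
  refine ContinuousLinearMap.ext fun v => ?_
  have h : ((extChartAt 𝓘(ℝ, W) y₀).symm : W → W) = id := by simp [chartAt_self_eq]
  have h1 : mfderiv 𝓘(ℝ, W) 𝓘(ℝ, W) (extChartAt 𝓘(ℝ, W) y₀).symm z v = v := by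
    rw [h, mfderiv_id]; rfl
  have h2 : ∀ z' (_ : z' = z) (u : W), u = v → η z' u = η z v := by rintro z' rfl u rfl; rfl
  exact h2 _ (congrFun h z) _ h1

theorem extDerivOneForm_modelSpace (η : W → W →L[ℝ] F) (y v w : W) :
    extDerivOneForm (I := 𝓘(ℝ, W)) (N := W) η y v w = fderiv ℝ η y v w - fderiv ℝ η y w v := by
  have h : (extChartAt 𝓘(ℝ, W) y : W → W) = id := by simp [chartAt_self_eq]
  have h1 : ∀ v : W, mvfderiv 𝓘(ℝ, W) (extChartAt 𝓘(ℝ, W) y) y v = v := by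
    intro v
    refine (mvfderiv_apply _ _ _).trans ?_
    rw [h, mfderiv_id]; rfl
  unfold extDerivOneForm localExtDeriv
  rw [localForm_modelSpace, h1, h1, h]
  rfl

theorem hasFDerivAt_const_add_clm_comp {Z : Type*} [NormedAddCommGroup Z] [NormedSpace ℝ Z]
    (c : Z) (T : F →L[ℝ] Z) {f : W → F} {x : W} (hf : DifferentiableAt ℝ f x) :
    HasFDerivAt (fun x => c + T (f x)) (T.comp (fderiv ℝ f x)) x :=
  (T.hasFDerivAt.comp x hf.hasFDerivAt).const_add c

end ModelSpace

section Solution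

variable {E : Type*} [NormedAddCommGroup E] [NormedSpace ℝ E] [FiniteDimensional ℝ E]
  {G : Type*} [TopologicalSpace G] [ChartedSpace E G] [Group G] [LieGroup 𝓘(ℝ, E) ∞ G]
  {D : SymmetricDecomposition (LieAlg E G)} {a : Submodule ℝ (LieAlg E G)}

variable (D a) in
/-- The bilinear map `(V, B) ↦ [B, V]`. -/
def lieCLM : D.m a →L[ℝ] a →L[ℝ] LieAlg E G :=
  LinearMap.toContinuousLinearMap (((LinearMap.toContinuousLinearMap :
    (a →ₗ[ℝ] LieAlg E G) ≃ₗ[ℝ] (a →L[ℝ] LieAlg E G)).toLinearMap).comp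
      (LinearMap.mk₂ ℝ (fun (V : D.m a) (B : a) => ⁅(B : LieAlg E G), (V : LieAlg E G)⁆)
        (fun V V' B => by simp) (fun c V B => by simp)
        (fun V B B' => by simp) (fun c V B => by simp)))

theorem lieCLM_apply (V : D.m a) (B : a) :
    lieCLM D a V B = ⁅(B : LieAlg E G), (V : LieAlg E G)⁆ := rfl

/-- The form is affine in V, so its derivative along V is a fixed bilinear map. -/
theorem addLie_eq (V : D.m a) : addLie a (V : LieAlg E G) = addLie a 0 + lieCLM D a V := by
  refine ContinuousLinearMap.ext fun B => ?_
  rw [add_apply, addLie_apply, addLie_apply, lieCLM_apply, lie_zero, add_zero]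

theorem hasFDerivAt_addLie {V : a → D.m a} {x : a} (hV : DifferentiableAt ℝ V x) :
    HasFDerivAt (fun x => addLie a (V x : LieAlg E G)) ((lieCLM D a).comp (fderiv ℝ V x)) x := by
  have h : (fun x => addLie a (V x : LieAlg E G)) = fun x => addLie a 0 + lieCLM D a (V x) :=
    funext fun x => addLie_eq (V x)
  rw [h]
  exact hasFDerivAt_const_add_clm_comp (Z := a →L[ℝ] LieAlg E G) _ (lieCLM D a) hV

/-- The 1-form `dx + [dx, V]` is flat at `x` if and only if `V` satisfies the equations there. -/
theorem flat_iff (ha : D.IsCartanSubspace a) {k : ℕ} (A : Basis (Fin k) ℝ a) {V : a → D.m a} {x : a}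
    (hV : DifferentiableAt ℝ V x) :
    (∀ v w : a, extDerivOneForm (I := 𝓘(ℝ, a)) (N := a) (fun x => addLie a (V x : LieAlg E G)) x v w +
      ⁅addLie a (V x : LieAlg E G) v, addLie a (V x : LieAlg E G) w⁆ = 0) ↔
    ∀ i j : Fin k, i ≠ j →
      ⁅(A i : LieAlg E G), (fderiv ℝ V x (A j) : LieAlg E G)⁆ -
          ⁅(A j : LieAlg E G), (fderiv ℝ V x (A i) : LieAlg E G)⁆ =
        ⁅⁅(A i : LieAlg E G), (V x : LieAlg E G)⁆, ⁅(A j : LieAlg E G), (V x : LieAlg E G)⁆⁆ := by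
  have h1 : ∀ v w : a, extDerivOneForm (I := 𝓘(ℝ, a)) (N := a)
      (fun x => addLie a (V x : LieAlg E G)) x v w +
      ⁅addLie a (V x : LieAlg E G) v, addLie a (V x : LieAlg E G) w⁆ =
      ⁅(w : LieAlg E G), (fderiv ℝ V x v : LieAlg E G)⁆ -
      ⁅(v : LieAlg E G), (fderiv ℝ V x w : LieAlg E G)⁆ +
      ⁅⁅(v : LieAlg E G), (V x : LieAlg E G)⁆, ⁅(w : LieAlg E G), (V x : LieAlg E G)⁆⁆ := by
    intro v w
    -- The subspace 𝔫 enters `lie_add_lie_add` only through the type of a zero summand, so the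
    -- choice ⊥ is arbitrary.
    rw [extDerivOneForm_modelSpace, (hasFDerivAt_addLie hV).fderiv, addLie_apply, addLie_apply,
      lie_add_lie_add (n := ⊥) ha]
    simp only [Submodule.coe_zero, zero_add, add_zero]
    rfl
  -- The left-hand side of the flatness equation is bilinear and vanishes on the diagonal, so it is
  -- enough to test it on pairs of distinct basis vectors.
  let B : a →ₗ[ℝ] a →ₗ[ℝ] LieAlg E G := LinearMap.mk₂ ℝ (fun v w =>
      ⁅(w : LieAlg E G), (fderiv ℝ V x v : LieAlg E G)⁆ -
      ⁅(v : LieAlg E G), (fderiv ℝ V x w : LieAlg E G)⁆ +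
      ⁅⁅(v : LieAlg E G), (V x : LieAlg E G)⁆, ⁅(w : LieAlg E G), (V x : LieAlg E G)⁆⁆)
    (fun v v' w => by simp only [map_add, Submodule.coe_add, add_lie, lie_add]; abel)
    (fun c v w => by
      simp only [map_smul, Submodule.coe_smul, smul_lie, lie_smul, smul_add, smul_sub])
    (fun v w w' => by simp only [map_add, Submodule.coe_add, add_lie, lie_add]; abel)
    (fun c v w => by
      simp only [map_smul, Submodule.coe_smul, smul_lie, lie_smul, smul_add, smul_sub])
  have hB : ∀ v w : a, B v w = ⁅(w : LieAlg E G), (fderiv ℝ V x v : LieAlg E G)⁆ -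
      ⁅(v : LieAlg E G), (fderiv ℝ V x w : LieAlg E G)⁆ +
      ⁅⁅(v : LieAlg E G), (V x : LieAlg E G)⁆, ⁅(w : LieAlg E G), (V x : LieAlg E G)⁆⁆ :=
    fun v w => rfl
  simp only [h1, ← hB]
  constructor
  · intro h i j _
    have h2 := h (A i) (A j)
    rw [hB, ← neg_sub, neg_add_eq_zero] at h2
    exact h2
  · intro h
    have h2 : B = 0 := by
      refine A.ext fun i => A.ext fun j => ?_
      rw [hB]
      by_cases hij : i = j
      · subst hij; simp
      · rw [← h i j hij]; simp
    intro v w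
    rw [h2]; rfl

theorem isSolution_iff (ha : D.IsCartanSubspace a) {k : ℕ} (A : Basis (Fin k) ℝ a)
    (U : TopologicalSpace.Opens a) (V : a → D.m a) :
    IsSolution D A U V ↔
      IsGeneralizedSolution (EM := a) (M := U) D (fun u => (u : a)) fun u => V u := by
  have hsmooth : ContDiffOn ℝ ∞ V U ↔
      ContMDiff 𝓘(ℝ, a) 𝓘(ℝ, D.m a) ∞ (fun u : U => V u) := by
    constructor
    · intro h u
      exact contMDiffAt_subtype_iff.2 (h.contDiffAt (U.isOpen.mem_nhds u.2)).contMDiffAt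
    · intro h x hx
      exact (contMDiffAt_iff_contDiffAt.1
        (contMDiffAt_subtype_iff.1 (h ⟨x, hx⟩))).contDiffWithinAt
  have hflat : ContDiffOn ℝ ∞ V U →
      ((∀ x ∈ U, ∀ i j : Fin k, i ≠ j →
        ⁅(A i : LieAlg E G), (fderiv ℝ V x (A j) : LieAlg E G)⁆ -
          ⁅(A j : LieAlg E G), (fderiv ℝ V x (A i) : LieAlg E G)⁆ =
        ⁅⁅(A i : LieAlg E G), (V x : LieAlg E G)⁆, ⁅(A j : LieAlg E G), (V x : LieAlg E G)⁆⁆) ↔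
      IsFlat (solutionForm (EM := a) (M := U) D (fun u => (u : a)) fun u => V u)) := by
    intro hV
    have hd : ∀ x ∈ U, DifferentiableAt ℝ V x := fun x hx =>
      (hV.contDiffAt (U.isOpen.mem_nhds hx)).differentiableAt (by simp)
    -- The form on U is the pull-back under the inclusion of a form on 𝔞, where the exterior
    -- derivative is a plain antisymmetrized derivative.
    have hform : solutionForm (EM := a) (M := U) D (fun u => (u : a)) (fun u => V u) =
        pullbackForm (J := 𝓘(ℝ, a)) (I := 𝓘(ℝ, a)) (Subtype.val : U → a)
          (fun x => addLie a (V x : LieAlg E G)) := rfl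
    have hext : ∀ (u : U) (v w : TangentSpace 𝓘(ℝ, a) u), extDerivOneForm
        (solutionForm (EM := a) (M := U) D (fun u => (u : a)) (fun u => V u)) u v w +
        ⁅solutionForm (EM := a) (M := U) D (fun u => (u : a)) (fun u => V u) u v,
          solutionForm (EM := a) (M := U) D (fun u => (u : a)) (fun u => V u) u w⁆ =
        extDerivOneForm (I := 𝓘(ℝ, a)) (N := a) (fun x => addLie a (V x : LieAlg E G)) (u : a)
          (mfderiv 𝓘(ℝ, a) 𝓘(ℝ, a) (Subtype.val : U → a) u v)
          (mfderiv 𝓘(ℝ, a) 𝓘(ℝ, a) (Subtype.val : U → a) u w) +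
        ⁅addLie a (V u : LieAlg E G) (mfderiv 𝓘(ℝ, a) 𝓘(ℝ, a) (Subtype.val : U → a) u v),
          addLie a (V u : LieAlg E G) (mfderiv 𝓘(ℝ, a) 𝓘(ℝ, a) (Subtype.val : U → a) u w)⁆ := by
      intro u v w
      rw [hform]
      refine congrArg₂ (fun X Y : LieAlg E G => X + Y) (extDerivOneForm_pullback (J := 𝓘(ℝ, a))
        (contMDiff_subtype_val u) (mem_extChartAt_source (u : a)) ?_ v w) rfl
      rw [localForm_modelSpace]
      have h : extChartAt 𝓘(ℝ, a) (u : a) (u : a) = u := by simp [chartAt_self_eq]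
      rw [h]
      exact (hasFDerivAt_addLie (hd u u.2)).differentiableAt
    constructor
    · intro h u v w
      rw [hext]
      exact (flat_iff ha A (hd u u.2)).2 (h u u.2) _ _
    · intro h x hx
      refine (flat_iff ha A (hd x hx)).1 fun v w => ?_
      have hb := bijective_mfderiv_coe (W := a) U ⟨x, hx⟩
      obtain ⟨v, rfl⟩ := hb.2 v
      obtain ⟨w, rfl⟩ := hb.2 w
      exact (hext ⟨x, hx⟩ v w).symm.trans (h ⟨x, hx⟩ v w)
  constructor
  · intro h
    refine ⟨?_, hsmooth.1 h.smooth, (hflat h.smooth).1 h.equation⟩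
    exact isLocalDiffeomorph_of_bijective contMDiff_subtype_val
      fun u => bijective_mfderiv_coe (W := a) U u
  · intro h
    have h1 := hsmooth.2 h.smooth
    exact ⟨h1, (hflat h1).2 h.flat⟩

end Solution

end TerngSystem

end

/-! ### Assembly of the theorem -/

theorem mainTheorem7 {E : Type*} [NormedAddCommGroup E] [NormedSpace ℝ E] [FiniteDimensional ℝ E]
    {G : Type*} [TopologicalSpace G] [ChartedSpace E G] [Group G] [LieGroup 𝓘(ℝ, E) ∞ G]
    [LieAlgebra.IsSemisimple ℝ (TerngSystem.LieAlg E G)]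
    (D : TerngSystem.SymmetricDecomposition (TerngSystem.LieAlg E G))
    (a n : Submodule ℝ (TerngSystem.LieAlg E G)) (ha : D.IsCartanSubspace a)
    (hn : D.b a ⊔ n = D.g₀) (hn' : Disjoint (D.b a) n)
    (k : ℕ) (A : Module.Basis (Fin k) ℝ a)
    (hA : ∀ i, D.IsRegular (A i : TerngSystem.LieAlg E G)) :
    -- the integral manifolds are the framed solutions
    (∀ {EM : Type*} [NormedAddCommGroup EM] [NormedSpace ℝ EM] [FiniteDimensional ℝ EM]
        {M : Type*} [TopologicalSpace M] [T2Space M] [SecondCountableTopology M]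
        [ChartedSpace EM M] [IsManifold 𝓘(ℝ, EM) ∞ M],
        Module.finrank ℝ EM = k → ∀ (g : M → G) (V : M → D.m a),
      (TerngSystem.IsFramedSolution (EM := EM) D g V →
        (TerngSystem.terngEDS ha hn hn' A).IsIntegralManifold (EM := EM) fun x => (g x, V x)) ∧
      ((TerngSystem.terngEDS ha hn hn' A).IsIntegralManifold (EM := EM) (fun x => (g x, V x)) ↔
        ∀ x : M, ∃ U : TopologicalSpace.Opens M, x ∈ U ∧
          TerngSystem.IsFramedSolution (EM := EM) (M := U) D (fun u => g u) (fun u => V u)) ∧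
      (SimplyConnectedSpace M →
        ((TerngSystem.terngEDS ha hn hn' A).IsIntegralManifold (EM := EM) (fun x => (g x, V x)) ↔
          TerngSystem.IsFramedSolution (EM := EM) D g V))) ∧
    -- on an open subset of `𝔞`, the generalized solutions over the inclusion are the solutions
    (∀ (U : TopologicalSpace.Opens a) (V : a → D.m a),
      TerngSystem.IsSolution D A U V ↔
        TerngSystem.IsGeneralizedSolution (EM := a) (M := U) D (fun u => (u : a)) fun u => V u) ∧
    -- involution, and the generality of the solutions
    (TerngSystem.terngEDS ha hn hn' A).InInvolution ∧
    (TerngSystem.terngEDS ha hn hn' A).GeneralSolutionDependsOn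
      (Module.finrank ℝ (D.m a)) 1 := by
  -- Cartan's criterion: in characteristic zero, a semisimple Lie algebra has a nondegenerate
  -- Killing form.
  have hI : LieAlgebra.IsKilling ℝ (TerngSystem.LieAlg E G) := inferInstance
  refine ⟨?_, TerngSystem.isSolution_iff ha A,
    TerngSystem.inInvolution_terngEDS ha hn hn' A hA,
    TerngSystem.generalSolutionDependsOn_terngEDS ha hn hn' A hA⟩
  intro EM _ _ _ M _ _ _ _ _ hk g V
  exact ⟨TerngSystem.isIntegralManifold_of_isFramedSolution ha hn hn' A hk,
    TerngSystem.isIntegralManifold_iff_locally_isFramedSolution ha hn hn' A hk,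
    fun _ => TerngSystem.isIntegralManifold_iff_isFramedSolution ha hn hn' A hk⟩
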